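/- Fix $\rho\in(0,1)$. The environment is one of the following two processes $\eta=(\eta_t(x);\,x\in\mathbb Z)_{t\ge 0}$. (EP) The simple symmetric exclusion process with rate $\gamma>0$: the $\eta_0(x)$, $x\in\mathbb Z$, are i.i.d. Bernoulli variables with mean $\rho$; independently, the edges $\{x,x+1\}$ of $\mathbb Z$ carry independent Poisson point processes of rate $\gamma$ on the time axis, and at each arrival on $\{x,x+1\}$ the occupations of $x$ and $x+1$ are exchanged. Its law is $\mathbf P^\rho_{EP}$. (RW) The Poisson cloud of random walks with laziness $q\in(0,1)$: the $\eta_0(x)$, $x\in\mathbb Z$, are i.i.d. Poisson variables with mean $-\ln(1-\rho)$; from each $x$ start $\eta_0(x)$ walks, all independent, that jump at integer times by $-1,0,1$ with probabilities $(1-q)/2,\,q,\,(1-q)/2$; and $\eta_t(y)$ is the number of walks at $y$ at time $t$. Its law is $\mathbf P^\rho_{RW}$. A real function of the trajectory $\eta$ is supported on $B\subset\mathbb R^2$ if it is measurable with respect to $\sigma\big(\eta_t(x):(x,t)\in B\cap(\mathbb Z\times\mathbb R_+)\big)$. For $y=(\pi_1(y),\pi_2(y))\in\mathbb R^2$, $\pi_1$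 is the space and $\pi_2$ the time coordinate. **Proposition.** Consider the environment with law $\mathbf P^\rho_{EP}$ or $\mathbf P^\rho_{RW}$. There is a constant $c>0$, depending only on the law of the environment (on $\rho,\gamma$, respectively $\rho,q$), such that the following holds. Let $H\ge 1$ and let $y_1,y_2\in\mathbb R^2$ satisfy $\pi_2(y_1)=\pi_2(y_2)$ and $$\pi_1(y_2)-\pi_1(y_1)\ge H^{3/4}.$$ Let $B_1=y_1+[-H,0]\times[0,H]$ and $B_2=y_2+[0,H]\times[0,H]$. Then for all functions $f_1,f_2$ with values in $[0,1]$ that are supported on $B_1$ and $B_2$ respectively, $$\mathrm{Cov}_\rho(f_1,f_2)\le c\,e^{-H^{1/4}}.$$ -/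

import Mathlib

open MeasureTheory ProbabilityTheory Set
open scoped NNReal ENNReal

/-! ## Trajectories, boxes, and functions supported on a box -/

/-- Trajectories `η = (η_t(x))`, `t ∈ ℝ₊`, `x ∈ ℤ`, of a particle system with single-site state
space `S`, written `η t x`. The space carries the σ-algebra generated by the coordinates
`η ↦ η t x` (Mathlib's product σ-algebra); on càdlàg trajectories this is the usual one. -/
abbrev Trajectory (S : Type*) : Type _ := ℝ≥0 → ℤ → S

/-- The σ-algebra generated by the `η t x` with `(x, t) ∈ B ∩ (ℤ × ℝ₊)`. A function of the
environment is supported on `B` if it is measurable with respect to this σ-algebra. Points of the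
plane are written `(space, time)`. -/
@[reducible]
def boxSigma {S : Type*} [MeasurableSpace S] (B : Set (ℝ × ℝ)) : MeasurableSpace (Trajectory S) :=
  ⨆ (x : ℤ) (t : ℝ≥0) (_ : ((x : ℝ), (t : ℝ)) ∈ B),
    MeasurableSpace.comap (fun η : Trajectory S => η t x) inferInstance

/-- `f` is supported on `B`. -/
def SupportedOn {S : Type*} [MeasurableSpace S] (f : Trajectory S → ℝ) (B : Set (ℝ × ℝ)) : Prop :=
  Measurable[boxSigma B] f

/-- The box `y + [-H, 0] × [0, H]`. -/
def leftBox (H : ℝ) (y : ℝ × ℝ) : Set (ℝ × ℝ) := Icc (y.1 - H) y.1 ×ˢ Icc y.2 (y.2 + H)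

/-- The box `y + [0, H] × [0, H]`. -/
def rightBox (H : ℝ) (y : ℝ × ℝ) : Set (ℝ × ℝ) := Icc y.1 (y.1 + H) ×ˢ Icc y.2 (y.2 + H)

/-! ## The simple symmetric exclusion process (graphical construction) -/

namespace SSEP

/-- A sample point: the initial configuration, and for every edge `{x, x + 1}` (indexed by `x`) the
sequence of the waiting times between the successive arrivals on this edge. -/
abbrev Sample : Type := (ℤ → Fin 2) × (ℤ → ℕ → ℝ)

/-- The Bernoulli law on `{0, 1}` with mean `ρ`. -/
noncomputable def siteLaw (ρ : ℝ) : Measure (Fin 2) :=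
  ENNReal.ofReal ρ • Measure.dirac 1 + ENNReal.ofReal (1 - ρ) • Measure.dirac 0

/-- All initial occupation variables and all waiting times are independent; the former are
Bernoulli with mean `ρ`, the latter exponential with rate `γ`. So the arrivals on the edges form
independent Poisson point processes of rate `γ`. -/
noncomputable def sampleLaw (γ ρ : ℝ) : Measure Sample :=
  (Measure.infinitePi fun _ : ℤ => siteLaw ρ).prod
    (Measure.infinitePi fun _ : ℤ => Measure.infinitePi fun _ : ℕ => expMeasure γ)

/-- The `i`-th arrival time (`i = 0, 1, 2, …`) on the edge `{x, x + 1}`. -/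
noncomputable def arrival (ω : Sample) (x : ℤ) (i : ℕ) : ℝ := ∑ j ∈ Finset.range (i + 1), ω.2 x j

/-- The first arrival on the edge `{x, x + 1}` strictly after time `s` (`⊤` if there is none). -/
noncomputable def nextArrival (ω : Sample) (x : ℤ) (s : EReal) : EReal :=
  ⨅ i : ℕ, if s < (arrival ω x i : EReal) then (arrival ω x i : EReal) else ⊤

/-- One move of whatever sits at `p.1` just after time `p.2`: it stays there until the first arrival
on one of the two edges touching `p.1`, and is then carried across that edge. (With probability one,
no two arrivals ever coincide.) -/
noncomputable def move (ω : Sample) (p : ℤ × EReal) : ℤ × EReal :=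
  if nextArrival ω p.1 p.2 ≤ nextArrival ω (p.1 - 1) p.2
  then (p.1 + 1, nextArrival ω p.1 p.2)
  else (p.1 - 1, nextArrival ω (p.1 - 1) p.2)

/-- The state, after `k` moves, of what sits at `z` at time `0`: its position, and the time of its
`k`-th move. -/
noncomputable def chain (ω : Sample) (z : ℤ) (k : ℕ) : ℤ × EReal := (move ω)^[k] (z, 0)

/-- What sits at `z` at time `0` sits at `x` at time `t`: for some `k` it has made exactly `k` moves
by time `t`, and these have brought it to `x`. -/
def SitsAt (ω : Sample) (z : ℤ) (t : ℝ≥0) (x : ℤ) : Prop :=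
  ∃ k : ℕ, (chain ω z k).1 = x ∧ (chain ω z k).2 ≤ ((t : ℝ) : EReal) ∧
    ((t : ℝ) : EReal) < (chain ω z (k + 1)).2

open Classical in
/-- The exclusion process: at each arrival on `{x, x + 1}` the contents of `x` and `x + 1` are
exchanged, so `η_t(x) = 1` exactly if what sits at `x` at time `t` is a particle that was
initially present somewhere. -/
noncomputable def env (ω : Sample) : Trajectory (Fin 2) := fun t x =>
  if ∃ z : ℤ, ω.1 z = 1 ∧ SitsAt ω z t x then 1 else 0

/-- The law of the exclusion process with density `ρ` and rate `γ`. -/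
noncomputable def law (γ ρ : ℝ) : Measure (Trajectory (Fin 2)) := (sampleLaw γ ρ).map env

theorem measurable_arrival (x : ℤ) (i : ℕ) : Measurable fun ω : Sample => arrival ω x i := by
  unfold arrival
  fun_prop

theorem measurable_nextArrival (x : ℤ) :
    Measurable fun q : Sample × EReal => nextArrival q.1 x q.2 := by
  unfold nextArrival
  refine Measurable.iInf fun i => ?_
  have h : Measurable fun q : Sample × EReal => (arrival q.1 x i : EReal) :=
    measurable_coe_real_ereal.comp ((measurable_arrival x i).comp measurable_fst)
  exact Measurable.ite (measurableSet_lt measurable_snd h) h measurable_const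

theorem measurable_move : Measurable fun q : Sample × (ℤ × EReal) => move q.1 q.2 := by
  have hn : Measurable fun q : Sample × (ℤ × EReal) => nextArrival q.1 q.2.1 q.2.2 := by
    have : Measurable fun q : ℤ × (Sample × EReal) => nextArrival q.2.1 q.1 q.2.2 :=
      measurable_from_prod_countable_right fun x => measurable_nextArrival x
    exact this.comp (f := fun q : Sample × (ℤ × EReal) => (q.2.1, (q.1, q.2.2))) (by fun_prop)
  have hn' : Measurable fun q : Sample × (ℤ × EReal) => nextArrival q.1 (q.2.1 - 1) q.2.2 :=
    hn.comp (f := fun q : Sample × (ℤ × EReal) => (q.1, (q.2.1 - 1, q.2.2)))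
      (by fun_prop)
  unfold move
  exact Measurable.ite (measurableSet_le hn hn')
    (Measurable.prodMk (by fun_prop) hn) (Measurable.prodMk (by fun_prop) hn')

theorem measurable_chain (z : ℤ) (k : ℕ) : Measurable fun ω : Sample => chain ω z k := by
  induction k with
  | zero => exact measurable_const
  | succ k ih =>
    have h : (fun ω : Sample => chain ω z (k + 1)) = fun ω => move ω (chain ω z k) := by
      funext ω
      simp only [chain, Function.iterate_succ_apply']
    rw [h]
    exact measurable_move.comp (measurable_id.prodMk ih)

/-- The construction is a random variable, so that `law` is its law. -/
theorem measurable_env : Measurable env := by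
  classical
  refine measurable_pi_lambda _ fun t => measurable_pi_lambda _ fun x => ?_
  unfold env
  refine Measurable.ite ?_ measurable_const measurable_const
  simp only [SitsAt, ofPred_exists, ofPred_and]
  refine MeasurableSet.iUnion fun z => MeasurableSet.inter ?_ (MeasurableSet.iUnion fun k => ?_)
  · exact measurableSet_eq_fun (by fun_prop) measurable_const
  · refine MeasurableSet.inter ?_ (MeasurableSet.inter ?_ ?_)
    · exact measurableSet_eq_fun (measurable_chain z k).fst measurable_const
    · exact measurableSet_le (measurable_chain z k).snd measurable_const
    · exact measurableSet_lt measurable_const (measurable_chain z (k + 1)).snd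

theorem isProbabilityMeasure_law {γ ρ : ℝ} (hγ : 0 < γ) (hρ₀ : 0 < ρ) (hρ₁ : ρ < 1) :
    IsProbabilityMeasure (law γ ρ) := by
  have h₁ : IsProbabilityMeasure (siteLaw ρ) := by
    constructor
    simp [siteLaw, ← ENNReal.ofReal_add hρ₀.le (sub_nonneg.2 hρ₁.le)]
  have h₂ := isProbabilityMeasure_expMeasure hγ
  unfold law sampleLaw
  exact Measure.isProbabilityMeasure_map measurable_env.aemeasurable

end SSEP

/-! ## The Poisson cloud of independent lazy random walks -/

namespace PCRW

/-- A sample point: the initial numbers of particles, and for every site `x` and every label `i` the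
sequence of the steps of the `i`-th walk started at `x`. -/
abbrev Sample : Type := (ℤ → ℕ) × (ℤ → ℕ → ℕ → ℤ)

/-- The law of one step: `-1, 0, 1` with probabilities `(1 - q) / 2, q, (1 - q) / 2`. -/
noncomputable def stepLaw (q : ℝ) : Measure ℤ :=
  ENNReal.ofReal ((1 - q) / 2) • Measure.dirac (-1) + ENNReal.ofReal q • Measure.dirac 0
    + ENNReal.ofReal ((1 - q) / 2) • Measure.dirac 1

/-- All initial numbers and all steps are independent; the former are Poisson with mean
`-ln (1 - ρ)`. -/
noncomputable def sampleLaw (q ρ : ℝ) : Measure Sample :=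
  (Measure.infinitePi fun _ : ℤ => poissonMeasure (Real.toNNReal (-Real.log (1 - ρ)))).prod
    (Measure.infinitePi fun _ : ℤ => Measure.infinitePi fun _ : ℕ =>
      Measure.infinitePi fun _ : ℕ => stepLaw q)

/-- The position at time `t` of the `i`-th walk started at `x`; it jumps at integer times only. -/
noncomputable def walk (ω : Sample) (x : ℤ) (i : ℕ) (t : ℝ≥0) : ℤ :=
  x + ∑ n ∈ Finset.range ⌊t⌋₊, ω.2 x i n

/-- `η_t(y)` is the number of pairs `(x, i)` with `1 ≤ i ≤ η_0(x)` whose walk is at `y` at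
time `t`. -/
noncomputable def env (ω : Sample) : Trajectory ℕ := fun t y =>
  {p : ℤ × ℕ | 1 ≤ p.2 ∧ p.2 ≤ ω.1 p.1 ∧ walk ω p.1 p.2 t = y}.ncard

/-- The law of the Poisson cloud with density parameter `ρ` and laziness `q`. -/
noncomputable def law (q ρ : ℝ) : Measure (Trajectory ℕ) := (sampleLaw q ρ).map env

/-- The construction is a random variable, so that `law` is its law. -/
theorem measurable_env : Measurable env := by
  refine measurable_pi_lambda _ fun t => measurable_pi_lambda _ fun y => ?_
  unfold env
  refine measurable_ncard.comp (measurable_set_iff.2 fun p => ?_)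
  have h : Measurable fun ω : Sample => walk ω p.1 p.2 t := by
    unfold walk
    fun_prop
  have h' : Measurable fun ω : Sample => ω.1 p.1 := by fun_prop
  refine measurableSet_setOfPred.1 ?_
  exact (MeasurableSet.const (1 ≤ p.2)).inter
    ((measurableSet_le measurable_const h').inter (measurableSet_eq_fun h measurable_const))

theorem isProbabilityMeasure_law {q ρ : ℝ} (hq₀ : 0 < q) (hq₁ : q < 1) :
    IsProbabilityMeasure (law q ρ) := by
  have h₁ : IsProbabilityMeasure (stepLaw q) := by
    constructor
    have : 0 ≤ (1 - q) / 2 := by linarith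
    simp [stepLaw, ← ENNReal.ofReal_add, this, hq₀.le, add_nonneg]
    ring_nf
  unfold law sampleLaw
  exact Measure.isProbabilityMeasure_map measurable_env.aemeasurable

end PCRW

/-! ## Functions supported on a box -/

/-! Write H = h⁴. The boxes are at least h³ apart, whereas during time H a particle typically moves
a distance of order h². If no particle crosses about half of the gap, the two boxes see independent
randomness, so it suffices to bound the crossing probability. An exponential moment with parameter l
of order h⁻² does this: l²H stays bounded, and half of the gap contributes a factor exp(-2h). The
sums over sites and over times cost a factor of order h⁶, which is absorbed by exp(h).

Exclusion. Follow the labels stirred by the clocks. At time s they are rearranged by a permutation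
of ℤ that depends on the clocks only. The Bernoulli configuration therefore remains Bernoulli,
jointly with the restarted clocks (`measurePreserving_restart`), and the boxes may be assumed to
start at time 0. If no label crosses, the left box is determined by the initial occupations and
clocks on the left of the midpoint, and the right box by those on the right. Glueing the left half
of one sample to the right half of an independent sample preserves the law, so the covariance is at
most a multiple of the crossing probability (`covariance_le_of_mix`, `covariance_le_of_crossing`).
For the crossing probability, let X_k and T_k be the position and the time of a label after k moves.
By the memoryless property at the first arrival (`lintegral_first_arrival`), E exp(l X_k - θ T_k) is
geometric in k (`lintegral_weight_rchain`). Summing over k and applying Markov's inequality controls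
the whole path up to time H.

Random walks. Sort the walks by their side of the midpoint at the time s when the boxes begin. By
Poisson thinning the two classes are independent (`indepFun_envOn_compl`). This is checked on
Fourier transforms, where it reduces to the fact that each walk belongs to one class only. If no
walk crosses, each box sees a single class (`covariance_le_of_indepFun`). The expected number of
crossing walks is a sum over starting points x (`tsum_stepsLaw_crosses_le`). The weight exp(-l|x + S
- M|) has a bounded sum over x whatever the displacement S up to time s is, so the bound is uniform
in s. -/

theorem boxSigma_le {S : Type*} [MeasurableSpace S] (B : Set (ℝ × ℝ)) :
    boxSigma (S := S) B ≤ MeasurableSpace.pi := by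
  refine iSup_le fun x => iSup_le fun t => iSup_le fun _ => ?_
  refine Measurable.comap_le ?_
  fun_prop

theorem SupportedOn.measurable {S : Type*} [MeasurableSpace S] {f : Trajectory S → ℝ}
    {B : Set (ℝ × ℝ)} (hf : SupportedOn f B) : Measurable f :=
  Measurable.mono hf (boxSigma_le B) le_rfl

/-- The σ-algebra of the box is contained in the one pulled back by restriction to the space-time
points of `B`, and a real function measurable for a pulled back σ-algebra factors through the map.
This turns measurability into dependence on values. -/
theorem SupportedOn.congr {S : Type*} [MeasurableSpace S] {f : Trajectory S → ℝ}
    {B : Set (ℝ × ℝ)} (hf : SupportedOn f B) {η η' : Trajectory S}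
    (h : ∀ (x : ℤ) (t : ℝ≥0), ((x : ℝ), (t : ℝ)) ∈ B → η t x = η' t x) : f η = f η' := by
  let r : Trajectory S → ({p : ℤ × ℝ≥0 // ((p.1 : ℝ), (p.2 : ℝ)) ∈ B} → S) :=
    fun η p => η p.1.2 p.1.1
  have hle : boxSigma (S := S) B ≤ MeasurableSpace.comap r MeasurableSpace.pi := by
    refine iSup_le fun x => iSup_le fun t => iSup_le fun hxt => ?_
    rintro _ ⟨s, hs, rfl⟩
    exact ⟨(fun u => u ⟨(x, t), hxt⟩) ⁻¹' s, measurable_pi_apply _ hs, rfl⟩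
  have hf' : Measurable[MeasurableSpace.comap r MeasurableSpace.pi] f := Measurable.mono hf hle le_rfl
  refine hf'.factorsThrough ?_
  funext p
  exact h _ _ p.2

/-! ## Covariance bounds by coupling -/

theorem mul_mem_unit {Ω : Type*} {X Y : Ω → ℝ} (hX1 : ∀ ω, 0 ≤ X ω ∧ X ω ≤ 1)
    (hY1 : ∀ ω, 0 ≤ Y ω ∧ Y ω ≤ 1) (ω : Ω) : 0 ≤ (X * Y) ω ∧ (X * Y) ω ≤ 1 :=
  ⟨mul_nonneg (hX1 ω).1 (hY1 ω).1, mul_le_one₀ (hX1 ω).2 (hY1 ω).1 (hY1 ω).2⟩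

section Coupling

variable {Ω : Type*} [MeasurableSpace Ω] {μ : Measure Ω} [IsProbabilityMeasure μ]

theorem integrable_of_mem_unit {X : Ω → ℝ} (hX : Measurable X) (h : ∀ ω, 0 ≤ X ω ∧ X ω ≤ 1) :
    Integrable X μ :=
  Integrable.of_bound hX.aestronglyMeasurable 1
    (Filter.Eventually.of_forall fun ω => by rw [Real.norm_of_nonneg (h ω).1]; exact (h ω).2)

theorem memLp_two_of_mem_unit {X : Ω → ℝ} (hX : Measurable X) (h : ∀ ω, 0 ≤ X ω ∧ X ω ≤ 1) :
    MemLp X 2 μ :=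
  MemLp.of_bound hX.aestronglyMeasurable 1
    (Filter.Eventually.of_forall fun ω => by rw [Real.norm_of_nonneg (h ω).1]; exact (h ω).2)

/-- The exceptional set need not be measurable: the indicator of its measurable hull, which has the
same measure, dominates `X - Y`. -/
theorem integral_le_add_of_eq_off {X Y : Ω → ℝ} (hX : Measurable X) (hY : Measurable Y)
    (hX1 : ∀ ω, 0 ≤ X ω ∧ X ω ≤ 1) (hY1 : ∀ ω, 0 ≤ Y ω ∧ Y ω ≤ 1) {A : Set Ω} {ε : ℝ}
    (hε : 0 ≤ ε) (hA : μ A ≤ ENNReal.ofReal ε) (h : ∀ᵐ ω ∂μ, ω ∉ A → X ω = Y ω) :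
    ∫ ω, X ω ∂μ ≤ ∫ ω, Y ω ∂μ + ε := by
  have hm := measurableSet_toMeasurable μ A
  have hA' : μ.real (toMeasurable μ A) ≤ ε := by
    rw [measureReal_def, measure_toMeasurable]
    exact ENNReal.toReal_le_of_le_ofReal hε hA
  have hi : Integrable ((toMeasurable μ A).indicator (1 : Ω → ℝ)) μ :=
    (integrable_indicator_iff hm).2 (integrable_const 1).integrableOn
  calc ∫ ω, X ω ∂μ ≤ ∫ ω, (Y ω + (toMeasurable μ A).indicator (1 : Ω → ℝ) ω) ∂μ := by
        refine integral_mono_ae (integrable_of_mem_unit hX hX1)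
          ((integrable_of_mem_unit hY hY1).add hi) ?_
        filter_upwards [h] with ω hω
        by_cases hmem : ω ∈ toMeasurable μ A
        · simp only [hmem, indicator_of_mem, Pi.one_apply]
          linarith [(hX1 ω).2, (hY1 ω).1]
        · simp only [hmem, not_false_eq_true, indicator_of_notMem, add_zero]
          exact (hω fun hA => hmem (subset_toMeasurable μ A hA)).le
    _ = ∫ ω, Y ω ∂μ + μ.real (toMeasurable μ A) := by
        rw [integral_add (integrable_of_mem_unit hY hY1) hi, integral_indicator_one hm]
    _ ≤ _ := by linarith

/-- If mixing two independent samples preserves the law, and off a small set of samples the mixture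
agrees with the first sample as far as `g₁` is concerned, and with the second one as far as `g₂`
is concerned, then `g₁` and `g₂` have a small covariance. -/
theorem covariance_le_of_mix {mix : Ω × Ω → Ω} (hmix : MeasurePreserving mix (μ.prod μ) μ)
    {g₁ g₂ : Ω → ℝ} (hg₁ : Measurable g₁) (hg₂ : Measurable g₂)
    (h₁ : ∀ ω, 0 ≤ g₁ ω ∧ g₁ ω ≤ 1) (h₂ : ∀ ω, 0 ≤ g₂ ω ∧ g₂ ω ≤ 1) {A : Set Ω} {ε : ℝ}
    (hε : 0 ≤ ε) (hA : μ A ≤ ENNReal.ofReal ε)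
    (e₁ : ∀ p : Ω × Ω, p.1 ∉ A → mix p ∉ A → g₁ (mix p) = g₁ p.1)
    (e₂ : ∀ p : Ω × Ω, p.2 ∉ A → mix p ∉ A → g₂ (mix p) = g₂ p.2) :
    cov[g₁, g₂; μ] ≤ 3 * ε := by
  rw [covariance_eq_sub (memLp_two_of_mem_unit hg₁ h₁) (memLp_two_of_mem_unit hg₂ h₂)]
  have hB : (μ.prod μ) (Prod.fst ⁻¹' toMeasurable μ A ∪ Prod.snd ⁻¹' toMeasurable μ A ∪
      mix ⁻¹' toMeasurable μ A) ≤ ENNReal.ofReal (3 * ε) := by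
    have hm := measurableSet_toMeasurable μ A
    -- Each of the two samples and their mixture has law `μ`, so each contributes one `μ A`: hence
    -- the factor 3.
    refine (measure_union_le _ _).trans ((add_le_add_left (measure_union_le _ _) _).trans ?_)
    rw [measurePreserving_fst.measure_preimage hm.nullMeasurableSet,
      measurePreserving_snd.measure_preimage hm.nullMeasurableSet,
      hmix.measure_preimage hm.nullMeasurableSet, measure_toMeasurable]
    calc μ A + μ A + μ A ≤ ENNReal.ofReal ε + ENNReal.ofReal ε + ENNReal.ofReal ε := by gcongr
      _ = ENNReal.ofReal (3 * ε) := by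
        rw [← ENNReal.ofReal_add hε hε, ← ENNReal.ofReal_add (by linarith) hε]
        ring_nf
  have h12 : ∫ ω, (g₁ * g₂) ω ∂μ = ∫ p, (g₁ * g₂) (mix p) ∂(μ.prod μ) := by
    conv_lhs => rw [← hmix.map_eq]
    rw [integral_map hmix.measurable.aemeasurable (hg₁.mul hg₂).aestronglyMeasurable]
  have hprod : (∫ ω, g₁ ω ∂μ) * ∫ ω, g₂ ω ∂μ = ∫ p, g₁ p.1 * g₂ p.2 ∂(μ.prod μ) :=
    (integral_prod_mul g₁ g₂).symm
  rw [h12, hprod]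
  have := integral_le_add_of_eq_off (μ := μ.prod μ) (X := fun p => (g₁ * g₂) (mix p))
    (Y := fun p => g₁ p.1 * g₂ p.2) ((hg₁.mul hg₂).comp hmix.measurable)
    ((hg₁.comp measurable_fst).mul (hg₂.comp measurable_snd)) (fun p => mul_mem_unit h₁ h₂ _)
    (fun p => ⟨mul_nonneg (h₁ _).1 (h₂ _).1, mul_le_one₀ (h₁ _).2 (h₂ _).1 (h₂ _).2⟩)
    (by positivity) hB (Filter.Eventually.of_forall fun p hp => by
      simp only [mem_union, mem_preimage, not_or] at hp
      have hs := subset_toMeasurable μ A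
      rw [Pi.mul_apply, e₁ p (fun h => hp.1.1 (hs h)) fun h => hp.2 (hs h),
        e₂ p (fun h => hp.1.2 (hs h)) fun h => hp.2 (hs h)])
  linarith

/-- The covariance of two functions that agree with independent ones off a small set. -/
theorem covariance_le_of_indepFun {X₁ X₂ Y₁ Y₂ : Ω → ℝ} (hX₁ : Measurable X₁)
    (hX₂ : Measurable X₂) (hY₁ : Measurable Y₁) (hY₂ : Measurable Y₂)
    (x₁ : ∀ ω, 0 ≤ X₁ ω ∧ X₁ ω ≤ 1) (x₂ : ∀ ω, 0 ≤ X₂ ω ∧ X₂ ω ≤ 1)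
    (y₁ : ∀ ω, 0 ≤ Y₁ ω ∧ Y₁ ω ≤ 1) (y₂ : ∀ ω, 0 ≤ Y₂ ω ∧ Y₂ ω ≤ 1) (hind : Y₁ ⟂ᵢ[μ] Y₂)
    {A : Set Ω} {ε : ℝ} (hε : 0 ≤ ε) (hA : μ A ≤ ENNReal.ofReal ε)
    (e₁ : ∀ᵐ ω ∂μ, ω ∉ A → X₁ ω = Y₁ ω) (e₂ : ∀ᵐ ω ∂μ, ω ∉ A → X₂ ω = Y₂ ω) :
    cov[X₁, X₂; μ] ≤ 3 * ε := by
  rw [covariance_eq_sub (memLp_two_of_mem_unit hX₁ x₁) (memLp_two_of_mem_unit hX₂ x₂)]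
  have h := integral_le_add_of_eq_off (μ := μ) (X := X₁ * X₂) (Y := Y₁ * Y₂) (hX₁.mul hX₂)
    (hY₁.mul hY₂) (mul_mem_unit x₁ x₂) (mul_mem_unit y₁ y₂) hε hA (by
      filter_upwards [e₁, e₂] with ω h₁ h₂ hω
      rw [Pi.mul_apply, Pi.mul_apply, h₁ hω, h₂ hω])
  have hi : ∫ ω, (Y₁ * Y₂) ω ∂μ = (∫ ω, Y₁ ω ∂μ) * ∫ ω, Y₂ ω ∂μ :=
    hind.integral_mul_eq_mul_integral hY₁.aestronglyMeasurable hY₂.aestronglyMeasurable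
  have h₁ := integral_le_add_of_eq_off (μ := μ) hY₁ hX₁ y₁ x₁ hε hA (by
      filter_upwards [e₁] with ω h₁ hω using (h₁ hω).symm)
  have h₂ := integral_le_add_of_eq_off (μ := μ) hY₂ hX₂ y₂ x₂ hε hA (by
      filter_upwards [e₂] with ω h₂ hω using (h₂ hω).symm)
  have b₁ : 0 ≤ ∫ ω, X₁ ω ∂μ := integral_nonneg fun ω => (x₁ ω).1
  have b₂ : 0 ≤ ∫ ω, Y₂ ω ∂μ := integral_nonneg fun ω => (y₂ ω).1
  have b₃ : ∫ ω, X₁ ω ∂μ ≤ 1 :=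
    (integral_mono (integrable_of_mem_unit hX₁ x₁) (integrable_const 1) fun ω => (x₁ ω).2).trans
      (by simp)
  have b₄ : ∫ ω, Y₂ ω ∂μ ≤ 1 :=
    (integral_mono (integrable_of_mem_unit hY₂ y₂) (integrable_const 1) fun ω => (y₂ ω).2).trans
      (by simp)
  rw [hi] at h
  -- One `ε` is lost between `X₁ * X₂` and `Y₁ * Y₂`, and one for each factor when the product of
  -- the means of the `Y`'s is compared with that of the `X`'s, the other factor being at most 1.
  nlinarith [mul_le_mul_of_nonneg_right h₁ b₂, mul_le_mul_of_nonneg_left h₂ b₁,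
    mul_le_mul_of_nonneg_left b₄ hε, mul_le_mul_of_nonneg_left b₃ hε]

end Coupling

/-! ## Infinite product measures -/

section InfiniteProduct

variable {ι : Type*} {E : Type*} [MeasurableSpace E]

/-- Resampling one coordinate does not change a product measure. -/
theorem measurePreserving_update [DecidableEq ι] (μ : ι → Measure E)
    [∀ i, IsProbabilityMeasure (μ i)] (i : ι) :
    MeasurePreserving (fun p : E × (ι → E) => Function.update p.2 i p.1)
      ((μ i).prod (Measure.infinitePi μ)) (Measure.infinitePi μ) := by
  have hm : Measurable fun p : E × (ι → E) => Function.update p.2 i p.1 :=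
    measurable_pi_lambda _ fun j => by
      by_cases h : j = i
      · subst h; simpa using measurable_fst
      · simp only [Function.update_of_ne h]; fun_prop
  refine ⟨hm, Measure.eq_infinitePi _ fun s t ht => ?_⟩
  rw [Measure.map_apply hm (.pi s.countable_toSet fun j _ => ht j)]
  have : (fun p : E × (ι → E) => Function.update p.2 i p.1) ⁻¹' (Set.pi s t) =
      (if i ∈ s then t i else univ) ×ˢ (Set.pi (s.erase i : Finset ι) t) := by
    ext ⟨e, c⟩
    simp only [mem_preimage, Set.mem_pi, Finset.mem_coe, mem_prod, Finset.mem_erase]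
    constructor
    · intro h
      refine ⟨?_, fun j hj => by simpa [hj.1] using h j hj.2⟩
      split_ifs with hi
      · simpa using h i hi
      · trivial
    · rintro ⟨h, h'⟩ j hj
      by_cases hji : j = i
      · subst hji; simpa [hj] using h
      · simpa [hji] using h' j ⟨hji, hj⟩
  rw [this, Measure.prod_prod, Measure.infinitePi_pi _ fun j _ => ht j]
  split_ifs with hi
  · exact Finset.mul_prod_erase s (fun j => μ j (t j)) hi
  · simp [hi]

theorem lintegral_infinitePi_update [DecidableEq ι] (μ : ι → Measure E)
    [∀ i, IsProbabilityMeasure (μ i)] (i : ι) {F : (ι → E) → ℝ≥0∞} (hF : Measurable F) :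
    ∫⁻ c, F c ∂Measure.infinitePi μ =
      ∫⁻ e, ∫⁻ c, F (Function.update c i e) ∂Measure.infinitePi μ ∂(μ i) := by
  have h := measurePreserving_update μ i
  rw [← h.lintegral_comp hF]
  exact lintegral_prod _ (hF.comp h.measurable).aemeasurable

/-- Taking the coordinates in `L` from a first sample and the other ones from an independent
second sample gives a sample. -/
theorem measurePreserving_mix (μ : ι → Measure E) [∀ i, IsProbabilityMeasure (μ i)] (L : Set ι)
    [DecidablePred (· ∈ L)] :
    MeasurePreserving (fun p : (ι → E) × (ι → E) => L.piecewise p.1 p.2)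
      ((Measure.infinitePi μ).prod (Measure.infinitePi μ)) (Measure.infinitePi μ) := by
  have hm : Measurable fun p : (ι → E) × (ι → E) => L.piecewise p.1 p.2 :=
    measurable_pi_lambda _ fun j => by
      by_cases h : j ∈ L
      · simp only [Set.piecewise, h, if_true]; fun_prop
      · simp only [Set.piecewise, h, if_false]; fun_prop
  refine ⟨hm, Measure.eq_infinitePi _ fun s t ht => ?_⟩
  rw [Measure.map_apply hm (.pi s.countable_toSet fun j _ => ht j)]
  have : (fun p : (ι → E) × (ι → E) => L.piecewise p.1 p.2) ⁻¹' (Set.pi s t) =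
      (Set.pi (s.filter (· ∈ L) : Finset ι) t) ×ˢ (Set.pi (s.filter (¬ · ∈ L) : Finset ι) t) := by
    ext ⟨e, c⟩
    simp only [mem_preimage, Set.mem_pi, Finset.mem_coe, mem_prod, Finset.mem_filter]
    constructor
    · exact fun h => ⟨fun j hj => by simpa [hj.2] using h j hj.1,
        fun j hj => by simpa [hj.2] using h j hj.1⟩
    · rintro ⟨h, h'⟩ j hj
      by_cases hji : j ∈ L
      · simpa [hji] using h j ⟨hj, hji⟩
      · simpa [hji] using h' j ⟨hj, hji⟩
  rw [this, Measure.prod_prod, Measure.infinitePi_pi _ fun j _ => ht j,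
    Measure.infinitePi_pi _ fun j _ => ht j, Finset.prod_filter_mul_prod_filter_not]

/-- The sequence `e, w 0, w 1, …`. -/
def seqCons {E : Type*} (e : E) (w : ℕ → E) : ℕ → E
  | 0 => e
  | n + 1 => w n

/-- A sequence of independent variables is the first one followed by an independent copy. -/
theorem measurePreserving_cons (μ : Measure E) [IsProbabilityMeasure μ] :
    MeasurePreserving (fun p : E × (ℕ → E) => seqCons p.1 p.2)
      (μ.prod (Measure.infinitePi fun _ : ℕ => μ)) (Measure.infinitePi fun _ : ℕ => μ) := by
  have hm : Measurable fun p : E × (ℕ → E) => seqCons p.1 p.2 :=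
    measurable_pi_lambda _ fun j => by
      cases j with
      | zero => exact measurable_fst
      | succ j => exact (measurable_pi_apply j).comp measurable_snd
  refine ⟨hm, Measure.eq_infinitePi _ fun s t ht => ?_⟩
  rw [Measure.map_apply hm (.pi s.countable_toSet fun j _ => ht j)]
  -- Coordinate `j + 1` of the extended sequence is coordinate `j` of the tail, so the constraints
  -- other than the one at 0 move down by one index.
  let s' : Finset ℕ := (s.erase 0).image Nat.pred
  have : (fun p : E × (ℕ → E) => seqCons p.1 p.2) ⁻¹' (Set.pi s t) = (if 0 ∈ s then t 0 else univ) ×ˢ (Set.pi s' fun j => t (j + 1)) := by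
    ext ⟨e, c⟩
    simp only [mem_preimage, Set.mem_pi, Finset.mem_coe, mem_prod]
    constructor
    · intro h
      refine ⟨?_, fun j hj => ?_⟩
      · split_ifs with hi
        · exact h 0 hi
        · trivial
      · obtain ⟨n, hn, rfl⟩ := Finset.mem_image.1 hj
        obtain ⟨hn0, hn⟩ := Finset.mem_erase.1 hn
        obtain ⟨m, rfl⟩ := Nat.exists_eq_succ_of_ne_zero hn0
        exact h (m + 1) hn
    · rintro ⟨h, h'⟩ j hj
      cases j with
      | zero => simpa [hj, seqCons] using h
      | succ j =>
        exact h' j (Finset.mem_image.2 ⟨j + 1, Finset.mem_erase.2 ⟨Nat.succ_ne_zero j, hj⟩, rfl⟩)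
  have hs' : ∏ j ∈ s', μ (t (j + 1)) = ∏ j ∈ s.erase 0, μ (t j) := by
    rw [Finset.prod_image]
    · refine Finset.prod_congr rfl fun j hj => ?_
      obtain ⟨m, rfl⟩ := Nat.exists_eq_succ_of_ne_zero (Finset.mem_erase.1 hj).1
      rfl
    · intro a ha b hb hab
      exact Nat.pred_inj (Nat.pos_of_ne_zero (Finset.mem_erase.1 ha).1)
        (Nat.pos_of_ne_zero (Finset.mem_erase.1 hb).1) hab
  rw [this, Measure.prod_prod, Measure.infinitePi_pi _ fun j _ => ht _, hs']
  split_ifs with hi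
  · exact Finset.mul_prod_erase s (fun j => μ (t j)) hi
  · simp [hi]

theorem lintegral_infinitePi_cons (μ : Measure E) [IsProbabilityMeasure μ]
    {F : (ℕ → E) → ℝ≥0∞} (hF : Measurable F) :
    ∫⁻ w, F w ∂(Measure.infinitePi fun _ : ℕ => μ) =
      ∫⁻ e, ∫⁻ w, F (seqCons e w)
        ∂(Measure.infinitePi fun _ : ℕ => μ) ∂μ := by
  have h := measurePreserving_cons μ
  rw [← h.lintegral_comp hF]
  exact lintegral_prod _ (hF.comp h.measurable).aemeasurable

end InfiniteProduct

/-! ## Exponential waiting times -/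

instance expMeasure.instIsProbabilityMeasure {γ : ℝ} [Fact (0 < γ)] :
    IsProbabilityMeasure (expMeasure γ) :=
  isProbabilityMeasure_expMeasure Fact.out

theorem lintegral_expMeasure (γ : ℝ) {K : ℝ → ℝ≥0∞} (hK : Measurable K) :
    ∫⁻ u, K u ∂expMeasure γ = ∫⁻ u, exponentialPDF γ u * K u := by
  have hm : Measurable (exponentialPDF γ) := (measurable_exponentialPDFReal γ).ennreal_ofReal
  change ∫⁻ u, K u ∂(volume.withDensity (exponentialPDF γ)) = _
  rw [lintegral_withDensity_eq_lintegral_mul _ hm hK]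
  rfl

/-- Translate the integral by `s` and split the exponential in the density: given that it exceeds
`s`, the waiting time overshoots `s` by a fresh exponential time. -/
theorem lintegral_expMeasure_memoryless (γ : ℝ) {s : ℝ} (hs : 0 ≤ s) {K : ℝ → ℝ≥0∞}
    (hK : Measurable K) :
    ∫⁻ u, (if s < u then K (u - s) else 0) ∂expMeasure γ =
      ENNReal.ofReal (Real.exp (-(γ * s))) * ∫⁻ u, K u ∂expMeasure γ := by
  have hm : Measurable (exponentialPDF γ) := (measurable_exponentialPDFReal γ).ennreal_ofReal
  have hK' : Measurable fun u => if s < u then K (u - s) else 0 :=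
    Measurable.ite measurableSet_Ioi (by fun_prop) measurable_const
  rw [lintegral_expMeasure γ hK', lintegral_expMeasure γ hK,
    ← lintegral_const_mul _ (show Measurable fun u => exponentialPDF γ u * K u from hm.mul hK),
    ← lintegral_add_right_eq_self (μ := volume)
      (fun u => exponentialPDF γ u * if s < u then K (u - s) else 0) s]
  refine lintegral_congr_ae ?_
  -- At `v = 0` the density is nonzero but the strict inequality fails, so the two integrands may
  -- differ there.
  have h0 : ∀ᵐ v : ℝ, v ≠ 0 := by simp [ae_iff]
  filter_upwards [h0] with v hv
  rcases lt_or_gt_of_ne hv with h | h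
  · simp [h.le, exponentialPDF_of_neg h]
  · rw [exponentialPDF_of_nonneg h.le, exponentialPDF_of_nonneg (by linarith)]
    simp only [lt_add_iff_pos_left, h, if_true, add_sub_cancel_right]
    rw [← mul_assoc, ← ENNReal.ofReal_mul (Real.exp_pos _).le]
    congr 2
    rw [mul_add, neg_add, Real.exp_add]
    ring

theorem lintegral_exp_neg_expMeasure {γ κ : ℝ} (hγ : 0 < γ) (hκ : 0 ≤ κ) :
    ∫⁻ u, ENNReal.ofReal (Real.exp (-(κ * u))) ∂expMeasure γ = ENNReal.ofReal (γ / (γ + κ)) := by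
  have hp : 0 < γ + κ := by linarith
  rw [lintegral_expMeasure γ (by fun_prop)]
  have : ∀ u, exponentialPDF γ u * ENNReal.ofReal (Real.exp (-(κ * u))) =
      ENNReal.ofReal (γ / (γ + κ)) * exponentialPDF (γ + κ) u := fun u => by
    rcases lt_or_ge u 0 with h | h
    · simp [exponentialPDF_of_neg h]
    · rw [exponentialPDF_of_nonneg h, exponentialPDF_of_nonneg h,
        ← ENNReal.ofReal_mul (by positivity), ← ENNReal.ofReal_mul (by positivity)]
      congr 1
      rw [mul_assoc, ← Real.exp_add, ← mul_assoc, div_mul_cancel₀ _ hp.ne']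
      ring_nf
  simp_rw [this]
  rw [lintegral_const_mul _ (show Measurable (exponentialPDF (γ + κ)) from
      (measurable_exponentialPDFReal _).ennreal_ofReal),
    lintegral_exponentialPDF_eq_one hp, mul_one]

theorem expMeasure_singleton (γ x : ℝ) : expMeasure γ {x} = 0 := by
  have h : expMeasure γ ≪ volume := withDensity_absolutelyContinuous _ _
  exact h (by simp)

theorem ae_expMeasure_pos (γ : ℝ) : ∀ᵐ u ∂expMeasure γ, 0 < u := by
  have h : expMeasure γ (Iio 0) = 0 := by
    have := lintegral_expMeasure γ (K := (Iio (0 : ℝ)).indicator 1)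
      (measurable_one.indicator measurableSet_Iio)
    rw [lintegral_indicator_one measurableSet_Iio] at this
    rw [this]
    refine (lintegral_congr fun u => ?_).trans lintegral_zero
    by_cases hu : u < 0
    · simp [exponentialPDF_of_neg hu]
    · simp [hu]
  rw [ae_iff]
  refine measure_mono_null (fun u hu => ?_) (measure_union_null h (expMeasure_singleton γ 0))
  rcases lt_or_eq_of_le (not_lt.1 hu) with h | h
  · exact Or.inl h
  · exact Or.inr h

/-! ## Arrival times of a sequence of waiting times -/

namespace SSEP

/-- The arrival times of a sequence of waiting times. -/
def arrT (w : ℕ → ℝ) (i : ℕ) : ℝ := ∑ j ∈ Finset.range (i + 1), w j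

/-- The number of arrivals up to time `s`. -/
noncomputable def cnt (s : ℝ) (w : ℕ → ℝ) : ℕ := sInf {i | s < arrT w i}

/-- The waiting times as seen from time `s`. -/
noncomputable def shift (s : ℝ) (w : ℕ → ℝ) : ℕ → ℝ :=
  fun j => if j = 0 then arrT w (cnt s w) - s else w (cnt s w + j)

/-- The waiting times are positive and their sum diverges. -/
structure GoodSeq (w : ℕ → ℝ) : Prop where
  pos : ∀ i, 0 < w i
  unbounded : ∀ t, ∃ i, t < arrT w i

/-- Exactly `n` arrivals up to time `s`. -/
def Hits (s : ℝ) (n : ℕ) (w : ℕ → ℝ) : Prop := s < arrT w n ∧ ∀ i < n, arrT w i ≤ s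

theorem arrT_zero (w : ℕ → ℝ) : arrT w 0 = w 0 := by simp [arrT]

theorem arrT_succ (w : ℕ → ℝ) (i : ℕ) : arrT w (i + 1) = arrT w i + w (i + 1) := by
  simp [arrT, Finset.sum_range_succ]

theorem arrT_cons_zero (u : ℝ) (w : ℕ → ℝ) :
    arrT (seqCons u w) 0 = u := by
  simp [arrT, seqCons]

theorem arrT_cons_succ (u : ℝ) (w : ℕ → ℝ) (i : ℕ) :
    arrT (seqCons u w) (i + 1) = u + arrT w i := by
  rw [arrT, Finset.sum_range_succ', arrT, add_comm]
  rfl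

theorem arrT_shift (s : ℝ) (w : ℕ → ℝ) (i : ℕ) :
    arrT (shift s w) i = arrT w (cnt s w + i) - s := by
  induction i with
  | zero => simp [arrT_zero, shift]
  | succ i ih =>
    rw [arrT_succ, ih, ← add_assoc, arrT_succ, shift, if_neg (Nat.succ_ne_zero i), ← add_assoc]
    ring

theorem Hits.cnt_eq {s : ℝ} {n : ℕ} {w : ℕ → ℝ} (h : Hits s n w) : cnt s w = n := by
  refine le_antisymm (Nat.sInf_le h.1) ?_
  refine le_csInf ⟨n, h.1⟩ fun i hi => ?_
  by_contra hlt
  exact absurd (h.2 i (not_le.1 hlt)) (not_le.2 hi)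

theorem hits_cnt {s : ℝ} {w : ℕ → ℝ} (h : ∃ i, s < arrT w i) : Hits s (cnt s w) w :=
  ⟨Nat.sInf_mem (s := {i | s < arrT w i}) h,
    fun _ hi => not_lt.1 (Nat.notMem_of_lt_sInf (s := {i | s < arrT w i}) hi)⟩

theorem GoodSeq.arrT_strictMono {w : ℕ → ℝ} (h : GoodSeq w) : StrictMono (arrT w) :=
  strictMono_nat_of_lt_succ fun i => by rw [arrT_succ]; linarith [h.pos (i + 1)]

theorem GoodSeq.arrT_pos {w : ℕ → ℝ} (h : GoodSeq w) (i : ℕ) : 0 < arrT w i :=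
  Finset.sum_pos (fun _ _ => h.pos _) ⟨0, by simp⟩

theorem GoodSeq.shift {w : ℕ → ℝ} (h : GoodSeq w) (s : ℝ) : GoodSeq (shift s w) where
  pos i := by
    unfold SSEP.shift
    split_ifs
    · linarith [(hits_cnt (h.unbounded s)).1]
    · exact h.pos _
  unbounded t := by
    obtain ⟨i, hi⟩ := h.unbounded (t + s)
    refine ⟨i, ?_⟩
    rw [arrT_shift]
    have := h.arrT_strictMono.monotone (Nat.le_add_left i (cnt s w))
    linarith

theorem measurable_arrT (i : ℕ) : Measurable fun w : ℕ → ℝ => arrT w i := by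
  unfold arrT
  fun_prop

theorem measurableSet_hits (n : ℕ) : MeasurableSet {p : ℝ × (ℕ → ℝ) | Hits p.1 n p.2} := by
  have h : ∀ i, Measurable fun p : ℝ × (ℕ → ℝ) => arrT p.2 i := fun i =>
    (measurable_arrT i).comp measurable_snd
  simp only [Hits, ofPred_and, ofPred_forall]
  exact (measurableSet_lt measurable_fst (h n)).inter
    (MeasurableSet.iInter fun i => MeasurableSet.iInter fun _ =>
      measurableSet_le (h i) measurable_fst)

theorem measurable_cnt : Measurable fun p : ℝ × (ℕ → ℝ) => cnt p.1 p.2 := by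
  refine measurable_to_countable' fun n => ?_
  have h : ∀ i, Measurable fun p : ℝ × (ℕ → ℝ) => arrT p.2 i := fun i =>
    (measurable_arrT i).comp measurable_snd
  -- The second piece accounts for the default value: with no arrival after `s` the infimum of the
  -- empty set is 0.
  have : (fun p : ℝ × (ℕ → ℝ) => cnt p.1 p.2) ⁻¹' {n} =
      {p | Hits p.1 n p.2} ∪ ({_p | n = 0} ∩ ⋂ i, {p | arrT p.2 i ≤ p.1}) := by
    ext p
    simp only [mem_preimage, mem_singleton_iff, mem_union, mem_ofPred, mem_inter_iff, mem_iInter]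
    constructor
    · intro hn
      by_cases hex : ∃ i, p.1 < arrT p.2 i
      · left
        rw [← hn]
        exact hits_cnt hex
      · right
        push Not at hex
        refine ⟨?_, hex⟩
        rw [← hn, cnt, Nat.sInf_eq_zero]
        right
        ext i
        simpa using hex i
    · rintro (hn | ⟨rfl, hn⟩)
      · exact hn.cnt_eq
      · rw [cnt, Nat.sInf_eq_zero]
        right
        ext i
        simpa using hn i
  rw [this]
  exact (measurableSet_hits n).union ((MeasurableSet.const _).inter
    (MeasurableSet.iInter fun i => measurableSet_le (h i) measurable_fst))

theorem measurable_shift : Measurable fun p : ℝ × (ℕ → ℝ) => shift p.1 p.2 := by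
  refine measurable_pi_lambda _ fun j => ?_
  have h₁ : Measurable fun p : ℝ × (ℕ → ℝ) => arrT p.2 (cnt p.1 p.2) := by
    have : Measurable fun q : ℕ × (ℕ → ℝ) => arrT q.2 q.1 :=
      measurable_from_prod_countable_right fun n => measurable_arrT n
    exact this.comp (f := fun p : ℝ × (ℕ → ℝ) => (cnt p.1 p.2, p.2))
      (measurable_cnt.prodMk measurable_snd)
  have h₂ : Measurable fun p : ℝ × (ℕ → ℝ) => p.2 (cnt p.1 p.2 + j) := by
    have : Measurable fun q : ℕ × (ℕ → ℝ) => q.2 (q.1 + j) :=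
      measurable_from_prod_countable_right fun n => measurable_pi_apply (n + j)
    exact this.comp (f := fun p : ℝ × (ℕ → ℝ) => (cnt p.1 p.2, p.2))
      (measurable_cnt.prodMk measurable_snd)
  unfold shift
  exact Measurable.ite (MeasurableSet.const _) (h₁.sub measurable_fst) h₂

theorem measurable_shift_left (s : ℝ) : Measurable (shift s) :=
  measurable_shift.comp (f := fun w => (s, w)) (by fun_prop)

/-! ## The law of one clock -/

/-- The law of a sequence of independent exponential waiting times. -/
noncomputable def clockLaw (γ : ℝ) : Measure (ℕ → ℝ) := Measure.infinitePi fun _ : ℕ => expMeasure γ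

section Law

variable {γ : ℝ} [hγ : Fact (0 < γ)]

instance : IsProbabilityMeasure (clockLaw γ) := by
  unfold clockLaw
  infer_instance

omit hγ in
theorem shift_cons_of_lt {s u : ℝ} (w : ℕ → ℝ) (h : s < u) :
    shift s (seqCons u w) =
      seqCons (u - s) w := by
  have hc : cnt s (seqCons u w) = 0 :=
    Hits.cnt_eq ⟨by rwa [arrT_cons_zero], by simp⟩
  funext j
  cases j with
  | zero => simp [shift, hc, arrT_zero, seqCons]
  | succ j => simp [shift, hc, seqCons]

omit hγ in
theorem hits_cons_succ (s u : ℝ) (n : ℕ) (w : ℕ → ℝ) :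
    Hits s (n + 1) (seqCons u w) ↔
      u ≤ s ∧ Hits (s - u) n w := by
  unfold Hits
  rw [arrT_cons_succ]
  constructor
  · rintro ⟨h, h'⟩
    refine ⟨by simpa [arrT_cons_zero] using h' 0 (Nat.succ_pos n), by linarith, fun i hi => ?_⟩
    have := h' (i + 1) (by omega)
    rw [arrT_cons_succ] at this
    linarith
  · rintro ⟨hu, h, h'⟩
    refine ⟨by linarith, fun i hi => ?_⟩
    cases i with
    | zero => rwa [arrT_cons_zero]
    | succ i =>
      rw [arrT_cons_succ]
      linarith [h' i (by omega)]

omit hγ in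
theorem Hits.shift_cons {s u : ℝ} {n : ℕ} {w : ℕ → ℝ} (hu : u ≤ s) (h : Hits (s - u) n w) :
    shift s (seqCons u w) = shift (s - u) w := by
  have hc := ((hits_cons_succ s u n w).2 ⟨hu, h⟩).cnt_eq
  funext j
  rw [shift, shift, hc, h.cnt_eq, arrT_cons_succ, Nat.add_right_comm n 1 j]
  split_ifs
  · ring
  · rfl

/-- If nothing has arrived by time `s`, restarting changes only the first waiting time, which is
memoryless, and leaves the later ones untouched. -/
theorem lintegral_shift_of_lt {s : ℝ} (hs : 0 ≤ s) {F : (ℕ → ℝ) → ℝ≥0∞} (hF : Measurable F) :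
    ∫⁻ w, {w | s < w 0}.indicator (fun w => F (shift s w)) w ∂clockLaw γ =
      ENNReal.ofReal (Real.exp (-(γ * s))) * ∫⁻ w, F w ∂clockLaw γ := by
  have hm : Measurable ({w | s < w 0}.indicator (fun w => F (shift s w))) :=
    (hF.comp (measurable_shift_left s)).indicator
      (measurableSet_lt measurable_const (measurable_pi_apply 0))
  have hcons := (measurePreserving_cons (expMeasure γ)).measurable
  unfold clockLaw
  rw [lintegral_infinitePi_cons _ hm, lintegral_infinitePi_cons _ hF,
    ← lintegral_expMeasure_memoryless γ hs
      (show Measurable fun u => ∫⁻ w, F (seqCons u w) ∂(Measure.infinitePi fun _ => expMeasure γ) from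
        (hF.comp hcons).lintegral_prod_right')]
  refine lintegral_congr fun u => ?_
  by_cases h : s < u
  · rw [if_pos h]
    refine lintegral_congr fun w => ?_
    rw [indicator_of_mem (show seqCons u w ∈ {w | s < w 0} from h), shift_cons_of_lt w h]
  · rw [if_neg h, ← lintegral_zero]
    refine lintegral_congr fun w => ?_
    rw [indicator_of_notMem (show seqCons u w ∉ {w | s < w 0} from h)]

/-- Given the number of arrivals up to `s`, the restarted clock is fresh. Induction on this number:
once the first arrival `u ≤ s` is removed, the rest is a clock seen from `s - u` with one arrival
fewer. The time therefore has to vary in the induction hypothesis. -/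
theorem lintegral_shift_of_hits {F : (ℕ → ℝ) → ℝ≥0∞} (hF : Measurable F) (n : ℕ) :
    ∀ {s : ℝ}, 0 ≤ s → ∫⁻ w, {w | Hits s n w}.indicator (fun w => F (shift s w)) w ∂clockLaw γ =
      clockLaw γ {w | Hits s n w} * ∫⁻ w, F w ∂clockLaw γ := by
  have hset : ∀ (n : ℕ) (s : ℝ), MeasurableSet {w | Hits s n w} := fun n s =>
    (measurableSet_hits n).preimage (f := fun w => (s, w)) (by fun_prop)
  have hmeas : ∀ (n : ℕ) (s : ℝ), Measurable ({w | Hits s n w}.indicator fun w => F (shift s w)) :=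
    fun n s => (hF.comp (measurable_shift_left s)).indicator (hset n s)
  induction n with
  | zero =>
    intro s hs
    have h0 : {w | Hits s 0 w} = {w : ℕ → ℝ | s < w 0} := by
      ext w
      simp [Hits, arrT_zero]
    have h1 := lintegral_shift_of_lt (γ := γ) hs (F := fun _ => 1) measurable_const
    rw [lintegral_one, measure_univ, mul_one] at h1
    rw [h0, lintegral_shift_of_lt hs hF, ← h1]
    congr 1
    rw [← lintegral_indicator_one (by rw [← h0]; exact hset 0 s)]
    rfl
  | succ n ih =>
    intro s hs
    rw [← lintegral_indicator_one (hset _ _)]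
    have e1 : ∀ u : ℝ, (∫⁻ w, {w | Hits s (n + 1) w}.indicator (fun w => F (shift s w))
        (seqCons u w) ∂clockLaw γ) =
        (Iic s).indicator (fun u => clockLaw γ {w | Hits (s - u) n w}) u *
          ∫⁻ w, F w ∂clockLaw γ := fun u => by
      by_cases h : u ≤ s
      · rw [indicator_of_mem (show u ∈ Iic s from h), ← ih (by linarith)]
        refine lintegral_congr fun w => ?_
        by_cases hw : Hits (s - u) n w
        · rw [indicator_of_mem (show _ ∈ {w | Hits s (n + 1) w} from
              (hits_cons_succ s u n w).2 ⟨h, hw⟩),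
            indicator_of_mem (show w ∈ {w | Hits (s - u) n w} from hw), hw.shift_cons h]
        · rw [indicator_of_notMem (show _ ∉ {w | Hits s (n + 1) w} from
              fun hh => hw ((hits_cons_succ s u n w).1 hh).2),
            indicator_of_notMem (show w ∉ {w | Hits (s - u) n w} from hw)]
      · rw [indicator_of_notMem (show u ∉ Iic s from h), zero_mul, ← lintegral_zero]
        refine lintegral_congr fun w => ?_
        rw [indicator_of_notMem (show _ ∉ {w | Hits s (n + 1) w} from
              fun hh => h ((hits_cons_succ s u n w).1 hh).1)]
    have e2 : ∀ u : ℝ, (∫⁻ w, {w | Hits s (n + 1) w}.indicator (1 : (ℕ → ℝ) → ℝ≥0∞)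
        (seqCons u w) ∂clockLaw γ) =
        (Iic s).indicator (fun u => clockLaw γ {w | Hits (s - u) n w}) u := fun u => by
      by_cases h : u ≤ s
      · rw [indicator_of_mem (show u ∈ Iic s from h), ← lintegral_indicator_one (hset _ _)]
        refine lintegral_congr fun w => ?_
        by_cases hw : Hits (s - u) n w
        · rw [indicator_of_mem (show _ ∈ {w | Hits s (n + 1) w} from
              (hits_cons_succ s u n w).2 ⟨h, hw⟩),
            indicator_of_mem (show w ∈ {w | Hits (s - u) n w} from hw)]
          rfl
        · rw [indicator_of_notMem (show _ ∉ {w | Hits s (n + 1) w} from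
              fun hh => hw ((hits_cons_succ s u n w).1 hh).2),
            indicator_of_notMem (show w ∉ {w | Hits (s - u) n w} from hw)]
      · rw [indicator_of_notMem (show u ∉ Iic s from h), ← lintegral_zero]
        refine lintegral_congr fun w => ?_
        rw [indicator_of_notMem (show _ ∉ {w | Hits s (n + 1) w} from
              fun hh => h ((hits_cons_succ s u n w).1 hh).1)]
    have hmu : Measurable ((Iic s).indicator (fun u => clockLaw γ {w | Hits (s - u) n w})) := by
      refine Measurable.indicator ?_ measurableSet_Iic
      exact measurable_measure_prodMk_left ((measurableSet_hits n).preimage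
        (f := fun p : ℝ × (ℕ → ℝ) => (s - p.1, p.2)) (by fun_prop))
    change ∫⁻ w, _ ∂(Measure.infinitePi fun _ : ℕ => expMeasure γ) =
      (∫⁻ w, _ ∂(Measure.infinitePi fun _ : ℕ => expMeasure γ)) * _
    rw [lintegral_infinitePi_cons _ (hmeas (n + 1) s),
      lintegral_infinitePi_cons _ (measurable_one.indicator (hset (n + 1) s)),
      ← lintegral_mul_const _ ?_]
    · exact lintegral_congr fun u => (e1 u).trans (by rw [← e2 u]; rfl)
    · exact (funext e2 : _ = _) ▸ hmu

theorem lintegral_exp_neg_arrT (i : ℕ) :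
    ∫⁻ w, ENNReal.ofReal (Real.exp (-arrT w i)) ∂clockLaw γ =
      ENNReal.ofReal (γ / (γ + 1)) ^ (i + 1) := by
  have h1 := lintegral_exp_neg_expMeasure hγ.out zero_le_one
  have hm : ∀ i, Measurable fun w : ℕ → ℝ => ENNReal.ofReal (Real.exp (-arrT w i)) := fun i => by
    have := measurable_arrT i
    fun_prop
  induction i with
  | zero =>
    unfold clockLaw
    rw [lintegral_infinitePi_cons _ (hm 0), zero_add, pow_one, ← h1]
    simp [arrT_cons_zero, one_mul]
  | succ i ih =>
    unfold clockLaw at ih ⊢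
    rw [lintegral_infinitePi_cons _ (hm (i + 1)), pow_succ', ← ih, ← h1,
      ← lintegral_mul_const _ (by fun_prop)]
    refine lintegral_congr fun u => ?_
    rw [← lintegral_const_mul _ (hm i)]
    refine lintegral_congr fun w => ?_
    rw [arrT_cons_succ, ← ENNReal.ofReal_mul (Real.exp_pos _).le, ← Real.exp_add]
    ring_nf

/-- Arrival times diverge because the means of `exp (-arrT w i)` form a convergent geometric series,
so that almost surely these exponentials tend to 0. -/
theorem ae_goodSeq : ∀ᵐ w ∂clockLaw γ, GoodSeq w := by
  have hpos : ∀ᵐ w ∂clockLaw γ, ∀ i, 0 < w i := by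
    rw [ae_all_iff]
    intro i
    exact (measurePreserving_eval_infinitePi (fun _ : ℕ => expMeasure γ) i).quasiMeasurePreserving.ae
      (ae_expMeasure_pos γ)
  have hm : ∀ i, Measurable fun w : ℕ → ℝ => ENNReal.ofReal (Real.exp (-arrT w i)) := fun i => by
    have := measurable_arrT i
    fun_prop
  have hr : ENNReal.ofReal (γ / (γ + 1)) < 1 := by
    rw [ENNReal.ofReal_lt_one, div_lt_one (by linarith [hγ.out])]
    linarith
  have hsum : ∫⁻ w, ∑' i, ENNReal.ofReal (Real.exp (-arrT w i)) ∂clockLaw γ ≠ ⊤ := by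
    rw [lintegral_tsum fun i => (hm i).aemeasurable]
    simp_rw [lintegral_exp_neg_arrT, pow_succ, ENNReal.tsum_mul_right, ENNReal.tsum_geometric]
    exact ENNReal.mul_ne_top (ENNReal.inv_ne_top.2 (tsub_pos_of_lt hr).ne') ENNReal.ofReal_ne_top
  have hfin := ae_lt_top (Measurable.tsum hm) hsum
  filter_upwards [hpos, hfin] with w hw hlt
  refine ⟨hw, fun t => ?_⟩
  have ht := ENNReal.tendsto_atTop_zero_of_tsum_ne_top hlt.ne
  obtain ⟨i, hi⟩ := (ht.eventually_lt_const
    (show (0 : ℝ≥0∞) < ENNReal.ofReal (Real.exp (-t)) by positivity)).exists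
  refine ⟨i, ?_⟩
  rw [ENNReal.ofReal_lt_ofReal_iff (Real.exp_pos _), Real.exp_lt_exp] at hi
  linarith

/-- A Poisson clock restarted at a fixed time is a Poisson clock. -/
theorem measurePreserving_shift {s : ℝ} (hs : 0 ≤ s) :
    MeasurePreserving (shift s) (clockLaw γ) (clockLaw γ) := by
  refine ⟨measurable_shift_left s, Measure.ext_of_lintegral _ fun F hF => ?_⟩
  rw [lintegral_map hF (measurable_shift_left s)]
  have hset : ∀ n : ℕ, MeasurableSet {w | Hits s n w} := fun n =>
    (measurableSet_hits n).preimage (f := fun w => (s, w)) (by fun_prop)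
  have hsum : ∀ G : (ℕ → ℝ) → ℝ≥0∞, Measurable G → ∫⁻ w, G w ∂clockLaw γ =
      ∑' n, ∫⁻ w, {w | Hits s n w}.indicator G w ∂clockLaw γ := fun G hG => by
    rw [← lintegral_tsum fun n => (hG.indicator (hset n)).aemeasurable]
    refine lintegral_congr_ae ?_
    filter_upwards [ae_goodSeq] with w hw
    have hc := hits_cnt (hw.unbounded s)
    rw [tsum_eq_single (cnt s w), indicator_of_mem (show w ∈ {w' | Hits s (cnt s w) w'} from hc)]
    exact fun n hn => indicator_of_notMem
      (show w ∉ {w | Hits s n w} from fun hh => hn hh.cnt_eq.symm) _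
  have hone : ∑' n, clockLaw γ {w | Hits s n w} = 1 := by
    have := hsum 1 measurable_one
    simp only [Pi.one_apply, lintegral_one, measure_univ, lintegral_indicator_one (hset _)] at this
    exact this.symm
  rw [hsum (fun w => F (shift s w)) (hF.comp (measurable_shift_left s))]
  simp_rw [lintegral_shift_of_hits hF _ hs]
  rw [ENNReal.tsum_mul_right, hone, one_mul]

/-! ## The law of the family of clocks -/

/-- The law of independent Poisson clocks on the edges. -/
noncomputable def clocksLaw (γ : ℝ) : Measure (ℤ → ℕ → ℝ) :=
  Measure.infinitePi fun _ : ℤ => clockLaw γ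

/-- All clocks as seen from time `s`. -/
noncomputable def shiftAll (s : ℝ) (c : ℤ → ℕ → ℝ) : ℤ → ℕ → ℝ := fun e => shift s (c e)

instance : IsProbabilityMeasure (clocksLaw γ) := by
  unfold clocksLaw
  infer_instance

omit hγ in
theorem measurable_shiftAll : Measurable fun p : ℝ × (ℤ → ℕ → ℝ) => shiftAll p.1 p.2 :=
  measurable_pi_lambda _ fun e =>
    measurable_shift.comp (f := fun p : ℝ × (ℤ → ℕ → ℝ) => (p.1, p.2 e)) (by fun_prop)

omit hγ in
theorem measurable_shiftAll_left (s : ℝ) : Measurable (shiftAll s) :=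
  measurable_shiftAll.comp (f := fun c => (s, c)) (by fun_prop)

theorem measurePreserving_shiftAll {s : ℝ} (hs : 0 ≤ s) :
    MeasurePreserving (shiftAll s) (clocksLaw γ) (clocksLaw γ) := by
  refine ⟨measurable_shiftAll_left s, ?_⟩
  have h := Measure.infinitePi_map_pi (μ := fun _ : ℤ => clockLaw γ) (f := fun _ => shift s)
    fun _ => measurable_shift_left s
  simp only [(measurePreserving_shift hs).map_eq] at h
  exact h

omit hγ in
theorem shiftAll_update (s : ℝ) (c : ℤ → ℕ → ℝ) (e : ℤ) (w : ℕ → ℝ) :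
    shiftAll s (Function.update c e w) = Function.update (shiftAll s c) e (shift s w) := by
  funext e'
  by_cases h : e' = e
  · subst h; simp [shiftAll]
  · simp [shiftAll, h]

/-- If the first arrival on the two edges `a`, `b` is on `a`, it happens at an exponential time of
rate `2 * γ`, after which the clocks start afresh. -/
theorem lintegral_first_arrival {a b : ℤ} (hab : a ≠ b) {θ : ℝ} (hθ : 0 ≤ θ)
    {G : (ℤ → ℕ → ℝ) → ℝ≥0∞} (hG : Measurable G) :
    ∫⁻ c, {c : ℤ → ℕ → ℝ | c a 0 < c b 0}.indicator (fun c =>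
        ENNReal.ofReal (Real.exp (-(θ * c a 0))) * G (shiftAll (c a 0) c)) c ∂clocksLaw γ =
      ENNReal.ofReal (γ / (2 * γ + θ)) * ∫⁻ c, G c ∂clocksLaw γ := by
  have hup : ∀ e : ℤ, Measurable fun p : (ℕ → ℝ) × (ℤ → ℕ → ℝ) => Function.update p.2 e p.1 :=
    fun e => (measurePreserving_update (fun _ : ℤ => clockLaw γ) e).measurable
  set F : (ℤ → ℕ → ℝ) → ℝ≥0∞ := {c : ℤ → ℕ → ℝ | c a 0 < c b 0}.indicator (fun c =>
    ENNReal.ofReal (Real.exp (-(θ * c a 0))) * G (shiftAll (c a 0) c)) with hFdef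
  have hF : Measurable F := by
    refine Measurable.indicator ?_ (measurableSet_lt (by fun_prop) (by fun_prop))
    refine Measurable.mul (by fun_prop) (hG.comp ?_)
    exact measurable_shiftAll.comp (f := fun c : ℤ → ℕ → ℝ => (c a 0, c)) (by fun_prop)
  set Γ : (ℕ → ℝ) → ℝ≥0∞ := fun w => ∫⁻ c, G (Function.update c a w) ∂clocksLaw γ with hΓdef
  have hΓ : Measurable Γ := (hG.comp (hup a)).lintegral_prod_right'
  -- Once clock `a` is frozen at `w`, its first arrival is a deterministic time. Clock `b` has to
  -- exceed it, which costs `exp (-(γ * w 0))` by memorylessness, and the other clocks restart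
  -- afresh there.
  have key : ∀ w : ℕ → ℝ, 0 < w 0 → ∫⁻ c, F (Function.update c a w) ∂clocksLaw γ =
      ENNReal.ofReal (Real.exp (-((θ + γ) * w 0))) * Γ (shift (w 0) w) := by
    intro w hw
    have hup' : Measurable fun p : (ℕ → ℝ) × (ℤ → ℕ → ℝ) =>
        Function.update (Function.update p.2 b p.1) a w :=
      (hup a).comp (f := fun p : (ℕ → ℝ) × (ℤ → ℕ → ℝ) => (w, Function.update p.2 b p.1))
        (measurable_const.prodMk (hup b))
    have hupa : ∀ w, Measurable fun c : ℤ → ℕ → ℝ => Function.update c a w := fun w =>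
      (hup a).comp (f := fun c => (w, c)) (by fun_prop)
    have hGw : Measurable fun c => G (Function.update c a (shift (w 0) w)) := hG.comp (hupa _)
    have hGb : Measurable fun p : (ℕ → ℝ) × (ℤ → ℕ → ℝ) =>
        G (Function.update (Function.update p.2 b p.1) a (shift (w 0) w)) := hGw.comp (hup b)
    have inner : ∀ c, ∫⁻ v, F (Function.update (Function.update c b v) a w) ∂clockLaw γ =
        ENNReal.ofReal (Real.exp (-((θ + γ) * w 0))) *
          ∫⁻ v, G (Function.update (Function.update (shiftAll (w 0) c) b v) a (shift (w 0) w))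
            ∂clockLaw γ := fun c => by
      have hK : Measurable fun v =>
          G (Function.update (Function.update (shiftAll (w 0) c) b v) a (shift (w 0) w)) :=
        hGb.comp (f := fun v => (v, shiftAll (w 0) c)) (by fun_prop)
      have := lintegral_shift_of_lt (γ := γ) hw.le hK
      have he : Real.exp (-((θ + γ) * w 0)) =
          Real.exp (-(θ * w 0)) * Real.exp (-(γ * w 0)) := by
        rw [← Real.exp_add]; ring_nf
      rw [he, ENNReal.ofReal_mul (Real.exp_pos _).le, mul_assoc, ← this, ← lintegral_const_mul]
      · refine lintegral_congr fun v => ?_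
        simp only [hFdef, indicator_apply, mem_ofPred, Function.update_self,
          Function.update_of_ne hab.symm, shiftAll_update]
        split_ifs <;> simp
      · exact (hK.comp (measurable_shift_left _)).indicator
          (measurableSet_lt measurable_const (measurable_pi_apply 0))
    have h1 := lintegral_infinitePi_update (fun _ : ℤ => clockLaw γ) b (hF.comp (hupa w))
    have h2 := lintegral_infinitePi_update (fun _ : ℤ => clockLaw γ) b hGw
    change ∫⁻ c, F (Function.update c a w) ∂clocksLaw γ = _ at h1
    refine h1.trans ((lintegral_lintegral_swap (f := fun v c =>
      F (Function.update (Function.update c b v) a w)) (hF.comp hup').aemeasurable).trans ?_)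
    change ∫⁻ c, ∫⁻ v, F (Function.update (Function.update c b v) a w) ∂clockLaw γ ∂clocksLaw γ = _
    simp_rw [inner]
    have hI : Measurable fun c : ℤ → ℕ → ℝ => ∫⁻ v, G (Function.update (Function.update c b v) a
        (shift (w 0) w)) ∂clockLaw γ := hGb.lintegral_prod_left'
    rw [lintegral_const_mul _ (show Measurable fun c => ∫⁻ v, G (Function.update (Function.update
      (shiftAll (w 0) c) b v) a (shift (w 0) w)) ∂clockLaw γ from
        hI.comp (measurable_shiftAll_left _)), (measurePreserving_shiftAll hw.le).lintegral_comp hI]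
    congr 1
    rw [hΓdef]
    refine Eq.trans ?_ h2.symm
    rw [lintegral_lintegral_swap]
    · rfl
    · exact (hGb.comp measurable_swap).aemeasurable
  have h1 := lintegral_infinitePi_update (fun _ : ℤ => clockLaw γ) a hF
  have h2 := lintegral_infinitePi_update (fun _ : ℤ => clockLaw γ) a hG
  change ∫⁻ c, F c ∂clocksLaw γ = ∫⁻ w, ∫⁻ c, F (Function.update c a w) ∂clocksLaw γ ∂clockLaw γ
    at h1
  change ∫⁻ c, G c ∂clocksLaw γ = ∫⁻ w, Γ w ∂clockLaw γ at h2
  rw [h1, h2]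
  have h3 : ∫⁻ w, ∫⁻ c, F (Function.update c a w) ∂clocksLaw γ ∂clockLaw γ =
      ∫⁻ w, ENNReal.ofReal (Real.exp (-((θ + γ) * w 0))) * Γ (shift (w 0) w) ∂clockLaw γ := by
    refine lintegral_congr_ae ?_
    filter_upwards [ae_goodSeq] with w hw using key w (hw.pos 0)
  have hm : Measurable fun w : ℕ → ℝ =>
      ENNReal.ofReal (Real.exp (-((θ + γ) * w 0))) * Γ (shift (w 0) w) := by
    refine Measurable.mul (by fun_prop) (hΓ.comp ?_)
    exact measurable_shift.comp (f := fun w : ℕ → ℝ => (w 0, w)) (by fun_prop)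
  have h4 := lintegral_infinitePi_cons (expMeasure γ) hm
  change ∫⁻ w, _ ∂clockLaw γ = ∫⁻ u, ∫⁻ w, _ ∂clockLaw γ ∂expMeasure γ at h4
  rw [h3, h4]
  -- Seen from its own first arrival `u`, clock `a` is the sequence of its later waiting times,
  -- which is independent of `u`. Only the Laplace transform of `u` at `θ + γ` remains.
  have h5 : ∀ u : ℝ, ∫⁻ w, (ENNReal.ofReal (Real.exp (-((θ + γ) * u))) *
      Γ (shift u (seqCons u w))) ∂clockLaw γ =
      ENNReal.ofReal (Real.exp (-((θ + γ) * u))) * ∫⁻ w, Γ w ∂clockLaw γ := fun u => by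
    rw [← lintegral_const_mul _ hΓ]
    refine lintegral_congr_ae ?_
    filter_upwards [ae_goodSeq] with w hw
    have hh : Hits (u - u) 0 w := ⟨by simpa using hw.arrT_pos 0, by simp⟩
    rw [hh.shift_cons le_rfl]
    have : shift (u - u) w = w := by
      funext j
      rw [shift, hh.cnt_eq]
      split_ifs with hj
      · subst hj; simp [arrT_zero]
      · rw [zero_add]
    rw [this]
  refine (lintegral_congr h5).trans ?_
  rw [lintegral_mul_const _ (by fun_prop),
    lintegral_exp_neg_expMeasure hγ.out (by linarith [hγ.out] : 0 ≤ θ + γ)]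
  congr 3
  ring

end Law

end SSEP

/-! ## The motion of a label, in real time -/

namespace SSEP

/-- The first arrival after time `s`. -/
noncomputable def rnext (s : ℝ) (w : ℕ → ℝ) : ℝ := arrT w (cnt s w)

/-- One move of a label, with a real clock time. -/
noncomputable def rmove (c : ℤ → ℕ → ℝ) (p : ℤ × ℝ) : ℤ × ℝ :=
  if rnext p.2 (c p.1) ≤ rnext p.2 (c (p.1 - 1))
  then (p.1 + 1, rnext p.2 (c p.1))
  else (p.1 - 1, rnext p.2 (c (p.1 - 1)))

/-- Position and time of a label after `k` moves, with a real clock time. -/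
noncomputable def rchain (c : ℤ → ℕ → ℝ) (z : ℤ) (k : ℕ) : ℤ × ℝ := (rmove c)^[k] (z, 0)

/-- The label `z` is at `x` at time `t`. -/
def RSits (c : ℤ → ℕ → ℝ) (z : ℤ) (t : ℝ) (x : ℤ) : Prop :=
  ∃ k : ℕ, (rchain c z k).1 = x ∧ (rchain c z k).2 ≤ t ∧ t < (rchain c z (k + 1)).2

/-- All clocks tick infinitely often, and no two of them at the same time. -/
structure Good (c : ℤ → ℕ → ℝ) : Prop where
  seq : ∀ e, GoodSeq (c e)
  noTie : ∀ e e', e ≠ e' → ∀ i j, arrT (c e) i ≠ arrT (c e') j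

theorem rchain_zero (c : ℤ → ℕ → ℝ) (z : ℤ) : rchain c z 0 = (z, 0) := rfl

theorem rchain_succ (c : ℤ → ℕ → ℝ) (z : ℤ) (k : ℕ) :
    rchain c z (k + 1) = rmove c (rchain c z k) :=
  Function.iterate_succ_apply' _ _ _

theorem Hits.rnext_eq {s : ℝ} {n : ℕ} {w : ℕ → ℝ} (h : Hits s n w) : rnext s w = arrT w n := by
  rw [rnext, h.cnt_eq]

theorem GoodSeq.lt_rnext {w : ℕ → ℝ} (h : GoodSeq w) (s : ℝ) : s < rnext s w :=
  (hits_cnt (h.unbounded s)).1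

theorem GoodSeq.rnext_le {w : ℕ → ℝ} (h : GoodSeq w) {s : ℝ} {i : ℕ} (hi : s < arrT w i) :
    rnext s w ≤ arrT w i :=
  h.arrT_strictMono.monotone (Nat.sInf_le hi)

theorem GoodSeq.rnext_zero {w : ℕ → ℝ} (h : GoodSeq w) : rnext 0 w = w 0 := by
  rw [Hits.rnext_eq (n := 0) ⟨h.arrT_pos 0, by simp⟩, arrT_zero]

theorem GoodSeq.rnext_add {w : ℕ → ℝ} (h : GoodSeq w) (s : ℝ) {τ : ℝ} (hτ : 0 ≤ τ) :
    rnext (s + τ) w = s + rnext τ (SSEP.shift s w) := by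
  have h₁ := hits_cnt (h.unbounded s)
  have h₂ := hits_cnt ((h.shift s).unbounded τ)
  have h₃ : Hits (s + τ) (cnt s w + cnt τ (SSEP.shift s w)) w := by
    refine ⟨?_, fun i hi => ?_⟩
    · have := h₂.1
      rw [arrT_shift] at this
      linarith
    · rcases lt_or_ge i (cnt s w) with hlt | hge
      · linarith [h₁.2 i hlt]
      · obtain ⟨j, rfl⟩ := Nat.exists_eq_add_of_le hge
        have := h₂.2 j (by omega)
        rw [arrT_shift] at this
        linarith
  rw [h₃.rnext_eq, rnext, arrT_shift]
  ring

theorem GoodSeq.rnext_eq_of_between {w : ℕ → ℝ} (h : GoodSeq w) {τ s : ℝ} (h₁ : τ ≤ s)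
    (h₂ : s < rnext τ w) : rnext s w = rnext τ w := by
  have := hits_cnt (h.unbounded τ)
  exact Hits.rnext_eq ⟨h₂, fun i hi => (this.2 i hi).trans h₁⟩

theorem Good.shiftAll {c : ℤ → ℕ → ℝ} (h : Good c) (s : ℝ) : Good (shiftAll s c) where
  seq e := (h.seq e).shift s
  noTie e e' hne i j := by
    simp only [SSEP.shiftAll, arrT_shift]
    intro heq
    exact h.noTie e e' hne _ _ (sub_left_injective heq)

section Deterministic

variable {c : ℤ → ℕ → ℝ}

theorem Good.lt_rmove (h : Good c) (p : ℤ × ℝ) : p.2 < (rmove c p).2 := by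
  unfold rmove
  split_ifs
  · exact (h.seq _).lt_rnext _
  · exact (h.seq _).lt_rnext _

theorem rmove_snd (p : ℤ × ℝ) :
    (rmove c p).2 = min (rnext p.2 (c p.1)) (rnext p.2 (c (p.1 - 1))) := by
  unfold rmove
  split_ifs with hle
  · exact (min_eq_left hle).symm
  · exact (min_eq_right (not_le.1 hle).le).symm

theorem Good.strictMono_time (h : Good c) (z : ℤ) : StrictMono fun k => (rchain c z k).2 :=
  strictMono_nat_of_lt_succ fun k => by rw [rchain_succ]; exact h.lt_rmove _

theorem Good.time_nonneg (h : Good c) (z : ℤ) (k : ℕ) : 0 ≤ (rchain c z k).2 :=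
  (h.strictMono_time z).monotone (Nat.zero_le k)

theorem Good.rmove_add (h : Good c) (x : ℤ) (s : ℝ) {τ : ℝ} (hτ : 0 ≤ τ) :
    rmove c (x, s + τ) =
      ((rmove (SSEP.shiftAll s c) (x, τ)).1, s + (rmove (SSEP.shiftAll s c) (x, τ)).2) := by
  simp only [rmove, (h.seq _).rnext_add s hτ, SSEP.shiftAll, add_le_add_iff_left]
  split_ifs with hle <;> simp [hle]

theorem Good.iterate_rmove_add (h : Good c) (s : ℝ) (k : ℕ) :
    ∀ (x : ℤ) {τ : ℝ}, 0 ≤ τ → (rmove c)^[k] (x, s + τ) =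
      (((rmove (SSEP.shiftAll s c))^[k] (x, τ)).1,
        s + ((rmove (SSEP.shiftAll s c))^[k] (x, τ)).2) := by
  induction k with
  | zero => intro x τ _; rfl
  | succ k ih =>
    intro x τ hτ
    rw [Function.iterate_succ_apply, Function.iterate_succ_apply, h.rmove_add x s hτ]
    exact ih _ (hτ.trans ((h.shiftAll s).lt_rmove (x, τ)).le)

theorem Good.iterate_rmove (h : Good c) (s : ℝ) (k : ℕ) (x : ℤ) :
    (rmove c)^[k] (x, s) =
      ((rchain (SSEP.shiftAll s c) x k).1, s + (rchain (SSEP.shiftAll s c) x k).2) := by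
  have := h.iterate_rmove_add s k x le_rfl
  rwa [add_zero] at this

/-- First-step decomposition: after its first move a label is a new label driven by the restarted
clocks. The form matches the integrand of `lintegral_first_arrival`. -/
theorem Good.rchain_succ_of_lt (h : Good c) {z : ℤ} (hlt : c z 0 < c (z - 1) 0) (k : ℕ) :
    rchain c z (k + 1) = ((rchain (SSEP.shiftAll (c z 0) c) (z + 1) k).1,
      c z 0 + (rchain (SSEP.shiftAll (c z 0) c) (z + 1) k).2) := by
  rw [rchain, Function.iterate_succ_apply, ← h.iterate_rmove]
  congr 1
  simp only [rmove, (h.seq _).rnext_zero, hlt.le, if_true]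

theorem Good.rchain_succ_of_gt (h : Good c) {z : ℤ} (hlt : c (z - 1) 0 < c z 0) (k : ℕ) :
    rchain c z (k + 1) = ((rchain (SSEP.shiftAll (c (z - 1) 0) c) (z - 1) k).1,
      c (z - 1) 0 + (rchain (SSEP.shiftAll (c (z - 1) 0) c) (z - 1) k).2) := by
  rw [rchain, Function.iterate_succ_apply, ← h.iterate_rmove]
  congr 1
  simp only [rmove, (h.seq _).rnext_zero, hlt.not_ge, if_false]

theorem rmove_cases (p : ℤ × ℝ) :
    (∃ i, (rmove c p).1 = p.1 + 1 ∧ (rmove c p).2 = arrT (c p.1) i) ∨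
      (∃ i, (rmove c p).1 = p.1 - 1 ∧ (rmove c p).2 = arrT (c (p.1 - 1)) i) := by
  unfold rmove
  split_ifs
  · exact Or.inl ⟨_, rfl, rfl⟩
  · exact Or.inr ⟨_, rfl, rfl⟩

/-- The later label enters the common site through a tick of one of its two edges, and this tick
carries the earlier one away if it is still there. -/
theorem Good.rmove_le_of_lt (h : Good c) {z z' : ℤ} {k k' : ℕ}
    (hpos : (rchain c z k).1 = (rchain c z' k').1) (hlt : (rchain c z k).2 < (rchain c z' k').2) :
    (rmove c (rchain c z k)).2 ≤ (rchain c z' k').2 := by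
  cases k' with
  | zero => exact absurd hlt (not_lt.2 (h.time_nonneg z k))
  | succ k' =>
    rw [rmove_snd]
    rw [rchain_succ] at hpos hlt ⊢
    rcases rmove_cases (c := c) (rchain c z' k') with ⟨i, h₁, h₂⟩ | ⟨i, h₁, h₂⟩
    · refine (min_le_right _ _).trans ?_
      rw [h₂] at hlt ⊢
      rw [h₁] at hpos
      rw [hpos, add_sub_cancel_right]
      exact (h.seq _).rnext_le hlt
    · refine (min_le_left _ _).trans ?_
      rw [h₂] at hlt ⊢
      rw [h₁] at hpos
      rw [hpos]
      exact (h.seq _).rnext_le hlt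

/-- The dynamics can be run backwards. Without ties, equal arrival times mean that the same edge was
crossed, hence the preceding positions agree. The preceding times agree as well, since otherwise the
earlier label would have left before the other one came. -/
theorem Good.rchain_inj (h : Good c) {z z' : ℤ} (k : ℕ) :
    ∀ {k' : ℕ}, rchain c z k = rchain c z' k' → z = z' := by
  induction k with
  | zero =>
    intro k' heq
    cases k' with
    | zero => exact congrArg Prod.fst heq
    | succ k' =>
      have h₁ := h.strictMono_time z' (Nat.succ_pos k')
      have h₂ := congrArg Prod.snd heq
      simp only [rchain_zero] at h₁ h₂
      exact absurd h₂ h₁.ne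
  | succ k ih =>
    intro k' heq
    cases k' with
    | zero =>
      have h₁ := h.strictMono_time z (Nat.succ_pos k)
      have h₂ := congrArg Prod.snd heq
      simp only [rchain_zero] at h₁ h₂
      exact absurd h₂ h₁.ne'
    | succ k' =>
      rw [rchain_succ, rchain_succ] at heq
      have h₁ := congrArg Prod.fst heq
      have h₂ := congrArg Prod.snd heq
      have hpos : (rchain c z k).1 = (rchain c z' k').1 := by
        rcases rmove_cases (c := c) (rchain c z k) with ⟨i, a₁, a₂⟩ | ⟨i, a₁, a₂⟩ <;>
        rcases rmove_cases (c := c) (rchain c z' k') with ⟨j, b₁, b₂⟩ | ⟨j, b₁, b₂⟩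
        · omega
        · exact absurd (a₂.symm.trans (h₂.trans b₂)) (h.noTie _ _ (by omega) _ _)
        · exact absurd (a₂.symm.trans (h₂.trans b₂)) (h.noTie _ _ (by omega) _ _)
        · omega
      refine ih (Prod.ext hpos ?_)
      rcases lt_trichotomy (rchain c z k).2 (rchain c z' k').2 with hlt | heq' | hgt
      · have := h.rmove_le_of_lt hpos hlt
        have := h.lt_rmove (rchain c z' k')
        linarith
      · exact heq'
      · have := h.rmove_le_of_lt hpos.symm hgt
        have := h.lt_rmove (rchain c z k)
        linarith

theorem Good.label_unique (h : Good c) {z z' : ℤ} {t : ℝ} {x : ℤ} (hz : RSits c z t x)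
    (hz' : RSits c z' t x) : z = z' := by
  obtain ⟨k, h₁, h₂, h₃⟩ := hz
  obtain ⟨k', h₁', h₂', h₃'⟩ := hz'
  have hpos := h₁.trans h₁'.symm
  rw [rchain_succ] at h₃ h₃'
  rcases lt_trichotomy (rchain c z k).2 (rchain c z' k').2 with hlt | heq' | hgt
  · have := h.rmove_le_of_lt hpos hlt
    linarith
  · exact h.rchain_inj k (Prod.ext hpos heq')
  · have := h.rmove_le_of_lt hpos.symm hgt
    linarith

theorem Good.index_unique (h : Good c) {z : ℤ} {t : ℝ} {k k' : ℕ}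
    (h₁ : (rchain c z k).2 ≤ t) (h₂ : t < (rchain c z (k' + 1)).2) : k ≤ k' := by
  by_contra hlt
  have := (h.strictMono_time z).monotone (show k' + 1 ≤ k by omega)
  linarith

theorem Good.position_unique (h : Good c) {z : ℤ} {t : ℝ} {x x' : ℤ} (hx : RSits c z t x)
    (hx' : RSits c z t x') : x = x' := by
  obtain ⟨k, h₁, h₂, h₃⟩ := hx
  obtain ⟨k', h₁', h₂', h₃'⟩ := hx'
  have : k = k' := le_antisymm (h.index_unique h₂ h₃') (h.index_unique h₂' h₃)
  rw [← h₁, ← h₁', this]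

theorem exists_rSits {z : ℤ} {t : ℝ} (ht : 0 ≤ t) (hub : ∃ k, t < (rchain c z k).2) :
    ∃ x, RSits c z t x := by
  classical
  have hspec := Nat.find_spec hub
  have hpos : Nat.find hub ≠ 0 := fun h0 => by
    rw [h0] at hspec
    exact absurd hspec (not_lt.2 ht)
  obtain ⟨k, hk⟩ := Nat.exists_eq_succ_of_ne_zero hpos
  refine ⟨_, k, rfl, not_lt.1 (Nat.find_min hub (m := k) (by omega)), ?_⟩
  rw [hk] at hspec
  exact hspec

/-- Flow property. Nothing ticks at `x` between the last move before `s` and time `s`, so both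
descriptions have the same moves after `s`. Their initial states carry different times (the last
move, respectively `s`), which is why the case of no further move is treated apart. -/
theorem Good.rSits_shift (h : Good c) {z x y : ℤ} {s t : ℝ} (hst : s ≤ t) (hx : RSits c z s x) :
    RSits c z t y ↔ RSits (SSEP.shiftAll s c) x (t - s) y := by
  obtain ⟨k, h₁, h₂, h₃⟩ := hx
  have hmove : rmove c (x, s) = rmove c (rchain c z k) := by
    rw [rchain_succ, rmove_snd, lt_min_iff] at h₃
    have e₁ := (h.seq _).rnext_eq_of_between h₂ h₃.1
    have e₂ := (h.seq _).rnext_eq_of_between h₂ h₃.2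
    rw [h₁] at e₁ e₂
    simp only [rmove, h₁, e₁, e₂]
  have hlater : ∀ j, rchain c z (k + (j + 1)) = ((rchain (SSEP.shiftAll s c) x (j + 1)).1,
      s + (rchain (SSEP.shiftAll s c) x (j + 1)).2) := fun j => by
    have : (rmove c)^[j + 1] (x, s) = (rmove c)^[j + 1] (rchain c z k) := by
      rw [Function.iterate_succ_apply, hmove, ← Function.iterate_succ_apply]
    rw [← h.iterate_rmove, this, rchain, rchain, ← Function.iterate_add_apply, add_comm]
  constructor
  · rintro ⟨k', h₁', h₂', h₃'⟩
    have hle := h.index_unique h₂ (lt_of_le_of_lt hst h₃')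
    obtain ⟨j, rfl⟩ := Nat.exists_eq_add_of_le hle
    have h₄ := hlater j
    rw [add_assoc, h₄] at h₃'
    refine ⟨j, ?_, ?_, by simp only at h₃'; linarith⟩
    · cases j with
      | zero => rw [← h₁', ← h₁]; rfl
      | succ j => rw [hlater] at h₁'; exact h₁'
    · cases j with
      | zero => rw [rchain_zero]; linarith
      | succ j => rw [hlater] at h₂'; simp only at h₂'; linarith
  · rintro ⟨j, h₁', h₂', h₃'⟩
    have h₄ := hlater j
    refine ⟨k + j, ?_, ?_, by rw [add_assoc, h₄]; linarith⟩
    · cases j with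
      | zero => rw [← h₁', add_zero, h₁]; rfl
      | succ j => rw [hlater]; exact h₁'
    · cases j with
      | zero => rw [add_zero]; linarith
      | succ j => rw [hlater]; simp only; linarith

/-! ### Comparison with the chain in extended time -/

theorem nextArrival_eq {ω : Sample} (h : Good ω.2) (e : ℤ) (s : ℝ) :
    nextArrival ω e (s : EReal) = (rnext s (ω.2 e) : EReal) := by
  unfold nextArrival
  refine le_antisymm ?_ (le_iInf fun i => ?_)
  · refine (iInf_le _ (cnt s (ω.2 e))).trans ?_
    have : (s : EReal) < (arrival ω e (cnt s (ω.2 e)) : EReal) :=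
      EReal.coe_lt_coe_iff.2 ((h.seq e).lt_rnext s)
    rw [if_pos this]
    exact le_rfl
  · split_ifs with hi
    · exact EReal.coe_le_coe_iff.2 ((h.seq e).rnext_le (EReal.coe_lt_coe_iff.1 hi))
    · exact le_top

theorem move_eq {ω : Sample} (h : Good ω.2) (x : ℤ) (s : ℝ) :
    move ω (x, (s : EReal)) = ((rmove ω.2 (x, s)).1, ((rmove ω.2 (x, s)).2 : EReal)) := by
  simp only [move, rmove, nextArrival_eq h, EReal.coe_le_coe_iff]
  split_ifs <;> rfl

theorem chain_eq {ω : Sample} (h : Good ω.2) (z : ℤ) (k : ℕ) :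
    chain ω z k = ((rchain ω.2 z k).1, ((rchain ω.2 z k).2 : EReal)) := by
  induction k with
  | zero => rfl
  | succ k ih =>
    rw [rchain_succ, ← move_eq h, ← ih, chain, Function.iterate_succ_apply']
    rfl

theorem sitsAt_iff {ω : Sample} (h : Good ω.2) (z : ℤ) (t : ℝ≥0) (x : ℤ) :
    SitsAt ω z t x ↔ RSits ω.2 z t x := by
  simp only [SitsAt, RSits, chain_eq h, EReal.coe_le_coe_iff, EReal.coe_lt_coe_iff]

/-! ### Translations -/

theorem rchain_translate (c : ℤ → ℕ → ℝ) (a z : ℤ) (k : ℕ) :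
    rchain (fun e => c (e + a)) z k = ((rchain c (z + a) k).1 - a, (rchain c (z + a) k).2) := by
  induction k with
  | zero => simp [rchain_zero]
  | succ k ih =>
    rw [rchain_succ, rchain_succ, ih]
    simp only [rmove, sub_add_cancel, sub_right_comm _ a 1]
    split_ifs
    · ext <;> simp only []
      ring
    · rw [sub_right_comm]

theorem rSits_translate (c : ℤ → ℕ → ℝ) (a z x : ℤ) (t : ℝ) :
    RSits (fun e => c (e + a)) z t (x - a) ↔ RSits c (z + a) t x := by
  simp only [RSits, rchain_translate, sub_left_inj]

end Deterministic

/-! ## Measurability -/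

theorem measurable_rnext : Measurable fun p : ℝ × (ℕ → ℝ) => rnext p.1 p.2 := by
  have : Measurable fun q : ℕ × (ℕ → ℝ) => arrT q.2 q.1 :=
    measurable_from_prod_countable_right fun n => measurable_arrT n
  exact this.comp (f := fun p : ℝ × (ℕ → ℝ) => (cnt p.1 p.2, p.2))
    (measurable_cnt.prodMk measurable_snd)

theorem measurable_rmove : Measurable fun q : (ℤ → ℕ → ℝ) × (ℤ × ℝ) => rmove q.1 q.2 := by
  have hn : Measurable fun q : (ℤ → ℕ → ℝ) × (ℤ × ℝ) => rnext q.2.2 (q.1 q.2.1) := by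
    have : Measurable fun q : ℤ × ((ℤ → ℕ → ℝ) × ℝ) => rnext q.2.2 (q.2.1 q.1) :=
      measurable_from_prod_countable_right fun x => measurable_rnext.comp
        (f := fun q : (ℤ → ℕ → ℝ) × ℝ => (q.2, q.1 x))
        (measurable_snd.prodMk ((measurable_pi_apply x).comp measurable_fst))
    exact this.comp (f := fun q : (ℤ → ℕ → ℝ) × (ℤ × ℝ) => (q.2.1, (q.1, q.2.2))) (by fun_prop)
  have hn' : Measurable fun q : (ℤ → ℕ → ℝ) × (ℤ × ℝ) => rnext q.2.2 (q.1 (q.2.1 - 1)) :=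
    hn.comp (f := fun q : (ℤ → ℕ → ℝ) × (ℤ × ℝ) => (q.1, (q.2.1 - 1, q.2.2))) (by fun_prop)
  unfold rmove
  exact Measurable.ite (measurableSet_le hn hn')
    (Measurable.prodMk (by fun_prop) hn) (Measurable.prodMk (by fun_prop) hn')

theorem measurable_rchain (z : ℤ) (k : ℕ) : Measurable fun c : ℤ → ℕ → ℝ => rchain c z k := by
  induction k with
  | zero => exact measurable_const
  | succ k ih =>
    simp only [rchain_succ]
    exact measurable_rmove.comp (f := fun c => (c, rchain c z k)) (measurable_id.prodMk ih)

theorem measurableSet_rSits (z : ℤ) (t : ℝ) (x : ℤ) : MeasurableSet {c | RSits c z t x} := by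
  simp only [RSits, ofPred_exists, ofPred_and]
  refine MeasurableSet.iUnion fun k => MeasurableSet.inter ?_ (MeasurableSet.inter ?_ ?_)
  · exact measurableSet_eq_fun (measurable_rchain z k).fst measurable_const
  · exact measurableSet_le (measurable_rchain z k).snd measurable_const
  · exact measurableSet_lt measurable_const (measurable_rchain z (k + 1)).snd

/-! ## Almost sure properties and exponential moments -/

section Law

variable {γ : ℝ} [hγ : Fact (0 < γ)]

theorem clockLaw_arrT_eq (i : ℕ) : ∀ r : ℝ, clockLaw γ {w | arrT w i = r} = 0 := by
  have hm : ∀ i r, MeasurableSet {w : ℕ → ℝ | arrT w i = r} := fun i r =>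
    measurableSet_eq_fun (measurable_arrT i) measurable_const
  induction i with
  | zero =>
    intro r
    have h := (measurePreserving_eval_infinitePi (fun _ : ℕ => expMeasure γ) 0).measure_preimage
      (measurableSet_singleton r).nullMeasurableSet
    rw [expMeasure_singleton] at h
    rw [← h]
    congr 1
    ext w
    simp [arrT_zero]
  | succ i ih =>
    intro r
    have h := lintegral_infinitePi_cons (expMeasure γ)
      ((measurable_one (α := ℝ≥0∞)).indicator (hm (i + 1) r))
    rw [lintegral_indicator_one (hm _ _)] at h
    refine h.trans ((lintegral_congr fun u => ?_).trans lintegral_zero)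
    rw [← ih (r - u), ← lintegral_indicator_one (hm _ _)]
    refine lintegral_congr fun w => ?_
    simp only [indicator_apply, mem_ofPred, arrT_cons_succ, eq_sub_iff_add_eq']
    rfl

theorem ae_good : ∀ᵐ c ∂clocksLaw γ, Good c := by
  have h₁ : ∀ᵐ c ∂clocksLaw γ, ∀ e, GoodSeq (c e) := by
    rw [ae_all_iff]
    exact fun e => (measurePreserving_eval_infinitePi
      (fun _ : ℤ => clockLaw γ) e).quasiMeasurePreserving.ae ae_goodSeq
  have h₂ : ∀ᵐ c ∂clocksLaw γ, ∀ e e', e ≠ e' → ∀ i j, arrT (c e) i ≠ arrT (c e') j := by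
    simp only [ae_all_iff]
    intro e e' hne i j
    have hm : MeasurableSet {c : ℤ → ℕ → ℝ | arrT (c e) i = arrT (c e') j} :=
      measurableSet_eq_fun ((measurable_arrT i).comp (measurable_pi_apply e))
        ((measurable_arrT j).comp (measurable_pi_apply e'))
    -- Resample clock `e` alone: the arrival on `e'` is then a constant, and arrival times have no
    -- atoms.
    have h := lintegral_infinitePi_update (fun _ : ℤ => clockLaw γ) e
      ((measurable_one (α := ℝ≥0∞)).indicator hm)
    rw [lintegral_indicator_one hm, lintegral_lintegral_swap] at h
    · rw [ae_iff]
      simp only [ne_eq, not_not]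
      refine h.trans ((lintegral_congr fun c => ?_).trans lintegral_zero)
      rw [← clockLaw_arrT_eq (γ := γ) i (arrT (c e') j),
        ← lintegral_indicator_one (measurableSet_eq_fun (measurable_arrT i) measurable_const)]
      refine lintegral_congr fun w => ?_
      simp only [indicator_apply, mem_ofPred, Function.update_self,
        Function.update_of_ne hne.symm]
      rfl
    · exact (((measurable_one (α := ℝ≥0∞)).indicator hm).comp
        (measurePreserving_update (fun _ : ℤ => clockLaw γ) e).measurable).aemeasurable
  filter_upwards [h₁, h₂] with c a b using ⟨a, b⟩

omit hγ in
theorem measurable_weight (l θ : ℝ) :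
    Measurable fun p : ℤ × ℝ => ENNReal.ofReal (Real.exp (l * p.1 - θ * p.2)) := by
  fun_prop

/-- Decompose at the first move: a move to the right and one to the left each contribute `γ / (2 * γ
+ θ)`, weighted by `exp l` and `exp (-l)`, and the clocks then restart. -/
theorem lintegral_weight_rchain (l : ℝ) {θ : ℝ} (hθ : 0 ≤ θ) (k : ℕ) : ∀ z : ℤ,
    ∫⁻ c, ENNReal.ofReal (Real.exp (l * (rchain c z k).1 - θ * (rchain c z k).2)) ∂clocksLaw γ =
      ENNReal.ofReal (Real.exp (l * z) * (2 * γ * Real.cosh l / (2 * γ + θ)) ^ k) := by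
  have hγ0 := hγ.out
  induction k with
  | zero => intro z; simp [rchain_zero]
  | succ k ih =>
    intro z
    have hG : ∀ y : ℤ, Measurable fun c : ℤ → ℕ → ℝ =>
        ENNReal.ofReal (Real.exp (l * (rchain c y k).1 - θ * (rchain c y k).2)) := fun y =>
      (measurable_weight l θ).comp (measurable_rchain y k)
    have h₁ := lintegral_first_arrival (γ := γ) (a := z) (b := z - 1) (by omega) hθ (hG (z + 1))
    have h₂ := lintegral_first_arrival (γ := γ) (a := z - 1) (b := z) (by omega) hθ (hG (z - 1))
    rw [ih] at h₁ h₂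
    have hm : Measurable ({c : ℤ → ℕ → ℝ | c z 0 < c (z - 1) 0}.indicator fun c =>
        ENNReal.ofReal (Real.exp (-(θ * c z 0))) * ENNReal.ofReal (Real.exp
          (l * (rchain (shiftAll (c z 0) c) (z + 1) k).1 -
            θ * (rchain (shiftAll (c z 0) c) (z + 1) k).2))) := by
      refine Measurable.indicator ?_ (measurableSet_lt (by fun_prop) (by fun_prop))
      refine Measurable.mul (by fun_prop) ((hG (z + 1)).comp ?_)
      exact measurable_shiftAll.comp (f := fun c : ℤ → ℕ → ℝ => (c z 0, c)) (by fun_prop)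
    have hsplit := lintegral_add_left (μ := clocksLaw γ) hm
      ({c : ℤ → ℕ → ℝ | c (z - 1) 0 < c z 0}.indicator fun c =>
        ENNReal.ofReal (Real.exp (-(θ * c (z - 1) 0))) * ENNReal.ofReal (Real.exp
          (l * (rchain (shiftAll (c (z - 1) 0) c) (z - 1) k).1 -
            θ * (rchain (shiftAll (c (z - 1) 0) c) (z - 1) k).2)))
    rw [h₁, h₂] at hsplit
    refine (lintegral_congr_ae ?_).trans (hsplit.trans ?_)
    · filter_upwards [ae_good] with c hc
      have hne := hc.noTie z (z - 1) (by omega) 0 0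
      rw [arrT_zero, arrT_zero] at hne
      simp only [indicator_apply, mem_ofPred]
      rcases lt_or_gt_of_ne hne with hlt | hgt
      · rw [if_pos hlt, if_neg hlt.not_gt, add_zero, hc.rchain_succ_of_lt hlt,
          ← ENNReal.ofReal_mul (Real.exp_pos _).le, ← Real.exp_add]
        ring_nf
      · rw [if_pos hgt, if_neg hgt.not_gt, zero_add, hc.rchain_succ_of_gt hgt,
          ← ENNReal.ofReal_mul (Real.exp_pos _).le, ← Real.exp_add]
        ring_nf
    have hp : 0 < 2 * γ + θ := by linarith
    have hc : 0 < Real.cosh l := Real.cosh_pos l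
    rw [← ENNReal.ofReal_mul (by positivity), ← ENNReal.ofReal_mul (by positivity),
      ← ENNReal.ofReal_add (by positivity) (by positivity)]
    congr 1
    rw [pow_succ]
    have e₁ : Real.exp (l * ((z + 1 : ℤ) : ℝ)) = Real.exp (l * z) * Real.exp l := by
      rw [← Real.exp_add]; push_cast; ring_nf
    have e₂ : Real.exp (l * ((z - 1 : ℤ) : ℝ)) = Real.exp (l * z) * Real.exp (-l) := by
      rw [← Real.exp_add]; push_cast; ring_nf
    rw [e₁, e₂]
    nth_rewrite 4 [Real.cosh_eq]
    field_simp

theorem tsum_lintegral_weight {l θ : ℝ} (hθ : 0 ≤ θ)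
    (hr : 2 * γ * Real.cosh l / (2 * γ + θ) < 1) (z : ℤ) :
    ∫⁻ c, ∑' k, ENNReal.ofReal (Real.exp (l * (rchain c z k).1 - θ * (rchain c z k).2))
      ∂clocksLaw γ =
      ENNReal.ofReal (Real.exp (l * z) / (1 - 2 * γ * Real.cosh l / (2 * γ + θ))) := by
  have hγ0 := hγ.out
  have hc : 0 < Real.cosh l := Real.cosh_pos l
  have hr0 : 0 ≤ 2 * γ * Real.cosh l / (2 * γ + θ) := by positivity
  rw [lintegral_tsum fun k => (show Measurable fun c : ℤ → ℕ → ℝ =>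
    ENNReal.ofReal (Real.exp (l * (rchain c z k).1 - θ * (rchain c z k).2)) from
      (measurable_weight l θ).comp (measurable_rchain z k)).aemeasurable]
  simp_rw [lintegral_weight_rchain l hθ]
  rw [← ENNReal.ofReal_tsum_of_nonneg (fun k => by positivity)
    ((summable_geometric_of_lt_one hr0 hr).mul_left _), tsum_mul_left,
    tsum_geometric_of_lt_one hr0 hr]
  rfl

/-- Labels do not explode: for `l = 0`, `θ = 1` the ratio of the geometric series is below 1, so the
discounted move times are almost surely summable. -/
theorem ae_time_unbounded : ∀ᵐ c ∂clocksLaw γ, ∀ (z : ℤ) (t : ℝ), ∃ k, t < (rchain c z k).2 := by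
  have hγ0 := hγ.out
  rw [ae_all_iff]
  intro z
  have h := tsum_lintegral_weight (γ := γ) (l := 0) (θ := 1) zero_le_one (by
    rw [Real.cosh_zero, mul_one, div_lt_one (by positivity)]; linarith) z
  have hm : ∀ k, Measurable fun c : ℤ → ℕ → ℝ =>
      ENNReal.ofReal (Real.exp (0 * (rchain c z k).1 - 1 * (rchain c z k).2)) := fun k =>
    (measurable_weight 0 1).comp (measurable_rchain z k)
  have hfin := ae_lt_top (Measurable.tsum hm) (h.trans_ne ENNReal.ofReal_ne_top)
  filter_upwards [hfin] with c hlt t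
  have ht := ENNReal.tendsto_atTop_zero_of_tsum_ne_top hlt.ne
  obtain ⟨i, hi⟩ := (ht.eventually_lt_const
    (show (0 : ℝ≥0∞) < ENNReal.ofReal (Real.exp (-t)) by positivity)).exists
  refine ⟨i, ?_⟩
  rw [ENNReal.ofReal_lt_ofReal_iff (Real.exp_pos _), Real.exp_lt_exp] at hi
  linarith

/-- A label is unlikely to travel far in a short time. -/
theorem clocksLaw_travel_le {l θ : ℝ} (hθ : 0 ≤ θ)
    (hr : 2 * γ * Real.cosh l / (2 * γ + θ) < 1) (z : ℤ) (H a : ℝ) :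
    clocksLaw γ {c | ∃ k, (rchain c z k).2 ≤ H ∧ a ≤ l * ((rchain c z k).1 - z)} ≤
      ENNReal.ofReal (Real.exp (θ * H - a) / (1 - 2 * γ * Real.cosh l / (2 * γ + θ))) := by
  have hm : ∀ k, Measurable fun c : ℤ → ℕ → ℝ =>
      ENNReal.ofReal (Real.exp (l * (rchain c z k).1 - θ * (rchain c z k).2)) := fun k =>
    (measurable_weight l θ).comp (measurable_rchain z k)
  have hmarkov := mul_meas_ge_le_lintegral₀ (μ := clocksLaw γ) (show Measurable fun c : ℤ → ℕ → ℝ =>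
      ∑' k, ENNReal.ofReal (Real.exp (l * (rchain c z k).1 - θ * (rchain c z k).2)) from
        Measurable.tsum hm).aemeasurable
    (ENNReal.ofReal (Real.exp (a + l * z - θ * H)))
  rw [tsum_lintegral_weight hθ hr] at hmarkov
  have hsub : {c | ∃ k, (rchain c z k).2 ≤ H ∧ a ≤ l * ((rchain c z k).1 - z)} ⊆
      {c | ENNReal.ofReal (Real.exp (a + l * z - θ * H)) ≤
        ∑' k, ENNReal.ofReal (Real.exp (l * (rchain c z k).1 - θ * (rchain c z k).2))} := by
    rintro c ⟨k, h₁, h₂⟩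
    -- One term of the sum over all moves already reaches the Markov threshold, so the bound covers
    -- all moves before `H` at once, without a maximal inequality.
    refine le_trans ?_ (ENNReal.le_tsum k)
    refine ENNReal.ofReal_le_ofReal (Real.exp_le_exp.2 ?_)
    have := mul_le_mul_of_nonneg_left h₁ hθ
    nlinarith
  refine (measure_mono hsub).trans ?_
  have hpos : 0 < ENNReal.ofReal (Real.exp (a + l * z - θ * H)) := by positivity
  rw [mul_comm, ← ENNReal.le_div_iff_mul_le (Or.inl hpos.ne') (Or.inl ENNReal.ofReal_ne_top)]
    at hmarkov
  refine hmarkov.trans (le_of_eq ?_)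
  rw [← ENNReal.ofReal_div_of_pos (Real.exp_pos _), div_right_comm, ← Real.exp_sub]
  ring_nf

/-! ## Labels at a fixed time form a permutation -/

theorem measurePreserving_translate (a : ℤ) :
    MeasurePreserving (fun (c : ℤ → ℕ → ℝ) e => c (e + a)) (clocksLaw γ) (clocksLaw γ) :=
  ⟨by fun_prop, Measure.map_infinitePi_infinitePi_of_inj (P := fun _ : ℤ => clockLaw γ)
    (f := fun e : ℤ => e + a) (add_left_injective a)⟩

/-- Mass transport. By translation invariance, the probabilities that the various labels sit at `x`
have the same sum as the probabilities that label 0 sits at the various sites. The latter sum is 1,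
since label 0 sits somewhere and only there. As labels exclude each other, the former sum is the
probability that `x` carries a label. -/
theorem ae_exists_label {t : ℝ} (ht : 0 ≤ t) :
    ∀ᵐ c ∂clocksLaw γ, ∀ x, ∃ z, RSits c z t x := by
  rw [ae_all_iff]
  intro x
  have h₁ : ∀ z, clocksLaw γ {c | RSits c z t x} = clocksLaw γ {c | RSits c 0 t (x - z)} := by
    intro z
    rw [← (measurePreserving_translate (γ := γ) z).measure_preimage
      (measurableSet_rSits 0 t (x - z)).nullMeasurableSet]
    congr 1
    ext c
    simp only [mem_ofPred, mem_preimage, rSits_translate, zero_add]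
  have h₂ : clocksLaw γ (⋃ z, {c | RSits c z t x}) = ∑' z, clocksLaw γ {c | RSits c z t x} := by
    refine measure_iUnion₀ (fun z z' hne => ?_) fun z => (measurableSet_rSits z t x).nullMeasurableSet
    refine measure_mono_null (fun c hc => ?_) (ae_iff.1 (ae_good (γ := γ)))
    exact fun hg => hne (hg.label_unique hc.1 hc.2)
  have h₃ : clocksLaw γ (⋃ y, {c | RSits c 0 t y}) = ∑' y, clocksLaw γ {c | RSits c 0 t y} := by
    refine measure_iUnion₀ (fun z z' hne => ?_) fun z => (measurableSet_rSits 0 t z).nullMeasurableSet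
    refine measure_mono_null (fun c hc => ?_) (ae_iff.1 (ae_good (γ := γ)))
    exact fun hg => hne (hg.position_unique hc.1 hc.2)
  have h₄ : clocksLaw γ (⋃ y, {c | RSits c 0 t y}) = 1 := by
    rw [← prob_compl_eq_zero_iff (MeasurableSet.iUnion fun y => measurableSet_rSits 0 t y)]
    refine (ae_iff (p := fun c => c ∈ ⋃ y, {c | RSits c 0 t y})).1 ?_
    filter_upwards [ae_time_unbounded] with c hc
    exact mem_iUnion.2 (exists_rSits ht (hc 0 t))
  have h₅ : clocksLaw γ (⋃ z, {c | RSits c z t x}) = 1 := by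
    rw [h₂, ← h₄, h₃]
    simp_rw [h₁]
    exact (Equiv.subLeft x).tsum_eq fun y => clocksLaw γ {c | RSits c 0 t y}
  rw [← prob_compl_eq_zero_iff (MeasurableSet.iUnion fun z => measurableSet_rSits z t x)] at h₅
  have := (ae_iff (p := fun c => c ∈ ⋃ z, {c | RSits c z t x})).2 h₅
  filter_upwards [this] with c hc using mem_iUnion.1 hc

end Law

end SSEP

/-! ### Mixing in product spaces, and covariances of almost surely equal variables -/

/-- On a rectangle the indicator factorises, and Fubini regroups the four independent variables. It
allows initial configurations and clocks to be mixed together. -/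
theorem measurePreserving_mix_prod {α β : Type*} [MeasurableSpace α] [MeasurableSpace β]
    {μ : Measure α} {ν : Measure β} [IsProbabilityMeasure μ] [IsProbabilityMeasure ν]
    {f : α × α → α} {g : β × β → β} (hf : MeasurePreserving f (μ.prod μ) μ)
    (hg : MeasurePreserving g (ν.prod ν) ν) :
    MeasurePreserving (fun p : (α × β) × (α × β) => (f (p.1.1, p.2.1), g (p.1.2, p.2.2)))
      ((μ.prod ν).prod (μ.prod ν)) (μ.prod ν) := by
  have hfm := hf.measurable
  have hgm := hg.measurable
  have hm : Measurable fun p : (α × β) × (α × β) => (f (p.1.1, p.2.1), g (p.1.2, p.2.2)) := by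
    fun_prop
  refine ⟨hm, (Measure.prod_eq fun s t hs ht => ?_).symm⟩
  rw [Measure.map_apply hm (hs.prod ht)]
  have hF : Measurable fun a : α × α => s.indicator (1 : α → ℝ≥0∞) (f a) :=
    (measurable_one.indicator hs).comp hfm
  have hG : Measurable fun b : β × β => t.indicator (1 : β → ℝ≥0∞) (g b) :=
    (measurable_one.indicator ht).comp hgm
  have e₁ : ∫⁻ a, ∫⁻ a', s.indicator (1 : α → ℝ≥0∞) (f (a, a')) ∂μ ∂μ = μ s := by
    rw [← lintegral_prod (fun a : α × α => s.indicator (1 : α → ℝ≥0∞) (f a)) hF.aemeasurable,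
      hf.lintegral_comp (measurable_one.indicator hs), lintegral_indicator_one hs]
  have e₂ : ∫⁻ b, ∫⁻ b', t.indicator (1 : β → ℝ≥0∞) (g (b, b')) ∂ν ∂ν = ν t := by
    rw [← lintegral_prod (fun b : β × β => t.indicator (1 : β → ℝ≥0∞) (g b)) hG.aemeasurable,
      hg.lintegral_comp (measurable_one.indicator ht), lintegral_indicator_one ht]
  have hFp : ∀ a, Measurable fun a' => s.indicator (1 : α → ℝ≥0∞) (f (a, a')) := fun a =>
    hF.comp measurable_prodMk_left
  have hGp : ∀ b, Measurable fun b' => t.indicator (1 : β → ℝ≥0∞) (g (b, b')) := fun b =>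
    hG.comp measurable_prodMk_left
  rw [← lintegral_indicator_one (hm (hs.prod ht)), ← e₁, ← e₂,
    ← lintegral_prod_mul hF.lintegral_prod_right'.aemeasurable
      hG.lintegral_prod_right'.aemeasurable,
    lintegral_prod _ (measurable_one.indicator (hm (hs.prod ht))).aemeasurable]
  refine lintegral_congr fun p => ?_
  rw [← lintegral_prod_mul (hFp p.1).aemeasurable (hGp p.2).aemeasurable]
  refine lintegral_congr fun p' => ?_
  classical
  simp only [indicator_apply, mem_preimage, mem_prod, Pi.one_apply]
  split_ifs <;> simp_all

theorem covariance_congr_ae {Ω : Type*} [MeasurableSpace Ω] {μ : Measure Ω} {X X' Y Y' : Ω → ℝ}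
    (hX : X =ᵐ[μ] X') (hY : Y =ᵐ[μ] Y') : cov[X, Y; μ] = cov[X', Y'; μ] := by
  unfold covariance
  rw [integral_congr_ae hX, integral_congr_ae hY]
  refine integral_congr_ae ?_
  filter_upwards [hX, hY] with ω h₁ h₂
  rw [h₁, h₂]

namespace SSEP

/-! ## Stationarity -/

theorem fin_two_ite (a : Fin 2) : (if a = 1 then 1 else 0 : Fin 2) = a := by
  fin_cases a <;> rfl

open Classical in
theorem env_apply {ω : Sample} (h : Good ω.2) (t : ℝ≥0) (x : ℤ) :
    env ω t x = if ∃ z, ω.1 z = 1 ∧ RSits ω.2 z t x then 1 else 0 := by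
  simp only [env, sitsAt_iff h]

/-- The configuration and the clocks as seen from time `s`. -/
noncomputable def restart (s : ℝ≥0) (ω : Sample) : Sample := (env ω s, shiftAll s ω.2)

theorem measurable_restart (s : ℝ≥0) : Measurable (restart s) :=
  ((measurable_pi_apply s).comp measurable_env).prodMk
    ((measurable_shiftAll_left s).comp measurable_snd)

section Law

variable {γ ρ : ℝ} [hγ : Fact (0 < γ)] [hρ : IsProbabilityMeasure (siteLaw ρ)]

theorem sampleLaw_eq (γ ρ : ℝ) : sampleLaw γ ρ =
    (Measure.infinitePi fun _ : ℤ => siteLaw ρ).prod (clocksLaw γ) := rfl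

instance : IsProbabilityMeasure (sampleLaw γ ρ) := by
  rw [sampleLaw_eq]
  infer_instance

omit hγ hρ in
theorem ae_sampleLaw_of_clocks {p : (ℤ → ℕ → ℝ) → Prop} (h : ∀ᵐ c ∂clocksLaw γ, p c) :
    ∀ᵐ ω ∂sampleLaw γ ρ, p ω.2 :=
  Measure.quasiMeasurePreserving_snd.ae h

/-- Fix the clocks: the configuration at time `s` is the initial one read through a map `σ`
determined by the clocks, hence again i.i.d. for every choice of them. Integrating over the clocks,
whose law is invariant under the restart, gives the joint law. -/
theorem measurePreserving_restart (s : ℝ≥0) :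
    MeasurePreserving (restart s) (sampleLaw γ ρ) (sampleLaw γ ρ) := by
  refine ⟨measurable_restart s, Measure.ext_of_lintegral _ fun F hF => ?_⟩
  rw [lintegral_map hF (measurable_restart s), sampleLaw_eq,
    lintegral_prod_symm (fun ω => F (restart s ω)) (hF.comp (measurable_restart s)).aemeasurable,
    lintegral_prod_symm _ hF.aemeasurable,
    ← (measurePreserving_shiftAll (γ := γ) s.coe_nonneg).lintegral_comp hF.lintegral_prod_left']
  refine lintegral_congr_ae ?_
  filter_upwards [ae_good, ae_exists_label (γ := γ) s.2] with c hc hlab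
  choose σ hσ using hlab
  -- Injectivity suffices: distinct sites read distinct independent variables.
  have hinj : Function.Injective σ := fun x x' hxx' =>
    hc.position_unique (hσ x) (hxx' ▸ hσ x')
  have henv : ∀ ξ : ℤ → Fin 2, restart s (ξ, c) = (fun x => ξ (σ x), shiftAll s c) := fun ξ => by
    refine Prod.ext (funext fun x => ?_) rfl
    change env (ξ, c) s x = ξ (σ x)
    rw [env_apply (ω := (ξ, c)) hc, ← fin_two_ite (ξ (σ x))]
    congr 1
    refine propext ⟨fun ⟨z, h₁, h₂⟩ => ?_, fun h => ⟨_, h, hσ x⟩⟩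
    rw [← hc.label_unique h₂ (hσ x)]
    exact h₁
  have hmp : MeasurePreserving (fun (ξ : ℤ → Fin 2) x => ξ (σ x))
      (Measure.infinitePi fun _ : ℤ => siteLaw ρ) (Measure.infinitePi fun _ : ℤ => siteLaw ρ) :=
    ⟨by fun_prop, Measure.map_infinitePi_infinitePi_of_inj (P := fun _ : ℤ => siteLaw ρ) hinj⟩
  have hFc : Measurable fun ξ : ℤ → Fin 2 => F (ξ, shiftAll s c) :=
    hF.comp measurable_prodMk_right
  rw [← hmp.lintegral_comp hFc]
  refine lintegral_congr fun ξ => ?_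
  rw [henv]

omit hρ in
theorem ae_env_eq_env_restart (s : ℝ≥0) : ∀ᵐ ω ∂sampleLaw γ ρ, ∀ (t : ℝ≥0) (x : ℤ), s ≤ t →
    env ω t x = env (restart s ω) (t - s) x := by
  filter_upwards [ae_sampleLaw_of_clocks ae_good, ae_sampleLaw_of_clocks ae_time_unbounded]
    with ω hc hub t x hst
  have hpos : ∀ z, ∃ y, RSits ω.2 z s y := fun z => exists_rSits s.coe_nonneg (hub z s)
  have hc' : Good (restart s ω).2 := hc.shiftAll s
  rw [env_apply hc, env_apply hc']
  congr 1
  have hts : (s : ℝ) ≤ t := hst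
  have h1 : ∀ y, (restart s ω).1 y = 1 ↔ ∃ z, ω.1 z = 1 ∧ RSits ω.2 z s y := fun y => by
    change env ω s y = 1 ↔ _
    rw [env_apply hc]
    split_ifs with h <;> simp [h]
  refine propext ⟨fun ⟨z, h₁, h₂⟩ => ?_, fun ⟨y, h₁, h₂⟩ => ?_⟩
  · obtain ⟨y, hy⟩ := hpos z
    refine ⟨y, (h1 y).2 ⟨z, h₁, hy⟩, ?_⟩
    rw [NNReal.coe_sub hst]
    exact (hc.rSits_shift hts hy).1 h₂
  · obtain ⟨z, hz, hy⟩ := (h1 y).1 h₁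
    refine ⟨z, hz, ?_⟩
    rw [NNReal.coe_sub hst] at h₂
    exact (hc.rSits_shift hts hy).2 h₂

/-- By stationarity the bottom of the boxes may be put at time `0`. -/
theorem exists_covariance_eq {H : ℝ} {y₁ y₂ : ℝ × ℝ} (hy : y₁.2 = y₂.2)
    {f₁ f₂ : Trajectory (Fin 2) → ℝ} (h₁ : ∀ η, 0 ≤ f₁ η ∧ f₁ η ≤ 1)
    (h₂ : ∀ η, 0 ≤ f₂ η ∧ f₂ η ≤ 1) (s₁ : SupportedOn f₁ (leftBox H y₁))
    (s₂ : SupportedOn f₂ (rightBox H y₂)) :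
    ∃ F₁ F₂ : Trajectory (Fin 2) → ℝ, Measurable F₁ ∧ Measurable F₂ ∧
      (∀ η, 0 ≤ F₁ η ∧ F₁ η ≤ 1) ∧ (∀ η, 0 ≤ F₂ η ∧ F₂ η ≤ 1) ∧
      (∀ η η', (∀ (t : ℝ≥0) (x : ℤ), (t : ℝ) ≤ H → (x : ℝ) ≤ y₁.1 → η t x = η' t x) →
        F₁ η = F₁ η') ∧
      (∀ η η', (∀ (t : ℝ≥0) (x : ℤ), (t : ℝ) ≤ H → y₂.1 ≤ (x : ℝ) → η t x = η' t x) →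
        F₂ η = F₂ η') ∧
      cov[f₁, f₂; law γ ρ] = cov[fun ω => F₁ (env ω), fun ω => F₂ (env ω); sampleLaw γ ρ] := by
  -- A box that begins below time 0 is only read at nonnegative times, hence the truncation. The
  -- truncated subtraction in `θ` is harmless because only times `t ≥ s` are read.
  set s : ℝ≥0 := y₁.2.toNNReal with hs
  let θ : Trajectory (Fin 2) → Trajectory (Fin 2) := fun η t x => η (t - s) x
  have hθ : Measurable θ := by fun_prop
  have hs₁ : ∀ t : ℝ≥0, y₁.2 ≤ t → s ≤ t := fun t ht => Real.toNNReal_le_iff_le_coe.2 ht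
  have hs₂ : ∀ t : ℝ≥0, y₁.2 ≤ t → (t : ℝ) ≤ y₁.2 + H → ((t - s : ℝ≥0) : ℝ) ≤ H :=
    fun t ht ht' => by
      rw [NNReal.coe_sub (hs₁ t ht)]
      have := Real.le_coe_toNNReal y₁.2
      linarith
  refine ⟨f₁ ∘ θ, f₂ ∘ θ, s₁.measurable.comp hθ, s₂.measurable.comp hθ, fun η => h₁ _,
    fun η => h₂ _, fun η η' hη => ?_, fun η η' hη => ?_, ?_⟩
  · refine s₁.congr fun x t hxt => ?_
    exact hη _ _ (hs₂ t hxt.2.1 hxt.2.2) hxt.1.2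
  · refine s₂.congr fun x t hxt => ?_
    refine hη _ _ (hs₂ t ?_ ?_) hxt.1.1
    · rw [hy]; exact hxt.2.1
    · rw [hy]; exact hxt.2.2
  · have hr := measurePreserving_restart (γ := γ) (ρ := ρ) s
    rw [law, covariance_map_fun s₁.measurable.aestronglyMeasurable
      s₂.measurable.aestronglyMeasurable measurable_env.aemeasurable]
    conv_rhs => rw [← hr.map_eq]
    rw [covariance_map_fun (X := fun ω => (f₁ ∘ θ) (env ω)) (Y := fun ω => (f₂ ∘ θ) (env ω))
      ((s₁.measurable.comp hθ).comp measurable_env).aestronglyMeasurable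
      ((s₂.measurable.comp hθ).comp measurable_env).aestronglyMeasurable
      hr.measurable.aemeasurable]
    refine covariance_congr_ae ?_ ?_
    · filter_upwards [ae_env_eq_env_restart (γ := γ) (ρ := ρ) s] with ω hω
      exact s₁.congr fun x t hxt => hω t x (hs₁ t hxt.2.1)
    · filter_upwards [ae_env_eq_env_restart (γ := γ) (ρ := ρ) s] with ω hω
      exact s₂.congr fun x t hxt => hω t x (hs₁ t (by rw [hy]; exact hxt.2.1))

end Law

/-! ## Locality -/

theorem rchain_congr {c c' : ℤ → ℕ → ℝ} {z : ℤ} {k : ℕ}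
    (h : ∀ j < k, c (rchain c z j).1 = c' (rchain c z j).1 ∧
      c ((rchain c z j).1 - 1) = c' ((rchain c z j).1 - 1)) : rchain c z k = rchain c' z k := by
  induction k with
  | zero => rfl
  | succ k ih =>
    have ih := ih fun j hj => h j (hj.trans (Nat.lt_succ_self k))
    obtain ⟨h₁, h₂⟩ := h k (Nat.lt_succ_self k)
    rw [rchain_succ, rchain_succ, ← ih, rmove, rmove, h₁, h₂]

/-- Labels that are in `B` at some time before `H` are in `S` at all times before `H`. -/
def Confined (c : ℤ → ℕ → ℝ) (H : ℝ) (B S : Set ℤ) : Prop :=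
  ∀ z k k', (rchain c z k).2 ≤ H → (rchain c z k').2 ≤ H → (rchain c z k).1 ∈ B →
    (rchain c z k').1 ∈ S

theorem exists_particle_of_confined {ω ω' : Sample} {H : ℝ} {B S : Set ℤ}
    (hg : Good ω.2) (hconf : Confined ω.2 H B S)
    (hS : ∀ x ∈ S, ω.1 x = ω'.1 x ∧ ω.2 x = ω'.2 x ∧ ω.2 (x - 1) = ω'.2 (x - 1)) {t : ℝ≥0}
    (ht : (t : ℝ) ≤ H) {x : ℤ} (hx : x ∈ B) (h : ∃ z, ω.1 z = 1 ∧ RSits ω.2 z t x) :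
    ∃ z, ω'.1 z = 1 ∧ RSits ω'.2 z t x := by
  obtain ⟨z, hz, k, h₁, h₂, h₃⟩ := h
  have hmem : ∀ j ≤ k, (rchain ω.2 z j).1 ∈ S := fun j hj => by
    have : (rchain ω.2 z j).2 ≤ (rchain ω.2 z k).2 := (hg.strictMono_time z).monotone hj
    exact hconf z k j (h₂.trans ht) (this.trans (h₂.trans ht)) (h₁ ▸ hx)
  -- Move `k + 1` must agree too, since its time decides whether the label is still there at `t`. It
  -- only reads the clocks around the position after `k` moves.
  have e : ∀ k' ≤ k + 1, rchain ω.2 z k' = rchain ω'.2 z k' := fun k' hk' =>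
    rchain_congr fun j hj => (hS _ (hmem j (by omega))).2
  refine ⟨z, ?_, k, ?_, ?_, ?_⟩
  · rw [← hz]
    exact (hS z (hmem 0 (Nat.zero_le k))).1.symm
  · rwa [← e k (Nat.le_succ k)]
  · rwa [← e k (Nat.le_succ k)]
  · rwa [← e (k + 1) le_rfl]

theorem env_congr_of_confined {ω ω' : Sample} {H : ℝ} {B S : Set ℤ}
    (hg : Good ω.2) (hg' : Good ω'.2) (hconf : Confined ω.2 H B S) (hconf' : Confined ω'.2 H B S)
    (hS : ∀ x ∈ S, ω.1 x = ω'.1 x ∧ ω.2 x = ω'.2 x ∧ ω.2 (x - 1) = ω'.2 (x - 1)) {t : ℝ≥0}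
    (ht : (t : ℝ) ≤ H) {x : ℤ} (hx : x ∈ B) : env ω t x = env ω' t x := by
  rw [env_apply hg, env_apply hg']
  congr 1
  exact propext ⟨exists_particle_of_confined hg hconf hS ht hx,
    exists_particle_of_confined hg' hconf'
      (fun x hx => ⟨(hS x hx).1.symm, (hS x hx).2.1.symm, (hS x hx).2.2.symm⟩) ht hx⟩

/-- Some label is both to the left of `p` and to the right of `q` before time `H`. -/
def Crossing (c : ℤ → ℕ → ℝ) (H p q : ℝ) : Prop :=
  ∃ z k k', (rchain c z k).2 ≤ H ∧ (rchain c z k').2 ≤ H ∧ ((rchain c z k).1 : ℝ) ≤ p ∧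
    q ≤ ((rchain c z k').1 : ℝ)

/-- The mixture takes everything indexed below `M` from the first sample and the rest from the
second. A label at `x` reads the edges `x - 1` and `x`, so on the right a margin of one site beyond
`M` keeps both edges outside `L`; the left margin is for symmetry. Two crossing events and the
factor 3 of the mixing bound give 6. -/
theorem covariance_le_of_crossing {γ ρ : ℝ} [hγ : Fact (0 < γ)]
    [hρ : IsProbabilityMeasure (siteLaw ρ)] {H a b M ε : ℝ}
    {F₁ F₂ : Trajectory (Fin 2) → ℝ} (m₁ : Measurable F₁) (m₂ : Measurable F₂)
    (h₁ : ∀ η, 0 ≤ F₁ η ∧ F₁ η ≤ 1) (h₂ : ∀ η, 0 ≤ F₂ η ∧ F₂ η ≤ 1)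
    (s₁ : ∀ η η', (∀ (t : ℝ≥0) (x : ℤ), (t : ℝ) ≤ H → (x : ℝ) ≤ a → η t x = η' t x) →
        F₁ η = F₁ η')
    (s₂ : ∀ η η', (∀ (t : ℝ≥0) (x : ℤ), (t : ℝ) ≤ H → b ≤ (x : ℝ) → η t x = η' t x) →
        F₂ η = F₂ η')
    (hε : 0 ≤ ε) (c₁ : clocksLaw γ {c | Crossing c H a (M - 1)} ≤ ENNReal.ofReal ε)
    (c₂ : clocksLaw γ {c | Crossing c H (M + 1) b} ≤ ENNReal.ofReal ε) :
    cov[fun ω => F₁ (env ω), fun ω => F₂ (env ω); sampleLaw γ ρ] ≤ 6 * ε := by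
  classical
  let L : Set ℤ := {x | (x : ℝ) < M}
  have hmix : MeasurePreserving (fun p : Sample × Sample =>
      (L.piecewise p.1.1 p.2.1, L.piecewise p.1.2 p.2.2))
      ((sampleLaw γ ρ).prod (sampleLaw γ ρ)) (sampleLaw γ ρ) :=
    measurePreserving_mix_prod (measurePreserving_mix (fun _ : ℤ => siteLaw ρ) L)
      (measurePreserving_mix (fun _ : ℤ => clockLaw γ) L)
  let A : Set Sample := Prod.snd ⁻¹' (toMeasurable (clocksLaw γ) {c | Crossing c H a (M - 1)} ∪
    toMeasurable (clocksLaw γ) {c | Crossing c H (M + 1) b} ∪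
    toMeasurable (clocksLaw γ) {c | ¬ Good c})
  have hA : sampleLaw γ ρ A ≤ ENNReal.ofReal (2 * ε) := by
    have hm := ((measurableSet_toMeasurable (clocksLaw γ) {c | Crossing c H a (M - 1)}).union
      (measurableSet_toMeasurable (clocksLaw γ) {c | Crossing c H (M + 1) b})).union
      (measurableSet_toMeasurable (clocksLaw γ) {c | ¬ Good c})
    have hp := (measurePreserving_snd (μ := Measure.infinitePi fun _ : ℤ => siteLaw ρ)
      (ν := clocksLaw γ)).measure_preimage hm.nullMeasurableSet
    rw [sampleLaw_eq]
    refine hp.trans_le ((measure_union_le _ _).trans ?_)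
    rw [measure_toMeasurable, ae_iff.1 (ae_good (γ := γ)), add_zero, two_mul,
      ENNReal.ofReal_add hε hε]
    refine (measure_union_le _ _).trans ?_
    rw [measure_toMeasurable, measure_toMeasurable]
    exact add_le_add c₁ c₂
  have hnot : ∀ ω, ω ∉ A → Good ω.2 ∧
      Confined ω.2 H {x : ℤ | (x : ℝ) ≤ a} {x : ℤ | (x : ℝ) < M - 1} ∧
      Confined ω.2 H {x : ℤ | b ≤ (x : ℝ)} {x : ℤ | M + 1 < (x : ℝ)} := fun ω hω => by
    simp only [A, mem_preimage, mem_union, not_or] at hω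
    refine ⟨?_, fun z k k' t₁ t₂ hB => ?_, fun z k k' t₁ t₂ hB => ?_⟩
    · by_contra hng
      exact hω.2 (subset_toMeasurable _ _ hng)
    · by_contra hS
      exact hω.1.1 (subset_toMeasurable _ _ ⟨z, k, k', t₁, t₂, hB, not_lt.1 hS⟩)
    · by_contra hS
      exact hω.1.2 (subset_toMeasurable _ _ ⟨z, k', k, t₂, t₁, not_lt.1 hS, hB⟩)
  have := covariance_le_of_mix hmix (m₁.comp measurable_env) (m₂.comp measurable_env)
    (fun ω => h₁ _) (fun ω => h₂ _) (by positivity) hA (fun p hp hq => ?_) (fun p hp hq => ?_)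
  · refine this.trans (le_of_eq (by ring))
  · obtain ⟨g, l, -⟩ := hnot _ hp
    obtain ⟨g', l', -⟩ := hnot _ hq
    refine s₁ _ _ fun t x ht hx => env_congr_of_confined g' g l' l (fun x hx => ?_) ht hx
    have hx' : (x : ℝ) < M - 1 := hx
    have e₁ : x ∈ L := show (x : ℝ) < M by linarith
    have e₂ : x - 1 ∈ L := show ((x - 1 : ℤ) : ℝ) < M by push_cast; linarith
    simp [e₁, e₂]
  · obtain ⟨g, -, l⟩ := hnot _ hp
    obtain ⟨g', -, l'⟩ := hnot _ hq
    refine s₂ _ _ fun t x ht hx => env_congr_of_confined g' g l' l (fun x hx => ?_) ht hx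
    have hx' : M + 1 < (x : ℝ) := hx
    have e₁ : x ∉ L := show ¬ (x : ℝ) < M by linarith
    have e₂ : x - 1 ∉ L := show ¬ ((x - 1 : ℤ) : ℝ) < M by push_cast; linarith
    simp [e₁, e₂]

end SSEP

/-! ## Elementary estimates -/

theorem one_sub_exp_neg_inv_le {μ : ℝ} (hμ : 0 < μ) : (1 - Real.exp (-μ))⁻¹ ≤ 1 + 1 / μ := by
  have h₁ : Real.exp (-μ) ≤ 1 / (1 + μ) := by
    rw [Real.exp_neg, one_div]
    exact inv_anti₀ (by linarith) (by linarith [Real.add_one_le_exp μ])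
  have h₂ : μ / (1 + μ) ≤ 1 - Real.exp (-μ) := by
    have : μ / (1 + μ) = 1 - 1 / (1 + μ) := by field_simp; ring
    linarith
  calc (1 - Real.exp (-μ))⁻¹ ≤ (μ / (1 + μ))⁻¹ := inv_anti₀ (by positivity) h₂
    _ = 1 + 1 / μ := by field_simp; ring

theorem tsum_exp_neg_nat_le {μ : ℝ} (hμ : 0 < μ) :
    ∑' n : ℕ, ENNReal.ofReal (Real.exp (-(μ * n))) ≤ ENNReal.ofReal (1 + 1 / μ) := by
  have hr : Real.exp (-μ) < 1 := Real.exp_lt_one_iff.2 (by linarith)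
  have e : ∀ n : ℕ, Real.exp (-(μ * n)) = Real.exp (-μ) ^ n := fun n => by
    rw [← Real.exp_nat_mul]; ring_nf
  simp_rw [e]
  rw [← ENNReal.ofReal_tsum_of_nonneg (fun n => by positivity)
    (summable_geometric_of_lt_one (Real.exp_pos _).le hr),
    tsum_geometric_of_lt_one (Real.exp_pos _).le hr]
  exact ENNReal.ofReal_le_ofReal (one_sub_exp_neg_inv_le hμ)

theorem tsum_exp_neg_int_le {μ : ℝ} (hμ : 0 < μ) (w : ℤ) :
    ∑' z : ℤ, ENNReal.ofReal (Real.exp (-(μ * |((z - w : ℤ) : ℝ)|))) ≤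
      ENNReal.ofReal (2 * (1 + 1 / μ)) := by
  refine ((Equiv.subRight w).tsum_eq
    (fun z : ℤ => ENNReal.ofReal (Real.exp (-(μ * |(z : ℝ)|))))).trans_le ?_
  rw [tsum_of_nat_of_neg_add_one ENNReal.summable ENNReal.summable, two_mul,
    ENNReal.ofReal_add (by positivity) (by positivity)]
  refine add_le_add (le_trans (le_of_eq ?_) (tsum_exp_neg_nat_le hμ))
    (le_trans (ENNReal.tsum_le_tsum fun n => ?_) (tsum_exp_neg_nat_le hμ))
  · simp
  · refine ENNReal.ofReal_le_ofReal (Real.exp_le_exp.2 (neg_le_neg ?_))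
    refine mul_le_mul_of_nonneg_left ?_ hμ.le
    push_cast
    rw [abs_neg, abs_of_nonneg (by positivity)]
    linarith

theorem exp_sub_one_le_mul_exp (u : ℝ) : Real.exp u - 1 ≤ u * Real.exp u := by
  have h := mul_le_mul_of_nonneg_right (Real.one_sub_le_exp_neg u) (Real.exp_pos u).le
  rw [← Real.exp_add, neg_add_cancel, Real.exp_zero] at h
  linarith

/-- From `h ^ 6 / 6! ≤ exp h`: one of the two factors `exp (-h)` pays for the polynomial losses of
the union bounds. -/
theorem pow_six_mul_exp_le {h : ℝ} (hh : 0 ≤ h) :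
    h ^ 6 * Real.exp (-(2 * h)) ≤ 720 * Real.exp (-h) := by
  have h₁ := Real.pow_div_factorial_le_exp h hh 6
  rw [show ((Nat.factorial 6 : ℕ) : ℝ) = 720 by norm_num [Nat.factorial],
    div_le_iff₀ (by norm_num)] at h₁
  calc h ^ 6 * Real.exp (-(2 * h)) ≤ Real.exp h * 720 * Real.exp (-(2 * h)) := by gcongr
    _ = 720 * (Real.exp h * Real.exp (-(2 * h))) := by ring
    _ = 720 * Real.exp (-h) := by rw [← Real.exp_add]; ring_nf

theorem exists_fourth_root {H : ℝ} (hH : 1 ≤ H) :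
    ∃ h : ℝ, 1 ≤ h ∧ H = h ^ 4 ∧ H ^ (1 / 4 : ℝ) = h ∧ H ^ (3 / 4 : ℝ) = h ^ 3 := by
  have h0 : 0 ≤ H := by linarith
  refine ⟨H ^ (1 / 4 : ℝ), Real.one_le_rpow hH (by norm_num), ?_, rfl, ?_⟩
  · rw [← Real.rpow_natCast, ← Real.rpow_mul h0]
    norm_num
  · rw [← Real.rpow_natCast, ← Real.rpow_mul h0]
    norm_num

/-! ### Crossing probabilities and decorrelation for the exclusion process -/

namespace SSEP

section Law

variable {γ : ℝ} [hγ : Fact (0 < γ)]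

/-- A crossing label started at `z` reaches both half-lines, so the larger of `q - z` and `z - p`
may be used in the travel bound. It is at least `(q - p) / 4 + |z - ⌊q⌋| / 2 - 1`: the first term
gives the decay, the second makes the union over `z` summable. -/
theorem clocksLaw_crossing_le {l θ : ℝ} (hl : 0 < l) (hθ : 0 ≤ θ)
    (hr : 2 * γ * Real.cosh l / (2 * γ + θ) < 1) {H p q : ℝ} (hpq : -1 ≤ q - p) :
    clocksLaw γ {c | Crossing c H p q} ≤
      ENNReal.ofReal (Real.exp (θ * H) / (1 - 2 * γ * Real.cosh l / (2 * γ + θ)) *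
        Real.exp (-(l * ((q - p) / 4 - 1))) * (2 * (1 + 1 / (l / 2)))) := by
  have hr' : 0 < 1 - 2 * γ * Real.cosh l / (2 * γ + θ) := by linarith
  have hsub : {c | Crossing c H p q} ⊆ ⋃ z : ℤ,
      {c | ∃ k k', (rchain c z k).2 ≤ H ∧ (rchain c z k').2 ≤ H ∧ ((rchain c z k).1 : ℝ) ≤ p ∧
        q ≤ ((rchain c z k').1 : ℝ)} := fun c ⟨z, h⟩ => mem_iUnion.2 ⟨z, h⟩
  refine (measure_mono hsub).trans ((measure_iUnion_le _).trans ?_)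
  have hz : ∀ z : ℤ, clocksLaw γ {c | ∃ k k', (rchain c z k).2 ≤ H ∧ (rchain c z k').2 ≤ H ∧
      ((rchain c z k).1 : ℝ) ≤ p ∧ q ≤ ((rchain c z k').1 : ℝ)} ≤
      ENNReal.ofReal (Real.exp (θ * H) / (1 - 2 * γ * Real.cosh l / (2 * γ + θ)) *
        Real.exp (-(l * ((q - p) / 4 - 1)))) *
        ENNReal.ofReal (Real.exp (-(l / 2 * |((z - ⌊q⌋ : ℤ) : ℝ)|))) := fun z => by
    have hleft := clocksLaw_travel_le (γ := γ) (l := -l) hθ (by rwa [Real.cosh_neg]) z H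
      (l * (z - p))
    have hright := clocksLaw_travel_le (γ := γ) (l := l) hθ hr z H (l * (q - z))
    rw [Real.cosh_neg] at hleft
    set E : Set (ℤ → ℕ → ℝ) := {c | ∃ k k', (rchain c z k).2 ≤ H ∧ (rchain c z k').2 ≤ H ∧
      ((rchain c z k).1 : ℝ) ≤ p ∧ q ≤ ((rchain c z k').1 : ℝ)}
    have hle₁ := hleft.trans' (measure_mono (s := E) fun c ⟨k, k', t, t', hp, hq⟩ =>
      ⟨k, t, by nlinarith⟩)
    have hle₂ := hright.trans' (measure_mono (s := E) fun c ⟨k, k', t, t', hp, hq⟩ =>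
      ⟨k', t', by nlinarith⟩)
    have key : ∀ m : ℝ, (q - p) / 4 + |((z - ⌊q⌋ : ℤ) : ℝ)| / 2 - 1 ≤ m →
        ENNReal.ofReal (Real.exp (θ * H - l * m) / (1 - 2 * γ * Real.cosh l / (2 * γ + θ))) ≤
        ENNReal.ofReal (Real.exp (θ * H) / (1 - 2 * γ * Real.cosh l / (2 * γ + θ)) *
        Real.exp (-(l * ((q - p) / 4 - 1)))) *
        ENNReal.ofReal (Real.exp (-(l / 2 * |((z - ⌊q⌋ : ℤ) : ℝ)|))) := fun m hm => by
      rw [← ENNReal.ofReal_mul (by positivity), div_mul_eq_mul_div, div_mul_eq_mul_div,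
        ← Real.exp_add, ← Real.exp_add]
      refine ENNReal.ofReal_le_ofReal (div_le_div_of_nonneg_right (Real.exp_le_exp.2 ?_) hr'.le)
      have := mul_le_mul_of_nonneg_left hm hl.le
      linarith
    have hf₁ := Int.floor_le q
    have hf₂ := Int.lt_floor_add_one q
    rcases le_or_gt (z : ℝ) ((p + q) / 2) with hlt | hgt
    · refine hle₂.trans (key (q - z) ?_)
      push_cast
      rcases le_or_gt z ⌊q⌋ with h | h
      · have : (z : ℝ) ≤ ⌊q⌋ := Int.cast_le.2 h
        rw [abs_of_nonpos (by linarith)]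
        linarith
      · have : (⌊q⌋ : ℝ) + 1 ≤ z := by exact_mod_cast h
        rw [abs_of_nonneg (by linarith)]
        linarith
    · refine hle₁.trans (key (z - p) ?_)
      push_cast
      rcases le_or_gt z ⌊q⌋ with h | h
      · have : (z : ℝ) ≤ ⌊q⌋ := Int.cast_le.2 h
        rw [abs_of_nonpos (by linarith)]
        linarith
      · have : (⌊q⌋ : ℝ) + 1 ≤ z := by exact_mod_cast h
        rw [abs_of_nonneg (by linarith)]
        linarith
  refine (ENNReal.tsum_le_tsum hz).trans ?_
  rw [ENNReal.tsum_mul_left, ENNReal.ofReal_mul (q := 2 * (1 + 1 / (l / 2))) (by positivity)]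
  exact mul_le_mul_right (tsum_exp_neg_int_le (by positivity) _) _

theorem clocksLaw_crossing_le_exp {h p q : ℝ} (hh : 1 ≤ h) (hpq : h ^ 3 / 2 - 1 ≤ q - p) :
    clocksLaw γ {c | Crossing c (h ^ 4) p q} ≤ ENNReal.ofReal
      (Real.exp (512 * γ * Real.exp 256) * Real.exp 20 * 5760 * Real.exp (-h)) := by
  have hγ0 := hγ.out
  have h0 : 0 < h := by linarith
  -- With this order of magnitude `l ^ 2 * h ^ 4` is constant, and 16 makes `l` times a quarter of
  -- the distance `h ^ 3 / 2` equal to `2 * h`.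
  set l : ℝ := 16 / h ^ 2 with hl
  -- Chosen so that `2 * γ + θ = 2 * γ * exp (l ^ 2)`. As `cosh l ≤ exp (l ^ 2 / 2)`, the ratio of
  -- the geometric series is at most `exp (-(l ^ 2 / 2))`, while `θ * h ^ 4` stays bounded.
  set θ : ℝ := 2 * γ * (Real.exp (l ^ 2) - 1) with hθ
  have hl0 : 0 < l := by positivity
  have hl16 : l ≤ 16 := div_le_self (by norm_num) (one_le_pow₀ hh)
  have hl2 : l ^ 2 * h ^ 4 = 256 := by rw [hl]; field_simp; norm_num
  have hexp1 : 1 ≤ Real.exp (l ^ 2) := Real.one_le_exp (by positivity)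
  have hθ0 : 0 ≤ θ := by have : 0 ≤ Real.exp (l ^ 2) - 1 := by linarith
                         positivity
  have hsum : 2 * γ + θ = 2 * γ * Real.exp (l ^ 2) := by rw [hθ]; ring
  have hr : 2 * γ * Real.cosh l / (2 * γ + θ) ≤ Real.exp (-(l ^ 2 / 2)) := by
    rw [hsum, mul_div_mul_left _ _ (by positivity), div_le_iff₀ (Real.exp_pos _), ← Real.exp_add]
    refine (Real.cosh_le_exp_half_sq l).trans (le_of_eq ?_)
    ring_nf
  have hr1 : Real.exp (-(l ^ 2 / 2)) < 1 := Real.exp_lt_one_iff.2 (by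
    have : 0 < l ^ 2 := by positivity
    linarith)
  have hcube : 1 ≤ h ^ 3 := one_le_pow₀ hh
  refine (clocksLaw_crossing_le hl0 hθ0 (hr.trans_lt hr1) (by linarith)).trans
    (ENNReal.ofReal_le_ofReal ?_)
  have b₁ : (1 - 2 * γ * Real.cosh l / (2 * γ + θ))⁻¹ ≤ 2 * h ^ 4 := by
    calc (1 - 2 * γ * Real.cosh l / (2 * γ + θ))⁻¹ ≤ (1 - Real.exp (-(l ^ 2 / 2)))⁻¹ :=
          inv_anti₀ (by linarith) (by linarith)
      _ ≤ 1 + 1 / (l ^ 2 / 2) := one_sub_exp_neg_inv_le (by positivity)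
      _ = 1 + h ^ 4 / 128 := by rw [hl]; field_simp; ring
      _ ≤ 2 * h ^ 4 := by
        have : 1 ≤ h ^ 4 := one_le_pow₀ hh
        linarith
  have b₂ : 2 * (1 + 1 / (l / 2)) ≤ 4 * h ^ 2 := by
    have e : 1 / (l / 2) = h ^ 2 / 8 := by rw [hl]; field_simp; norm_num
    have : 1 ≤ h ^ 2 := one_le_pow₀ hh
    rw [e]
    linarith
  have b₃ : Real.exp (θ * h ^ 4) ≤ Real.exp (512 * γ * Real.exp 256) := by
    refine Real.exp_le_exp.2 ?_
    have h1 := exp_sub_one_le_mul_exp (l ^ 2)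
    have h2 : Real.exp (l ^ 2) ≤ Real.exp 256 := Real.exp_le_exp.2 (by nlinarith)
    calc θ * h ^ 4 = 2 * γ * h ^ 4 * (Real.exp (l ^ 2) - 1) := by rw [hθ]; ring
      _ ≤ 2 * γ * h ^ 4 * (l ^ 2 * Real.exp (l ^ 2)) := by gcongr
      _ = 2 * γ * (l ^ 2 * h ^ 4) * Real.exp (l ^ 2) := by ring
      _ ≤ 2 * γ * (l ^ 2 * h ^ 4) * Real.exp 256 := by gcongr
      _ = 512 * γ * Real.exp 256 := by rw [hl2]; ring
  have b₄ : Real.exp (-(l * ((q - p) / 4 - 1))) ≤ Real.exp 20 * Real.exp (-(2 * h)) := by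
    rw [← Real.exp_add]
    refine Real.exp_le_exp.2 ?_
    have h1 : l * ((h ^ 3 / 2 - 1) / 4 - 1) ≤ l * ((q - p) / 4 - 1) := by gcongr
    have h2 : l * h ^ 3 = 16 * h := by rw [hl]; field_simp
    nlinarith
  calc _ = Real.exp (θ * h ^ 4) * (1 - 2 * γ * Real.cosh l / (2 * γ + θ))⁻¹ *
        Real.exp (-(l * ((q - p) / 4 - 1))) * (2 * (1 + 1 / (l / 2))) := by rw [div_eq_mul_inv]
    _ ≤ Real.exp (512 * γ * Real.exp 256) * (2 * h ^ 4) * (Real.exp 20 * Real.exp (-(2 * h))) *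
        (4 * h ^ 2) := by
      have : 0 < 1 - 2 * γ * Real.cosh l / (2 * γ + θ) := by linarith
      gcongr
    _ = Real.exp (512 * γ * Real.exp 256) * Real.exp 20 * 8 *
        (h ^ 6 * Real.exp (-(2 * h))) := by ring
    _ ≤ Real.exp (512 * γ * Real.exp 256) * Real.exp 20 * 8 * (720 * Real.exp (-h)) := by
      have := pow_six_mul_exp_le h0.le
      gcongr
    _ = _ := by ring

end Law

/-- Decorrelation of distant boxes for the exclusion process. -/
theorem exists_covariance_le {ρ : ℝ} (hρ₀ : 0 < ρ) (hρ₁ : ρ < 1) {γ : ℝ} (hγ : 0 < γ) :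
    ∃ c : ℝ, 0 < c ∧ ∀ (H : ℝ) (y₁ y₂ : ℝ × ℝ), 1 ≤ H → y₁.2 = y₂.2 →
      H ^ (3 / 4 : ℝ) ≤ y₂.1 - y₁.1 → ∀ f₁ f₂ : Trajectory (Fin 2) → ℝ,
        (∀ η, 0 ≤ f₁ η ∧ f₁ η ≤ 1) → (∀ η, 0 ≤ f₂ η ∧ f₂ η ≤ 1) →
        SupportedOn f₁ (leftBox H y₁) → SupportedOn f₂ (rightBox H y₂) →
        cov[f₁, f₂; law γ ρ] ≤ c * Real.exp (-H ^ (1 / 4 : ℝ)) := by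
  have : Fact (0 < γ) := ⟨hγ⟩
  have : IsProbabilityMeasure (siteLaw ρ) := by
    constructor
    simp [siteLaw, ← ENNReal.ofReal_add hρ₀.le (sub_nonneg.2 hρ₁.le)]
  refine ⟨6 * (Real.exp (512 * γ * Real.exp 256) * Real.exp 20 * 5760), by positivity, ?_⟩
  intro H y₁ y₂ hH hy hd f₁ f₂ h₁ h₂ s₁ s₂
  obtain ⟨h, hh, rfl, e₁, e₃⟩ := exists_fourth_root hH
  rw [e₃] at hd
  rw [e₁]
  obtain ⟨F₁, F₂, m₁, m₂, b₁, b₂, l₁, l₂, hcov⟩ :=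
    exists_covariance_eq (γ := γ) (ρ := ρ) hy h₁ h₂ s₁ s₂
  rw [hcov, mul_assoc 6]
  refine covariance_le_of_crossing (M := (y₁.1 + y₂.1) / 2) m₁ m₂ b₁ b₂ l₁ l₂ (by positivity)
    (clocksLaw_crossing_le_exp hh ?_) (clocksLaw_crossing_le_exp hh ?_) <;> linarith

end SSEP

/-! ### Products of independent variables and the Poisson generating function -/

theorem integral_infinitePi_finset_prod {ι E : Type*} [MeasurableSpace E] (μ : ι → Measure E)
    [∀ i, IsProbabilityMeasure (μ i)] (s : Finset ι) {g : ι → E → ℂ} (hg : ∀ i, Measurable (g i)) :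
    ∫ c, ∏ i ∈ s, g i (c i) ∂Measure.infinitePi μ = ∏ i ∈ s, ∫ e, g i e ∂μ i := by
  have hm : Measurable fun y : (i : s) → E => ∏ i : s, g i (y i) :=
    Finset.measurable_prod _ fun i _ => (hg i).comp (measurable_pi_apply i)
  have h := integral_restrict_infinitePi (μ := μ) (s := s)
    (f := fun y : (i : s) → E => ∏ i : s, g i (y i)) hm.aestronglyMeasurable
  rw [integral_fintype_prod_eq_prod (fun (i : s) => g i)] at h
  rw [← Finset.prod_coe_sort s fun i => ∫ e, g i e ∂μ i, ← h]
  refine integral_congr_ae (Filter.Eventually.of_forall fun c => ?_)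
  exact (Finset.prod_coe_sort s fun i => g i (c i)).symm

theorem integral_pow_poissonMeasure (r : ℝ≥0) (a : ℂ) :
    ∫ n, a ^ n ∂poissonMeasure r = Complex.exp (r * (a - 1)) := by
  rw [integral_poissonMeasure r]
  calc ∑' n : ℕ, (Real.exp (-r) * r ^ n / (n.factorial : ℝ)) • a ^ n
      = ∑' n : ℕ, (Real.exp (-r) : ℂ) * ((r * a) ^ n / (n.factorial : ℂ)) := by
        congr with n
        rw [Complex.real_smul]
        push_cast
        rw [mul_pow]
        ring
    _ = (Real.exp (-r) : ℂ) * ∑' n : ℕ, ((r * a) ^ n / (n.factorial : ℂ)) := tsum_mul_left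
    _ = (Real.exp (-r) : ℂ) * Complex.exp (r * a) := by
        rw [(NormedSpace.expSeries_div_hasSum_exp ((r : ℂ) * a)).tsum_eq, Complex.exp_eq_exp_ℂ]
    _ = Complex.exp (r * (a - 1)) := by
        rw [Complex.ofReal_exp, ← Complex.exp_add]
        push_cast
        ring_nf

/-! ### Poisson thinning: independence of the two classes of walks -/

namespace PCRW

/-- The position at time `t` of the walk with steps `w` started at `x`. -/
noncomputable def pos (x : ℤ) (w : ℕ → ℤ) (t : ℝ≥0) : ℤ := x + ∑ n ∈ Finset.range ⌊t⌋₊, w n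

/-- The numbers of walks that are in `D` at time `s`. -/
noncomputable def envOn (D : Set ℤ) (s : ℝ≥0) (ω : Sample) : Trajectory ℕ := fun t y =>
  {p : ℤ × ℕ | 1 ≤ p.2 ∧ p.2 ≤ ω.1 p.1 ∧ walk ω p.1 p.2 t = y ∧ walk ω p.1 p.2 s ∈ D}.ncard

theorem measurable_pos (x : ℤ) (t : ℝ≥0) : Measurable fun w : ℕ → ℤ => pos x w t := by
  unfold pos
  fun_prop

theorem measurable_envOn (D : Set ℤ) (s : ℝ≥0) : Measurable (envOn D s) := by
  refine measurable_pi_lambda _ fun t => measurable_pi_lambda _ fun y => ?_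
  unfold envOn
  refine measurable_ncard.comp (measurable_set_iff.2 fun p => ?_)
  have h : ∀ t, Measurable fun ω : Sample => walk ω p.1 p.2 t := fun t => by
    unfold walk
    fun_prop
  have h' : Measurable fun ω : Sample => ω.1 p.1 := by fun_prop
  refine measurableSet_setOfPred.1 ?_
  exact (MeasurableSet.const (1 ≤ p.2)).inter ((measurableSet_le measurable_const h').inter
    ((measurableSet_eq_fun (h t) measurable_const).inter ((h s) (MeasurableSet.of_discrete (s := D)))))

/-- Steps have size at most one. -/
def Bounded (ω : Sample) : Prop := ∀ x i n, |ω.2 x i n| ≤ 1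

theorem Bounded.abs_walk_sub_le {ω : Sample} (h : Bounded ω) (x : ℤ) (i : ℕ) (t : ℝ≥0) :
    |walk ω x i t - x| ≤ ⌊t⌋₊ := by
  rw [walk, add_sub_cancel_left]
  refine (Finset.abs_sum_le_sum_abs _ _).trans ((Finset.sum_le_sum fun n _ => h x i n).trans ?_)
  simp

open Classical in
-- Steps of size at most one confine the starting points of the walks that are at `y` at time `t` to
-- a finite set. The count is thus a finite sum, to which the generating functional applies.
theorem Bounded.envOn_eq_sum {ω : Sample} (h : Bounded ω) (D : Set ℤ) (s t : ℝ≥0) (y : ℤ)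
    {X : Finset ℤ} (hX : ∀ x : ℤ, |y - x| ≤ ⌊t⌋₊ → x ∈ X) :
    envOn D s ω t y = ∑ x ∈ X, ∑ i ∈ Finset.Icc 1 (ω.1 x),
      if pos x (ω.2 x i) t = y ∧ pos x (ω.2 x i) s ∈ D then 1 else 0 := by
  have : {p : ℤ × ℕ | 1 ≤ p.2 ∧ p.2 ≤ ω.1 p.1 ∧ walk ω p.1 p.2 t = y ∧ walk ω p.1 p.2 s ∈ D} =
      Equiv.sigmaEquivProd ℤ ℕ '' ((X.sigma fun x => Finset.Icc 1 (ω.1 x)).filter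
        fun p => walk ω p.1 p.2 t = y ∧ walk ω p.1 p.2 s ∈ D : Finset (Σ _ : ℤ, ℕ)) := by
    ext ⟨x, i⟩
    simp only [mem_ofPred, Set.mem_image, Finset.coe_filter, Finset.mem_sigma, Finset.mem_Icc,
      Sigma.exists, Equiv.sigmaEquivProd_apply, Prod.mk.injEq]
    constructor
    · rintro ⟨h₁, h₂, h₃, h₄⟩
      exact ⟨x, i, ⟨⟨hX x (by rw [← h₃]; exact h.abs_walk_sub_le x i t), h₁, h₂⟩, h₃, h₄⟩,
        rfl, rfl⟩
    · rintro ⟨x', i', ⟨⟨-, h₁, h₂⟩, h₃, h₄⟩, rfl, rfl⟩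
      exact ⟨h₁, h₂, h₃, h₄⟩
  rw [envOn, this, Set.ncard_image_of_injective _ (Equiv.injective _), Set.ncard_coe_finset,
    Finset.card_filter, Finset.sum_sigma]
  rfl

theorem ae_abs_le_stepLaw (q : ℝ) : ∀ᵐ z ∂stepLaw q, |z| ≤ 1 := by
  rw [ae_iff]
  simp [stepLaw]

section Law

variable {q ρ : ℝ} [hstep : IsProbabilityMeasure (stepLaw q)]

/-- The law of the steps of one walk. -/
noncomputable def stepsLaw (q : ℝ) : Measure (ℕ → ℤ) := Measure.infinitePi fun _ : ℕ => stepLaw q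

instance : IsProbabilityMeasure (stepsLaw q) := by
  unfold stepsLaw
  infer_instance

instance : IsProbabilityMeasure (sampleLaw q ρ) := by
  unfold sampleLaw
  infer_instance

theorem ae_bounded : ∀ᵐ ω ∂sampleLaw q ρ, Bounded ω := by
  simp only [Bounded, ae_all_iff]
  intro x i n
  have h₁ := (measurePreserving_eval_infinitePi (fun _ : ℕ => stepLaw q) n).quasiMeasurePreserving.ae
    (ae_abs_le_stepLaw q)
  have h₂ := (measurePreserving_eval_infinitePi
    (fun _ : ℕ => stepsLaw q) i).quasiMeasurePreserving.ae h₁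
  have h₃ := (measurePreserving_eval_infinitePi (fun _ : ℤ => Measure.infinitePi fun _ : ℕ =>
    stepsLaw q) x).quasiMeasurePreserving.ae h₂
  exact Measure.quasiMeasurePreserving_snd.ae h₃

theorem norm_finset_prod_le_one {ι : Type*} (s : Finset ι) (f : ι → ℂ) (h : ∀ i, ‖f i‖ ≤ 1) :
    ‖∏ i ∈ s, f i‖ ≤ 1 := by
  rw [norm_prod]
  exact Finset.prod_le_one (fun i _ => norm_nonneg _) fun i _ => h i

/-- The generating functional of the marked Poisson clouds. -/
theorem integral_prod_sampleLaw (X : Finset ℤ) {ψ : ℤ → (ℕ → ℤ) → ℂ} (hψ : ∀ x, Measurable (ψ x))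
    (hb : ∀ x w, ‖ψ x w‖ ≤ 1) :
    ∫ ω, ∏ x ∈ X, ∏ i ∈ Finset.Icc 1 (ω.1 x), ψ x (ω.2 x i) ∂sampleLaw q ρ =
      ∏ x ∈ X, Complex.exp ((Real.toNNReal (-Real.log (1 - ρ)) : ℝ) *
        (∫ w, ψ x w ∂stepsLaw q - 1)) := by
  have hm : Measurable fun ω : Sample => ∏ x ∈ X, ∏ i ∈ Finset.Icc 1 (ω.1 x), ψ x (ω.2 x i) := by
    refine Finset.measurable_prod _ fun x _ => ?_
    have : Measurable fun p : ℕ × (ℕ → ℕ → ℤ) => ∏ i ∈ Finset.Icc 1 p.1, ψ x (p.2 i) :=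
      measurable_from_prod_countable_right fun n =>
        show Measurable fun v : ℕ → ℕ → ℤ => ∏ i ∈ Finset.Icc 1 n, ψ x (v i) from
          Finset.measurable_prod _ fun i _ => (hψ x).comp (measurable_pi_apply i)
    exact this.comp (f := fun ω : Sample => (ω.1 x, ω.2 x)) (by fun_prop)
  have hint : Integrable (fun ω : Sample => ∏ x ∈ X, ∏ i ∈ Finset.Icc 1 (ω.1 x), ψ x (ω.2 x i))
      (sampleLaw q ρ) :=
    Integrable.of_bound hm.aestronglyMeasurable 1 (Filter.Eventually.of_forall fun ω =>
      norm_finset_prod_le_one _ _ fun x => norm_finset_prod_le_one _ _ fun i => hb _ _)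
  unfold sampleLaw at hint ⊢
  rw [integral_prod _ hint]
  have inner : ∀ N : ℤ → ℕ, ∫ w, ∏ x ∈ X, ∏ i ∈ Finset.Icc 1 (N x), ψ x (w x i)
      ∂(Measure.infinitePi fun _ : ℤ => Measure.infinitePi fun _ : ℕ => stepsLaw q) =
      ∏ x ∈ X, (∫ w, ψ x w ∂stepsLaw q) ^ N x := fun N => by
    rw [integral_infinitePi_finset_prod (fun _ : ℤ => Measure.infinitePi fun _ : ℕ => stepsLaw q) X
      (g := fun x v => ∏ i ∈ Finset.Icc 1 (N x), ψ x (v i))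
      fun x => Finset.measurable_prod _ fun i _ => (hψ x).comp (measurable_pi_apply i)]
    refine Finset.prod_congr rfl fun x _ => ?_
    rw [integral_infinitePi_finset_prod (fun _ : ℕ => stepsLaw q) (Finset.Icc 1 (N x))
      (g := fun _ => ψ x) fun _ => hψ x]
    simp
  refine (integral_congr_ae (Filter.Eventually.of_forall inner)).trans ?_
  rw [integral_infinitePi_finset_prod (fun _ : ℤ => poissonMeasure _) X
    (g := fun x n => (∫ w, ψ x w ∂stepsLaw q) ^ n) fun x => measurable_of_countable _]
  exact Finset.prod_congr rfl fun x _ => integral_pow_poissonMeasure _ _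

open Classical in
/-- The joint Fourier transform of the numbers of walks of two disjoint classes. -/
theorem integral_cexp_envOn_mul (D : Set ℤ) (s : ℝ≥0) (I J : Finset (ℝ≥0 × ℤ)) (u : I → ℝ)
    (v : J → ℝ) :
    ∫ ω, Complex.exp (((∑ p, u p * (envOn D s ω p.1.1 p.1.2 : ℝ) +
      ∑ p, v p * (envOn Dᶜ s ω p.1.1 p.1.2 : ℝ) : ℝ) : ℂ) * Complex.I) ∂sampleLaw q ρ =
    (∫ ω, Complex.exp (((∑ p, u p * (envOn D s ω p.1.1 p.1.2 : ℝ) : ℝ) : ℂ) * Complex.I)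
      ∂sampleLaw q ρ) *
    ∫ ω, Complex.exp (((∑ p, v p * (envOn Dᶜ s ω p.1.1 p.1.2 : ℝ) : ℝ) : ℂ) * Complex.I)
      ∂sampleLaw q ρ := by
  let X : Finset ℤ := (I ∪ J).biUnion fun p => Finset.Icc (p.2 - ⌊p.1⌋₊) (p.2 + ⌊p.1⌋₊)
  have hX : ∀ p ∈ I ∪ J, ∀ x : ℤ, |p.2 - x| ≤ ⌊p.1⌋₊ → x ∈ X := fun p hp x hx => by
    rw [abs_le] at hx
    exact Finset.mem_biUnion.2 ⟨p, hp, Finset.mem_Icc.2 ⟨by linarith, by linarith⟩⟩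
  let ind : Set ℤ → ℤ → (ℕ → ℤ) → ℝ≥0 × ℤ → ℝ := fun D x w p =>
    if pos x w p.1 = p.2 ∧ pos x w s ∈ D then 1 else 0
  let φ₁ : ℤ → (ℕ → ℤ) → ℝ := fun x w => ∑ p : I, u p * ind D x w p
  let φ₂ : ℤ → (ℕ → ℤ) → ℝ := fun x w => ∑ p : J, v p * ind Dᶜ x w p
  have hms : ∀ (D : Set ℤ) (x : ℤ) (p : ℝ≥0 × ℤ), Measurable fun w : ℕ → ℤ => ind D x w p :=
    fun D x p => Measurable.ite ((measurableSet_eq_fun (measurable_pos x p.1)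
      measurable_const).inter (measurable_pos x s (MeasurableSet.of_discrete (s := D))))
      measurable_const measurable_const
  have hm₁ : ∀ x, Measurable (φ₁ x) := fun x =>
    Finset.measurable_sum _ fun p _ => (hms D x p).const_mul _
  have hm₂ : ∀ x, Measurable (φ₂ x) := fun x =>
    Finset.measurable_sum _ fun p _ => (hms Dᶜ x p).const_mul _
  have hsum₁ : ∀ ω, Bounded ω → ∑ p, u p * (envOn D s ω p.1.1 p.1.2 : ℝ) =
      ∑ x ∈ X, ∑ i ∈ Finset.Icc 1 (ω.1 x), φ₁ x (ω.2 x i) := fun ω hω => by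
    have : ∀ p : I, (envOn D s ω p.1.1 p.1.2 : ℝ) = ∑ x ∈ X, ∑ i ∈ Finset.Icc 1 (ω.1 x),
        ind D x (ω.2 x i) p := fun p => by
      rw [hω.envOn_eq_sum D s _ _ (hX p.1 (Finset.mem_union_left _ p.2))]
      push_cast
      rfl
    simp_rw [this, Finset.mul_sum]
    rw [Finset.sum_comm]
    exact Finset.sum_congr rfl fun x _ => Finset.sum_comm
  have hsum₂ : ∀ ω, Bounded ω → ∑ p, v p * (envOn Dᶜ s ω p.1.1 p.1.2 : ℝ) =
      ∑ x ∈ X, ∑ i ∈ Finset.Icc 1 (ω.1 x), φ₂ x (ω.2 x i) := fun ω hω => by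
    have : ∀ p : J, (envOn Dᶜ s ω p.1.1 p.1.2 : ℝ) = ∑ x ∈ X, ∑ i ∈ Finset.Icc 1 (ω.1 x),
        ind Dᶜ x (ω.2 x i) p := fun p => by
      rw [hω.envOn_eq_sum Dᶜ s _ _ (hX p.1 (Finset.mem_union_right _ p.2))]
      push_cast
      refine Finset.sum_congr rfl fun x _ => Finset.sum_congr rfl fun i _ => ?_
      simp only [ind]
      congr
    simp_rw [this, Finset.mul_sum]
    rw [Finset.sum_comm]
    exact Finset.sum_congr rfl fun x _ => Finset.sum_comm
  have gen : ∀ φ : ℤ → (ℕ → ℤ) → ℝ, (∀ x, Measurable (φ x)) → ∀ Z : Sample → ℝ,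
      (∀ ω, Bounded ω → Z ω = ∑ x ∈ X, ∑ i ∈ Finset.Icc 1 (ω.1 x), φ x (ω.2 x i)) →
      ∫ ω, Complex.exp ((Z ω : ℂ) * Complex.I) ∂sampleLaw q ρ =
      ∏ x ∈ X, Complex.exp ((Real.toNNReal (-Real.log (1 - ρ)) : ℝ) *
        (∫ w, Complex.exp ((φ x w : ℂ) * Complex.I) ∂stepsLaw q - 1)) := fun φ hφ Z hZ => by
    rw [← integral_prod_sampleLaw X (ψ := fun x w => Complex.exp ((φ x w : ℂ) * Complex.I))
      (fun x => by have := hφ x; fun_prop) fun x w => (Complex.norm_exp_ofReal_mul_I _).le]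
    refine integral_congr_ae ?_
    filter_upwards [ae_bounded] with ω hω
    rw [hZ ω hω]
    simp only [← Complex.exp_sum, ← Finset.sum_mul]
    push_cast
    rfl
  rw [gen (fun x w => φ₁ x w + φ₂ x w) (fun x => (hm₁ x).add (hm₂ x)) _ fun ω hω => by
      rw [hsum₁ ω hω, hsum₂ ω hω]; simp only [Finset.sum_add_distrib],
    gen φ₁ hm₁ _ hsum₁, gen φ₂ hm₂ _ hsum₂, ← Finset.prod_mul_distrib]
  refine Finset.prod_congr rfl fun x _ => ?_
  rw [← Complex.exp_add]
  congr 1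
  have hint : ∀ φ : (ℕ → ℤ) → ℝ, Measurable φ →
      Integrable (fun w => Complex.exp ((φ w : ℂ) * Complex.I)) (stepsLaw q) := fun φ hφ =>
    Integrable.of_bound (by fun_prop) 1
      (Filter.Eventually.of_forall fun w => (Complex.norm_exp_ofReal_mul_I _).le)
  -- Each walk belongs to one class only, so `φ₁` or `φ₂` vanishes. This linearises the exponential
  -- and makes the Poisson exponents of the two classes add up.
  have hpt : ∀ w, Complex.exp (((φ₁ x w + φ₂ x w : ℝ) : ℂ) * Complex.I) =
      Complex.exp ((φ₁ x w : ℂ) * Complex.I) + Complex.exp ((φ₂ x w : ℂ) * Complex.I) - 1 :=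
    fun w => by
      by_cases hD : pos x w s ∈ D
      · have : φ₂ x w = 0 := Finset.sum_eq_zero fun p _ => by simp [ind, hD]
        simp [this]
      · have : φ₁ x w = 0 := Finset.sum_eq_zero fun p _ => by simp [ind, hD]
        simp [this]
  simp_rw [hpt]
  have hadd : Integrable (fun w => Complex.exp ((φ₁ x w : ℂ) * Complex.I) +
      Complex.exp ((φ₂ x w : ℂ) * Complex.I)) (stepsLaw q) :=
    (hint _ (hm₁ x)).add (hint _ (hm₂ x))
  rw [integral_sub hadd (integrable_const 1),
    integral_add (hint _ (hm₁ x)) (hint _ (hm₂ x))]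
  simp only [integral_const, probReal_univ, one_smul]
  ring

/-- The walks that are in `D` at time `s` are independent of the other ones. -/
theorem indepFun_envOn_compl (D : Set ℤ) (s : ℝ≥0) :
    envOn D s ⟂ᵢ[sampleLaw q ρ] envOn Dᶜ s := by
  have hme : ∀ (D : Set ℤ) (p : ℝ≥0 × ℤ), Measurable fun ω => envOn D s ω p.1 p.2 := fun D p =>
    (measurable_pi_apply p.2).comp ((measurable_pi_apply p.1).comp (measurable_envOn D s))
  have key := IndepFun.process_indepFun_process (P := sampleLaw q ρ)
    (X := fun (p : ℝ≥0 × ℤ) ω => envOn D s ω p.1 p.2)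
    (Y := fun (p : ℝ≥0 × ℤ) ω => envOn Dᶜ s ω p.1 p.2) (hme D) (hme Dᶜ) fun I J => by
    have hU : ∀ (D : Set ℤ) (I : Finset (ℝ≥0 × ℤ)), Measurable fun ω =>
        (WithLp.toLp 2 fun p : I => (envOn D s ω p.1.1 p.1.2 : ℝ) : EuclideanSpace ℝ I) :=
      fun D I => (WithLp.measurable_toLp 2 _).comp (measurable_pi_lambda _ fun p =>
        (measurable_of_countable (fun n : ℕ => (n : ℝ))).comp (hme D p.1))
    have hind := (indepFun_iff_charFun_prod (P := sampleLaw q ρ) (hU D I).aemeasurable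
      (hU Dᶜ J).aemeasurable).2 fun t => by
        rw [charFun_apply, charFun_apply, charFun_apply,
          integral_map (by fun_prop) (by fun_prop),
          integral_map (hU D I).aemeasurable (by fun_prop),
          integral_map (hU Dᶜ J).aemeasurable (by fun_prop)]
        simp only [WithLp.prod_inner_apply, PiLp.inner_apply, RCLike.inner_apply, conj_trivial]
        exact integral_cexp_envOn_mul D s I J _ _
    -- Characteristic functions need real vectors; the floor recovers the integer counts from them.
    have hfl : ∀ I : Finset (ℝ≥0 × ℤ), Measurable fun (a : EuclideanSpace ℝ I) (p : I) => ⌊a p⌋₊ :=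
      fun I => measurable_pi_lambda _ fun p => Nat.measurable_floor.comp (by fun_prop)
    have := hind.comp (hfl I) (hfl J)
    simpa [Function.comp_def] using this
  have hcur : Measurable fun (a : ℝ≥0 × ℤ → ℕ) (t : ℝ≥0) (y : ℤ) => a (t, y) := by fun_prop
  exact key.comp hcur hcur

end Law

end PCRW

/-! ### The Poisson mean and uniform lattice sums -/

theorem lintegral_natCast_poissonMeasure_lt_top (r : ℝ≥0) :
    ∫⁻ n : ℕ, (n : ℝ≥0∞) ∂poissonMeasure r < ∞ := by
  have hint : Integrable (fun n : ℕ => (n : ℝ)) (poissonMeasure r) := by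
    rw [integrable_poissonMeasure_iff, ← summable_nat_add_iff 1]
    refine ((Real.summable_pow_div_factorial (r : ℝ)).mul_left (Real.exp (-r) * r)).congr
      fun n => ?_
    rw [Nat.factorial_succ]
    push_cast
    rw [Real.norm_of_nonneg (by positivity)]
    field_simp
    ring
  have := hint.lintegral_lt_top
  simpa using this

theorem tsum_poissonMeasure_le (r : ℝ≥0) :
    ∑' i : ℕ, poissonMeasure r {n | 1 ≤ i ∧ i ≤ n} ≤ ∫⁻ n : ℕ, (n : ℝ≥0∞) ∂poissonMeasure r := by
  have h : ∀ i : ℕ, poissonMeasure r {n | 1 ≤ i ∧ i ≤ n} =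
      ∫⁻ n : ℕ, ({n | 1 ≤ i ∧ i ≤ n} : Set ℕ).indicator (1 : ℕ → ℝ≥0∞) n ∂poissonMeasure r := fun i =>
    (lintegral_indicator_one MeasurableSet.of_discrete).symm
  rw [tsum_congr h, ← lintegral_tsum fun i => (measurable_of_countable _).aemeasurable]
  refine lintegral_mono fun n => ?_
  rw [tsum_eq_sum (s := Finset.Icc 1 n) fun i hi => by
    rw [Finset.mem_Icc] at hi
    exact indicator_of_notMem (s := {n | 1 ≤ i ∧ i ≤ n}) hi _]
  refine (Finset.sum_le_sum (g := fun _ => (1 : ℝ≥0∞)) fun i _ => ?_).trans (by simp)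
  exact indicator_le_self' (fun _ _ => zero_le) n

/-- The bound does not depend on `m`, which will be the random displacement of a walk up to the time
when the boxes begin. Replacing `M` by its floor costs the factor `exp l`. -/
theorem tsum_exp_neg_abs_add_le {l : ℝ} (hl : 0 < l) (m : ℤ) (M : ℝ) :
    ∑' z : ℤ, ENNReal.ofReal (Real.exp (-(l * |((z + m : ℤ) : ℝ) - M|))) ≤
      ENNReal.ofReal (Real.exp l * (2 * (1 + 1 / l))) := by
  rw [ENNReal.ofReal_mul (Real.exp_pos _).le]
  refine le_trans ?_ (mul_le_mul_right (tsum_exp_neg_int_le hl (⌊M⌋ - m)) _)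
  rw [← ENNReal.tsum_mul_left]
  refine ENNReal.tsum_le_tsum fun z => ?_
  rw [← ENNReal.ofReal_mul (Real.exp_pos _).le, ← Real.exp_add]
  refine ENNReal.ofReal_le_ofReal (Real.exp_le_exp.2 ?_)
  have h₁ : |((z - (⌊M⌋ - m) : ℤ) : ℝ)| ≤ |((z + m : ℤ) : ℝ) - M| + |M - ⌊M⌋| := by
    refine le_trans (le_of_eq ?_) (abs_add_le _ _)
    push_cast
    ring_nf
  have h₂ : |M - ⌊M⌋| ≤ 1 := by
    rw [abs_of_nonneg (by linarith [Int.floor_le M])]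
    linarith [Int.lt_floor_add_one M]
  nlinarith

/-! ### The expected number of crossing walks -/

namespace PCRW

/-- The displacement of a walk with steps `w` between the times `n` and `n + k`. -/
noncomputable def displacement (w : ℕ → ℤ) (n k : ℕ) : ℝ :=
  ∑ j ∈ Finset.Ico n (n + k), (w j : ℝ)

/-- Between time `n` and some time before `n + K`, the walk with steps `w` started at `x` moves
beyond distance `d` on the other side of `M`. -/
def Crosses (x : ℤ) (w : ℕ → ℤ) (n K : ℕ) (M d : ℝ) : Prop :=
  ∃ k < K, |((x + ∑ j ∈ Finset.range n, w j : ℤ) : ℝ) - M| + d ≤ |displacement w n k|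

theorem measurable_displacement (n k : ℕ) : Measurable fun w : ℕ → ℤ => displacement w n k := by
  unfold displacement
  exact Finset.measurable_sum _ fun j _ =>
    (measurable_of_countable (fun z : ℤ => (z : ℝ))).comp (measurable_pi_apply j)

theorem measurableSet_crosses (x : ℤ) (n K : ℕ) (M d : ℝ) :
    MeasurableSet {w : ℕ → ℤ | Crosses x w n K M d} := by
  have hp : Measurable fun w : ℕ → ℤ => ((x + ∑ j ∈ Finset.range n, w j : ℤ) : ℝ) :=
    (measurable_of_countable (fun z : ℤ => (z : ℝ))).comp (by fun_prop)
  simp only [Crosses, ofPred_exists, ofPred_and]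
  refine MeasurableSet.iUnion fun k => (MeasurableSet.const _).inter ?_
  have hd := measurable_displacement n k
  exact measurableSet_le (by fun_prop) (by fun_prop)

section Law

variable {q ρ : ℝ} [hstep : IsProbabilityMeasure (stepLaw q)]

/-- First moment bound: the number of walks started at a site is independent of their steps, and the
probabilities that label `i` is in use sum to at most the Poisson mean. -/
theorem measure_exists_walk_le {E : ℤ → Set (ℕ → ℤ)} (hE : ∀ x, MeasurableSet (E x)) :
    sampleLaw q ρ {ω | ∃ x i, 1 ≤ i ∧ i ≤ ω.1 x ∧ ω.2 x i ∈ E x} ≤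
      (∫⁻ n : ℕ, (n : ℝ≥0∞) ∂poissonMeasure (Real.toNNReal (-Real.log (1 - ρ)))) *
        ∑' x, stepsLaw q (E x) := by
  set r := Real.toNNReal (-Real.log (1 - ρ)) with hr
  have hsub : {ω : Sample | ∃ x i, 1 ≤ i ∧ i ≤ ω.1 x ∧ ω.2 x i ∈ E x} ⊆ ⋃ x : ℤ, ⋃ i : ℕ,
      ((fun N : ℤ → ℕ => N x) ⁻¹' {n | 1 ≤ i ∧ i ≤ n}) ×ˢ
        ((fun w : ℤ → ℕ → ℕ → ℤ => w x) ⁻¹' ((fun v : ℕ → ℕ → ℤ => v i) ⁻¹' E x)) :=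
    fun ω ⟨x, i, h₁, h₂, h₃⟩ => mem_iUnion.2 ⟨x, mem_iUnion.2 ⟨i, ⟨h₁, h₂⟩, h₃⟩⟩
  refine (measure_mono hsub).trans ((measure_iUnion_le _).trans ?_)
  rw [← ENNReal.tsum_mul_left]
  refine ENNReal.tsum_le_tsum fun x => (measure_iUnion_le _).trans ?_
  refine le_trans ?_ (mul_le_mul_left (tsum_poissonMeasure_le r) _)
  rw [← ENNReal.tsum_mul_right]
  refine ENNReal.tsum_le_tsum fun i => le_of_eq ?_
  rw [sampleLaw, Measure.prod_prod]
  refine congrArg₂ (· * ·) ?_ ?_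
  · exact (measurePreserving_eval_infinitePi (fun _ : ℤ => poissonMeasure r) x).measure_preimage
      MeasurableSet.of_discrete.nullMeasurableSet
  · exact ((measurePreserving_eval_infinitePi (fun _ : ℤ => Measure.infinitePi fun _ : ℕ =>
      stepsLaw q) x).measure_preimage
      (measurable_pi_apply i (hE x)).nullMeasurableSet).trans
      ((measurePreserving_eval_infinitePi (fun _ : ℕ => stepsLaw q) i).measure_preimage
      (hE x).nullMeasurableSet)

/-- Hoeffding's lemma for a centred variable in `[-1, 1]`; the parameter is the squared half-length
of the interval. -/
theorem hasSubgaussianMGF_stepLaw :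
    HasSubgaussianMGF (fun z : ℤ => (z : ℝ)) 1 (stepLaw q) := by
  have h := hasSubgaussianMGF_of_mem_Icc_of_integral_eq_zero (X := fun z : ℤ => (z : ℝ))
    (μ := stepLaw q) (a := -1) (b := 1) (measurable_of_countable _).aemeasurable
    ((ae_abs_le_stepLaw q).mono fun z hz => abs_le.1 (by exact_mod_cast hz)) (by
      have hd : ∀ (c : ℝ) (a : ℤ), Integrable (fun z : ℤ => (z : ℝ))
          (ENNReal.ofReal c • Measure.dirac a) := fun c a =>
        (integrable_dirac (by simp)).smul_measure ENNReal.ofReal_ne_top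
      rw [stepLaw, integral_add_measure ((hd _ _).add_measure (hd _ _)) (hd _ _),
        integral_add_measure (hd _ _) (hd _ _)]
      simp)
  convert h using 1
  norm_num

theorem lintegral_exp_displacement_le (n k : ℕ) (l : ℝ) :
    ∫⁻ w, ENNReal.ofReal (Real.exp (l * displacement w n k)) ∂stepsLaw q ≤
      ENNReal.ofReal (Real.exp (k * l ^ 2 / 2)) := by
  have hind := iIndepFun_infinitePi (P := fun _ : ℕ => stepLaw q)
    (X := fun _ (z : ℤ) => (z : ℝ)) fun _ => measurable_of_countable _
  have hs := HasSubgaussianMGF.sum_of_iIndepFun hind (s := Finset.Ico n (n + k)) (c := fun _ => 1)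
    fun j _ => by
      refine HasSubgaussianMGF.of_map (Y := fun w : ℕ → ℤ => w j)
        (X := fun z : ℤ => (z : ℝ)) (measurable_pi_apply j).aemeasurable ?_
      rw [Measure.infinitePi_map_eval]
      exact hasSubgaussianMGF_stepLaw
  change HasSubgaussianMGF (fun w => displacement w n k) _ (stepsLaw q) at hs
  rw [← ofReal_integral_eq_lintegral_ofReal (hs.integrable_exp_mul l)
    (Filter.Eventually.of_forall fun _ => (Real.exp_pos _).le)]
  refine ENNReal.ofReal_le_ofReal ((hs.mgf_le l).trans (le_of_eq ?_))
  simp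

/-- Bound the crossing indicator by an exponential, with a union over the `K` durations and the two
signs. For fixed steps, the sum over `x` of the factor containing the position at time `n` is
bounded by a constant. No independence of past and future is needed, and `n` disappears. -/
theorem tsum_stepsLaw_crosses_le {l : ℝ} (hl : 0 < l) (n K : ℕ) (M d : ℝ) :
    ∑' x : ℤ, stepsLaw q {w | Crosses x w n K M d} ≤
      ENNReal.ofReal (Real.exp l * (2 * (1 + 1 / l)) * Real.exp (-(l * d)) * K *
        (2 * Real.exp (K * l ^ 2 / 2))) := by
  have hpt : ∀ (x : ℤ) (w : ℕ → ℤ),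
      {w | Crosses x w n K M d}.indicator (1 : (ℕ → ℤ) → ℝ≥0∞) w ≤
      ENNReal.ofReal (Real.exp (-(l * |((x + ∑ j ∈ Finset.range n, w j : ℤ) : ℝ) - M|))) *
        (ENNReal.ofReal (Real.exp (-(l * d))) * ∑ k ∈ Finset.range K,
          (ENNReal.ofReal (Real.exp (l * displacement w n k)) +
            ENNReal.ofReal (Real.exp (-l * displacement w n k)))) := fun x w => by
    refine indicator_apply_le' (fun hw => ?_) fun _ => bot_le
    obtain ⟨k, hk, hc⟩ : Crosses x w n K M d := hw
    refine le_trans ?_ (mul_le_mul_right (mul_le_mul_right (Finset.single_le_sum_of_canonicallyOrdered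
      (f := fun k => ENNReal.ofReal (Real.exp (l * displacement w n k)) +
        ENNReal.ofReal (Real.exp (-l * displacement w n k))) (Finset.mem_range.2 hk)) _) _)
    rw [← ENNReal.ofReal_add (Real.exp_pos _).le (Real.exp_pos _).le,
      ← ENNReal.ofReal_mul (Real.exp_pos _).le, ← ENNReal.ofReal_mul (Real.exp_pos _).le,
      Pi.one_apply, ENNReal.one_le_ofReal]
    have h₁ : Real.exp (l * |displacement w n k|) ≤
        Real.exp (l * displacement w n k) + Real.exp (-l * displacement w n k) := by
      rcases abs_choice (displacement w n k) with h | h <;> rw [h]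
      · linarith [Real.exp_pos (-l * displacement w n k)]
      · rw [mul_neg, neg_mul]
        linarith [Real.exp_pos (l * displacement w n k)]
    refine le_trans ?_ (mul_le_mul_of_nonneg_left (mul_le_mul_of_nonneg_left h₁
      (Real.exp_pos _).le) (Real.exp_pos _).le)
    rw [← Real.exp_add, ← Real.exp_add]
    refine Real.one_le_exp ?_
    nlinarith
  have hmd : ∀ (k : ℕ) (a : ℝ), Measurable fun w : ℕ → ℤ =>
      ENNReal.ofReal (Real.exp (a * displacement w n k)) := fun k a => by
    have := measurable_displacement n k
    fun_prop
  have hma : ∀ k, Measurable fun w : ℕ → ℤ => ENNReal.ofReal (Real.exp (l * displacement w n k)) +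
      ENNReal.ofReal (Real.exp (-l * displacement w n k)) := fun k => (hmd k l).add (hmd k (-l))
  have hmp : ∀ x : ℤ, Measurable fun w : ℕ → ℤ => ENNReal.ofReal
      (Real.exp (-(l * |((x + ∑ j ∈ Finset.range n, w j : ℤ) : ℝ) - M|))) := fun x => by
    have hp : Measurable fun w : ℕ → ℤ => ((x + ∑ j ∈ Finset.range n, w j : ℤ) : ℝ) :=
      (measurable_of_countable (fun z : ℤ => (z : ℝ))).comp (by fun_prop)
    fun_prop
  have hexp : ∀ k < K, ∀ a : ℝ, a ^ 2 = l ^ 2 →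
      ∫⁻ w, ENNReal.ofReal (Real.exp (a * displacement w n k)) ∂stepsLaw q ≤
      ENNReal.ofReal (Real.exp (K * l ^ 2 / 2)) := fun k hk a ha => by
    refine (lintegral_exp_displacement_le n k a).trans (ENNReal.ofReal_le_ofReal
      (Real.exp_le_exp.2 ?_))
    rw [ha]
    have : (k : ℝ) ≤ K := by exact_mod_cast hk.le
    gcongr
  calc ∑' x : ℤ, stepsLaw q {w | Crosses x w n K M d}
      = ∑' x : ℤ, ∫⁻ w, {w | Crosses x w n K M d}.indicator 1 w ∂stepsLaw q :=
        tsum_congr fun x => (lintegral_indicator_one (measurableSet_crosses x n K M d)).symm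
    _ ≤ ∑' x : ℤ, ∫⁻ w, ENNReal.ofReal
          (Real.exp (-(l * |((x + ∑ j ∈ Finset.range n, w j : ℤ) : ℝ) - M|))) *
        (ENNReal.ofReal (Real.exp (-(l * d))) * ∑ k ∈ Finset.range K,
          (ENNReal.ofReal (Real.exp (l * displacement w n k)) +
            ENNReal.ofReal (Real.exp (-l * displacement w n k)))) ∂stepsLaw q :=
        ENNReal.tsum_le_tsum fun x => lintegral_mono (hpt x)
    _ = ∫⁻ w, (∑' x : ℤ, ENNReal.ofReal
          (Real.exp (-(l * |((x + ∑ j ∈ Finset.range n, w j : ℤ) : ℝ) - M|)))) *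
        (ENNReal.ofReal (Real.exp (-(l * d))) * ∑ k ∈ Finset.range K,
          (ENNReal.ofReal (Real.exp (l * displacement w n k)) +
            ENNReal.ofReal (Real.exp (-l * displacement w n k)))) ∂stepsLaw q := by
        simp_rw [← ENNReal.tsum_mul_right]
        refine (lintegral_tsum fun x => ((hmp x).mul (Measurable.const_mul
          (Finset.measurable_sum _ fun k _ => hma k) _)).aemeasurable).symm
    _ ≤ ∫⁻ w, ENNReal.ofReal (Real.exp l * (2 * (1 + 1 / l))) *
        (ENNReal.ofReal (Real.exp (-(l * d))) * ∑ k ∈ Finset.range K,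
          (ENNReal.ofReal (Real.exp (l * displacement w n k)) +
            ENNReal.ofReal (Real.exp (-l * displacement w n k)))) ∂stepsLaw q :=
        lintegral_mono fun w => mul_le_mul_left (tsum_exp_neg_abs_add_le hl _ M) _
    _ = ENNReal.ofReal (Real.exp l * (2 * (1 + 1 / l))) *
        (ENNReal.ofReal (Real.exp (-(l * d))) * ∑ k ∈ Finset.range K,
          (∫⁻ w, ENNReal.ofReal (Real.exp (l * displacement w n k)) ∂stepsLaw q +
            ∫⁻ w, ENNReal.ofReal (Real.exp (-l * displacement w n k)) ∂stepsLaw q)) := by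
        rw [lintegral_const_mul _ (Measurable.const_mul
          (Finset.measurable_sum _ fun k _ => hma k) _),
          lintegral_const_mul _ (Finset.measurable_sum _ fun k _ => hma k),
          lintegral_finsetSum _ fun k _ => hma k]
        simp_rw [fun k => lintegral_add_left (μ := stepsLaw q) (hmd k l)
          fun w => ENNReal.ofReal (Real.exp (-l * displacement w n k))]
    _ ≤ ENNReal.ofReal (Real.exp l * (2 * (1 + 1 / l))) *
        (ENNReal.ofReal (Real.exp (-(l * d))) * ∑ k ∈ Finset.range K,
          ENNReal.ofReal (2 * Real.exp (K * l ^ 2 / 2))) := by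
        gcongr with k hk
        rw [two_mul, ENNReal.ofReal_add (Real.exp_pos _).le (Real.exp_pos _).le]
        exact add_le_add (hexp k (Finset.mem_range.1 hk) l rfl)
          (hexp k (Finset.mem_range.1 hk) (-l) (by ring))
    _ = _ := by
        rw [Finset.sum_const, Finset.card_range, nsmul_eq_mul, ← ENNReal.ofReal_natCast,
          ← ENNReal.ofReal_mul (by positivity), ← ENNReal.ofReal_mul (by positivity),
          ← ENNReal.ofReal_mul (by positivity)]
        congr 1
        ring

end Law

end PCRW

/-! ### Decorrelation for the Poisson cloud -/

namespace PCRW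

theorem env_eq_envOn {D : Set ℤ} {s t : ℝ≥0} {y : ℤ} {ω : Sample}
    (h : ∀ x i, 1 ≤ i → i ≤ ω.1 x → walk ω x i t = y → walk ω x i s ∈ D) :
    env ω t y = envOn D s ω t y := by
  unfold env envOn
  congr 1
  ext ⟨x, i⟩
  exact ⟨fun ⟨h₁, h₂, h₃⟩ => ⟨h₁, h₂, h₃, h x i h₁ h₂ h₃⟩, fun ⟨h₁, h₂, h₃, _⟩ => ⟨h₁, h₂, h₃⟩⟩

theorem walk_eq_add_displacement (ω : Sample) (x : ℤ) (i : ℕ) {s t : ℝ≥0} (hst : s ≤ t) :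
    (walk ω x i t : ℝ) = walk ω x i s + displacement (ω.2 x i) ⌊s⌋₊ (⌊t⌋₊ - ⌊s⌋₊) := by
  have h : ⌊s⌋₊ ≤ ⌊t⌋₊ := Nat.floor_mono hst
  rw [walk, walk, displacement, Nat.add_sub_cancel' h]
  push_cast
  rw [add_assoc, Finset.range_eq_Ico, Finset.range_eq_Ico,
    Finset.sum_Ico_consecutive _ (Nat.zero_le _) h]

theorem abs_walk_sub_add_lt {ω : Sample} {x : ℤ} {i : ℕ} {s t : ℝ≥0} {H M d : ℝ}
    (hst : s ≤ t) (hts : (t : ℝ) ≤ s + H)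
    (h : ¬Crosses x (ω.2 x i) ⌊s⌋₊ (⌊H⌋₊ + 2) M d) :
    |(walk ω x i t : ℝ) - walk ω x i s| < |(walk ω x i s : ℝ) - M| + d := by
  by_contra! hc
  -- A time interval of length at most `H` can contain `⌊H⌋₊ + 1` integer times, hence the strict
  -- bound `⌊H⌋₊ + 2` on the number of jumps.
  refine h ⟨⌊t⌋₊ - ⌊s⌋₊, ?_, ?_⟩
  · have h₁ : (⌊t⌋₊ : ℝ) ≤ t := by exact_mod_cast Nat.floor_le (zero_le (a := t))
    have h₂ : (s : ℝ) < ⌊s⌋₊ + 1 := by exact_mod_cast Nat.lt_floor_add_one s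
    have h₃ := Nat.lt_floor_add_one H
    have h₄ : (⌊t⌋₊ : ℝ) < ⌊s⌋₊ + (⌊H⌋₊ + 2) := by linarith
    have h₅ : ⌊t⌋₊ < ⌊s⌋₊ + (⌊H⌋₊ + 2) := by exact_mod_cast h₄
    omega
  · rw [walk_eq_add_displacement ω x i hst, add_sub_cancel_left] at hc
    exact hc

section Law

variable {q ρ : ℝ} [hstep : IsProbabilityMeasure (stepLaw q)]

theorem tsum_stepsLaw_crosses_le_exp {h : ℝ} (hh : 1 ≤ h) (n : ℕ) {M d : ℝ}
    (hd : h ^ 3 / 2 ≤ d) :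
    ∑' x : ℤ, stepsLaw q {w | Crosses x w n (⌊h ^ 4⌋₊ + 2) M d} ≤
      ENNReal.ofReal (Real.exp 28 * 12960 * Real.exp (-h)) := by
  have h0 : 0 < h := by linarith
  have h2 : 1 ≤ h ^ 2 := one_le_pow₀ hh
  have h4 : 1 ≤ h ^ 4 := one_le_pow₀ hh
  -- This gives `l * (h ^ 3 / 2) = 2 * h`, and keeps `l ^ 2` times the number of steps bounded.
  set l : ℝ := 4 / h ^ 2 with hl
  have hl0 : 0 < l := by positivity
  have hl4 : l ≤ 4 := div_le_self (by norm_num) h2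
  refine (tsum_stepsLaw_crosses_le hl0 n _ M d).trans (ENNReal.ofReal_le_ofReal ?_)
  have b₁ : 2 * (1 + 1 / l) ≤ 3 * h ^ 2 := by
    have e : 1 / l = h ^ 2 / 4 := by rw [hl]; field_simp
    rw [e]
    linarith
  have b₂ : Real.exp (-(l * d)) ≤ Real.exp (-(2 * h)) := by
    refine Real.exp_le_exp.2 ?_
    have e₁ : l * (h ^ 3 / 2) = 2 * h := by rw [hl]; field_simp; norm_num
    have e₂ : l * (h ^ 3 / 2) ≤ l * d := by gcongr
    linarith
  have b₃ : ((⌊h ^ 4⌋₊ + 2 : ℕ) : ℝ) ≤ 3 * h ^ 4 := by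
    push_cast
    linarith [Nat.floor_le (show 0 ≤ h ^ 4 by positivity)]
  have b₄ : Real.exp (((⌊h ^ 4⌋₊ + 2 : ℕ) : ℝ) * l ^ 2 / 2) ≤ Real.exp 24 := by
    refine Real.exp_le_exp.2 ?_
    calc ((⌊h ^ 4⌋₊ + 2 : ℕ) : ℝ) * l ^ 2 / 2 ≤ 3 * h ^ 4 * l ^ 2 / 2 := by gcongr
      _ = 24 := by rw [hl]; field_simp; norm_num
  calc Real.exp l * (2 * (1 + 1 / l)) * Real.exp (-(l * d)) * ((⌊h ^ 4⌋₊ + 2 : ℕ) : ℝ) *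
        (2 * Real.exp (((⌊h ^ 4⌋₊ + 2 : ℕ) : ℝ) * l ^ 2 / 2))
      ≤ Real.exp 4 * (3 * h ^ 2) * Real.exp (-(2 * h)) * (3 * h ^ 4) * (2 * Real.exp 24) := by
        gcongr
    _ = Real.exp 4 * Real.exp 24 * 18 * (h ^ 6 * Real.exp (-(2 * h))) := by ring
    _ ≤ Real.exp 4 * Real.exp 24 * 18 * (720 * Real.exp (-h)) := by
      have := pow_six_mul_exp_le h0.le
      gcongr
    _ = Real.exp 28 * 12960 * Real.exp (-h) := by
      rw [← Real.exp_add, show (4 + 24 : ℝ) = 28 by norm_num]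
      ring

end Law

/-- Decorrelation of distant boxes for the Poisson cloud of random walks. -/
theorem exists_covariance_le (ρ : ℝ) {q : ℝ} (hq₀ : 0 < q) (hq₁ : q < 1) :
    ∃ c : ℝ, 0 < c ∧ ∀ (H : ℝ) (y₁ y₂ : ℝ × ℝ), 1 ≤ H → y₁.2 = y₂.2 →
      H ^ (3 / 4 : ℝ) ≤ y₂.1 - y₁.1 → ∀ f₁ f₂ : Trajectory ℕ → ℝ,
        (∀ η, 0 ≤ f₁ η ∧ f₁ η ≤ 1) → (∀ η, 0 ≤ f₂ η ∧ f₂ η ≤ 1) →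
        SupportedOn f₁ (leftBox H y₁) → SupportedOn f₂ (rightBox H y₂) →
        cov[f₁, f₂; law q ρ] ≤ c * Real.exp (-H ^ (1 / 4 : ℝ)) := by
  have : IsProbabilityMeasure (stepLaw q) := by
    constructor
    have : 0 ≤ (1 - q) / 2 := by linarith
    simp [stepLaw, ← ENNReal.ofReal_add, this, hq₀.le, add_nonneg]
    ring_nf
  set m : ℝ≥0∞ := ∫⁻ n : ℕ, (n : ℝ≥0∞) ∂poissonMeasure (Real.toNNReal (-Real.log (1 - ρ)))
    with hm
  have hmtop : m ≠ ∞ := (lintegral_natCast_poissonMeasure_lt_top _).ne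
  -- The 3 comes from `covariance_le_of_indepFun`; adding 1 to the Poisson mean keeps the constant
  -- positive.
  refine ⟨3 * ((m.toReal + 1) * (Real.exp 28 * 12960)), by positivity, ?_⟩
  intro H y₁ y₂ hH hy hd f₁ f₂ h₁ h₂ s₁ s₂
  obtain ⟨h, hh, rfl, e₁, e₃⟩ := exists_fourth_root hH
  rw [e₃] at hd
  rw [e₁, mul_assoc 3, mul_assoc (m.toReal + 1)]
  set s : ℝ≥0 := y₁.2.toNNReal with hs
  set M : ℝ := (y₁.1 + y₂.1) / 2 with hM
  -- The distance from the midpoint `M` to either box.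
  set d : ℝ := (y₂.1 - y₁.1) / 2 with hdd
  have hsle : ∀ t : ℝ≥0, y₁.2 ≤ t → s ≤ t := fun t ht => Real.toNNReal_le_iff_le_coe.2 ht
  have hles : y₁.2 ≤ s := Real.le_coe_toNNReal _
  rw [law, covariance_map_fun s₁.measurable.aestronglyMeasurable
    s₂.measurable.aestronglyMeasurable measurable_env.aemeasurable]
  refine covariance_le_of_indepFun (X₁ := f₁ ∘ env) (X₂ := f₂ ∘ env)
    (ε := (m.toReal + 1) * (Real.exp 28 * 12960 * Real.exp (-h)))
    (A := {ω | ∃ x i, 1 ≤ i ∧ i ≤ ω.1 x ∧ ω.2 x i ∈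
      {w | Crosses x w ⌊s⌋₊ (⌊h ^ 4⌋₊ + 2) M d}})
    (Y₁ := f₁ ∘ envOn {z | (z : ℝ) < M} s) (Y₂ := f₂ ∘ envOn {z | (z : ℝ) < M}ᶜ s)
    (s₁.measurable.comp measurable_env) (s₂.measurable.comp measurable_env)
    (s₁.measurable.comp (measurable_envOn _ s)) (s₂.measurable.comp (measurable_envOn _ s))
    (fun _ => h₁ _) (fun _ => h₂ _) (fun _ => h₁ _) (fun _ => h₂ _)
    ((indepFun_envOn_compl (q := q) (ρ := ρ) _ s).comp s₁.measurable s₂.measurable) (by positivity) ?_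
    (Filter.Eventually.of_forall fun ω hω => ?_) (Filter.Eventually.of_forall fun ω hω => ?_)
  · refine (measure_exists_walk_le fun x => measurableSet_crosses x _ _ _ _).trans ?_
    rw [ENNReal.ofReal_mul (by positivity)]
    refine mul_le_mul' ?_ (tsum_stepsLaw_crosses_le_exp hh _ (by linarith))
    rw [ENNReal.le_ofReal_iff_toReal_le hmtop (by positivity)]
    linarith
  -- A walk at or to the right of `M` at time `s` that is seen in the left box would have moved at
  -- least its distance to `M` plus `d`, which is excluded off the exceptional set.
  · refine s₁.congr fun y t hyt => env_eq_envOn fun x i hi hN hw => ?_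
    have hlt := abs_walk_sub_add_lt (hsle t hyt.2.1)
      (hyt.2.2.trans (by simpa using hles)) fun hc => hω ⟨x, i, hi, hN, hc⟩
    rw [hw] at hlt
    by_contra! hge
    have hge' : M ≤ walk ω x i s := not_lt.1 hge
    have hy' : (y : ℝ) ≤ y₁.1 := hyt.1.2
    rw [abs_of_nonneg (by linarith : 0 ≤ (walk ω x i s : ℝ) - M)] at hlt
    linarith [neg_abs_le ((y : ℝ) - walk ω x i s)]
  · refine s₂.congr fun y t hyt => env_eq_envOn fun x i hi hN hw => ?_
    have ht₁ : y₁.2 ≤ t := by rw [hy]; exact hyt.2.1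
    have ht₂ : (t : ℝ) ≤ y₁.2 + h ^ 4 := by rw [hy]; exact hyt.2.2
    have hlt := abs_walk_sub_add_lt (hsle t ht₁)
      (ht₂.trans (by simpa using hles)) fun hc => hω ⟨x, i, hi, hN, hc⟩
    rw [hw] at hlt
    intro hge
    have hge' : (walk ω x i s : ℝ) < M := hge
    have hy' : y₂.1 ≤ (y : ℝ) := hyt.1.1
    rw [abs_of_nonpos (by linarith : (walk ω x i s : ℝ) - M ≤ 0)] at hlt
    linarith [le_abs_self ((y : ℝ) - walk ω x i s)]

end PCRW

theorem proposition4p1 (ρ : ℝ) (hρ₀ : 0 < ρ) (hρ₁ : ρ < 1) :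
    (∀ γ : ℝ, 0 < γ → ∃ c : ℝ, 0 < c ∧
      ∀ (H : ℝ) (y₁ y₂ : ℝ × ℝ), 1 ≤ H → y₁.2 = y₂.2 → H ^ (3 / 4 : ℝ) ≤ y₂.1 - y₁.1 →
      ∀ f₁ f₂ : Trajectory (Fin 2) → ℝ,
        (∀ η, 0 ≤ f₁ η ∧ f₁ η ≤ 1) → (∀ η, 0 ≤ f₂ η ∧ f₂ η ≤ 1) →
        SupportedOn f₁ (leftBox H y₁) → SupportedOn f₂ (rightBox H y₂) →
        cov[f₁, f₂; SSEP.law γ ρ] ≤ c * Real.exp (-H ^ (1 / 4 : ℝ))) ∧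
    (∀ q : ℝ, 0 < q → q < 1 → ∃ c : ℝ, 0 < c ∧
      ∀ (H : ℝ) (y₁ y₂ : ℝ × ℝ), 1 ≤ H → y₁.2 = y₂.2 → H ^ (3 / 4 : ℝ) ≤ y₂.1 - y₁.1 →
      ∀ f₁ f₂ : Trajectory ℕ → ℝ,
        (∀ η, 0 ≤ f₁ η ∧ f₁ η ≤ 1) → (∀ η, 0 ≤ f₂ η ∧ f₂ η ≤ 1) →
        SupportedOn f₁ (leftBox H y₁) → SupportedOn f₂ (rightBox H y₂) →
        cov[f₁, f₂; PCRW.law q ρ] ≤ c * Real.exp (-H ^ (1 / 4 : ℝ))) :=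
  ⟨fun _ hγ => SSEP.exists_covariance_le hρ₀ hρ₁ hγ,
    fun _ hq₀ hq₁ => PCRW.exists_covariance_le ρ hq₀ hq₁⟩
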